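/- Let $K$ be a field of characteristic different from $2$, let $q\in K\setminus\{0\}$ with $q^2\neq 1$, and let $n\geq 2$. Let $\boldsymbol\lambda=(\lambda_1,\dots,\lambda_l)$ be a tuple of elements of $K\setminus\{0\}$ such that the sets $I_{\lambda_a}=\{\lambda_a^{\epsilon}q^{2m}\mid \epsilon\in\{1,-1\},\ m\in\mathbb Z\}$ are pairwise disjoint, and let $S_{\boldsymbol\lambda}=I_{\lambda_1}\cup\dots\cup I_{\lambda_l}$. For $i,j\in S_{\boldsymbol\lambda}$ write $i\to j$ if $j=q^2i\neq q^{-2}i$; $i\leftarrow j$ if $j=q^{-2}i\neq q^2i$; $i\leftrightarrow j$ if $j=q^2i=q^{-2}i$; and $i\nleftrightarrow j$ if $j\notin\{i,q^2i,q^{-2}i\}$. Write $r_0(i_1,\dots,i_n)=(i_1^{-1},i_2,\dots,i_n)$, let $r_b=s_b$ exchange the entries in positions $b,b+1$ ($1\le b\le n-1$), and put $s_0(i_1,\dots,i_n)=(i_2^{-1},i_1^{-1},i_3,\dots,i_n)$. Let $\beta\subset (S_{\boldsymbol\lambda})^n$ be finite and stable under $r_0,\dots,r_{n-1}$. Let $\pi_b$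 be the transposition $(b\;\,b+1)$. Let $W(D_n)$ be the group generated by the reflections in the roots $\pm\varepsilon_i\pm\varepsilon_j$ ($i\neq j$) of $\mathbb Z^n$, with simple reflections $s_0,\dots,s_{n-1}$ in the simple roots $\varepsilon_1+\varepsilon_2$ and $\varepsilon_{b+1}-\varepsilon_b$ ($1\le b\le n-1$). Common relations. Consider generators $\psi_a$ ($0\le a\le n-1$), $y_j$ ($1\le j\le n$), $e(\mathbf i)$ ($\mathbf i\in\beta$), and the following relations, for all admissible indices with $b,b'\geq 1$ and all $\mathbf i,\mathbf j\in\beta$: $\sum_{\mathbf i\in\beta}e(\mathbf i)=1$; $e(\mathbf i)e(\mathbf j)=\delta_{\mathbf i,\mathbf j}e(\mathbf i)$; $y_jy_{j'}=y_{j'}y_j$; $y_je(\mathbf i)=e(\mathbf i)y_j$; $\psi_be(\mathbf i)=e(r_b\mathbf i)\psi_b$; $\psi_b\psi_{b'}=\psi_{b'}\psi_b$ if $|b-b'|>1$; $(\psi_by_j-y_{\pi_b(j)}\psi_b)e(\mathbf i)$ equals $-e(\mathbf i)$ if $j=b$, $i_b=i_{b+1}$; $e(\mathbf i)$ if $j=b+1$,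 $i_b=i_{b+1}$; and $0$ otherwise; $\psi_b^2e(\mathbf i)$ equals $0$, $e(\mathbf i)$, $(y_{b+1}-y_b)e(\mathbf i)$, $(y_b-y_{b+1})e(\mathbf i)$, $(y_{b+1}-y_b)(y_b-y_{b+1})e(\mathbf i)$ if respectively $i_b=i_{b+1}$, $i_b\nleftrightarrow i_{b+1}$, $i_b\to i_{b+1}$, $i_b\leftarrow i_{b+1}$, $i_b\leftrightarrow i_{b+1}$; $(\psi_b\psi_{b+1}\psi_b-\psi_{b+1}\psi_b\psi_{b+1})e(\mathbf i)$ equals $e(\mathbf i)$, $-e(\mathbf i)$, $(y_{b+2}-2y_{b+1}+y_b)e(\mathbf i)$ if respectively $i_b=i_{b+2}\to i_{b+1}$, $i_b=i_{b+2}\leftarrow i_{b+1}$, $i_b=i_{b+2}\leftrightarrow i_{b+1}$, and $0$ otherwise. $V^\beta_{\boldsymbol\lambda}$ is the unital $K$-algebra with these generators, the common relations, and: $\psi_0e(\mathbf i)=e(r_0\mathbf i)\psi_0$; $\psi_0\psi_b=\psi_b\psi_0$ for $b>1$; $\psi_0y_1+y_1\psi_0=0$; $\psi_0y_j=y_j\psi_0$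 for $j>1$; $\psi_0^2=1$; $(\psi_0\psi_1)^2=(\psi_1\psi_0)^2$. $W^\beta_{\boldsymbol\lambda}$ is the unital $K$-algebra with generators $\Psi_a$, $y_j$, $e(\mathbf i)$ (same index sets), the common relations with $\Psi$ in place of $\psi$, and: $\Psi_0e(\mathbf i)=e(s_0\mathbf i)\Psi_0$; $\Psi_0\Psi_b=\Psi_b\Psi_0$ for $b=1$ or $b>2$; $\Psi_0y_je(\mathbf i)$ equals $(-y_{\pi_1(j)}\Psi_0+1)e(\mathbf i)$ if $j\in\{1,2\}$, $i_1^{-1}=i_2$; $-y_{\pi_1(j)}\Psi_0e(\mathbf i)$ if $j\in\{1,2\}$, $i_1^{-1}\neq i_2$; and $y_j\Psi_0e(\mathbf i)$ if $j>2$; $\Psi_0^2e(\mathbf i)$ equals $0$, $e(\mathbf i)$, $(y_1+y_2)e(\mathbf i)$, $-(y_1+y_2)e(\mathbf i)$, $-(y_1+y_2)^2e(\mathbf i)$ if respectively $i_1^{-1}=i_2$, $i_1^{-1}\nleftrightarrow i_2$, $i_1^{-1}\to i_2$, $i_1^{-1}\leftarrow i_2$, $i_1^{-1}\leftrightarrow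 i_2$; and, if $n\ge 3$, $(\Psi_0\Psi_2\Psi_0-\Psi_2\Psi_0\Psi_2)e(\mathbf i)$ equals $e(\mathbf i)$, $-e(\mathbf i)$, $(y_3-2y_2-y_1)e(\mathbf i)$ if respectively $i_1^{-1}=i_3\to i_2$, $i_1^{-1}=i_3\leftarrow i_2$, $i_1^{-1}=i_3\leftrightarrow i_2$, and $0$ otherwise. Let $\rho$ be the involutive automorphism of $V^\beta_{\boldsymbol\lambda}$ with $\psi_0\mapsto-\psi_0$ that fixes all the other generators. For every $w\in W(D_n)$ fix a reduced expression $w=s_{a_1}\cdots s_{a_k}$ and put $\Psi_w=\Psi_{a_1}\cdots\Psi_{a_k}\in W^\beta_{\boldsymbol\lambda}$. **Theorem (Basis Theorem 2).** \label{prop:fixed point VV is SVV} (1) The elements $y_1^{m_1}\cdots y_n^{m_n}\Psi_we(\mathbf i)$, with $w\in W(D_n)$, $(m_1,\dots,m_n)\in(\mathbb Z_{\ge0})^n$ and $\mathbf i\in\beta$, are pairwise distinct and form a $K$-basis of $W^\beta_{\boldsymbol\lambda}$. (2) There is an isomorphism of $K$-algebras from $W^\beta_{\boldsymbol\lambda}$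 onto the subalgebra $\{x\in V^\beta_{\boldsymbol\lambda}\mid\rho(x)=x\}$ with $\Psi_0\mapsto\psi_0\psi_1\psi_0$, $\Psi_b\mapsto\psi_b$ ($1\le b\le n-1$), $y_j\mapsto y_j$ ($1\le j\le n$) and $e(\mathbf i)\mapsto e(\mathbf i)$ ($\mathbf i\in\beta$). -/

import Mathlib

namespace QuiverHecke

/-! ### The vertex set and the arrows of the quiver -/

section Quiver

variable {K : Type*} [Field K]

/-- The set `I_lam` of all `lam ^ ε * q ^ (2 m)` with `ε = 1` or `ε = -1` and `m` an integer. -/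
def vertexClass (q lam : K) : Set K :=
  {x | ∃ ε m : ℤ, (ε = 1 ∨ ε = -1) ∧ x = lam ^ ε * q ^ (2 * m)}

/-- The vertex set, the union of the sets `I_{lam a}`. -/
def vertexSet (q : K) {l : ℕ} (lam : Fin l → K) : Set K :=
  ⋃ a, vertexClass q (lam a)

/-- `i → j` : `j = q² i ≠ q⁻² i`. -/
def ArrowTo (q i j : K) : Prop := j = q ^ 2 * i ∧ q ^ 2 * i ≠ (q ^ 2)⁻¹ * i

/-- `i ← j` : `j = q⁻² i ≠ q² i`. -/
def ArrowFrom (q i j : K) : Prop := j = (q ^ 2)⁻¹ * i ∧ (q ^ 2)⁻¹ * i ≠ q ^ 2 * i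

/-- `i ↔ j` : `j = q² i = q⁻² i`. -/
def ArrowBoth (q i j : K) : Prop := j = q ^ 2 * i ∧ q ^ 2 * i = (q ^ 2)⁻¹ * i

/-- `i` and `j` are distinct and not joined by an arrow. -/
def NoArrow (q i j : K) : Prop := i ≠ j ∧ j ≠ q ^ 2 * i ∧ j ≠ (q ^ 2)⁻¹ * i

end Quiver

/-! ### The Weyl group of type D and reduced expressions -/

section Weyl

/-- The root system of type D: the vectors `± ε_i ± ε_j` with `i ≠ j`. -/
def rootsD (n : ℕ) : Set (Fin n → ℤ) :=
  {α | ∃ (i j : Fin n) (σ τ : ℤ), i ≠ j ∧ (σ = 1 ∨ σ = -1) ∧ (τ = 1 ∨ τ = -1) ∧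
    α = Pi.single i σ + Pi.single j τ}

/-- The reflection `x ↦ x - α^∨(x) α`. It is used only for roots of type D; these satisfy
`(α, α) = 2`, so that `α^∨(x) = 2 (α, x) / (α, α) = (α, x)`. -/
def rootReflection {n : ℕ} (α : Fin n → ℤ) : Module.End ℤ (Fin n → ℤ) where
  toFun x := x - (α ⬝ᵥ x) • α
  map_add' x y := by rw [dotProduct_add, add_smul]; abel
  map_smul' c x := by
    rw [dotProduct_smul, RingHom.id_apply, smul_sub, smul_assoc]

/-- The Weyl group `W(D_n)`, generated by all reflections in roots of type D. -/
def weylD (n : ℕ) : Subgroup ((Fin n → ℤ) ≃ₗ[ℤ] (Fin n → ℤ)) :=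
  Subgroup.closure
    {g | ∃ α ∈ rootsD n, (g : Module.End ℤ (Fin n → ℤ)) = rootReflection α}

/-- The simple roots: `ε_1 + ε_2` for the index `0`, and `ε_{b+1} - ε_b` for `b = 1, …, n - 1`.
(The coordinate `ε_{k+1}` is the basis vector with index `k : Fin n`.) -/
def simpleRootD {n : ℕ} (a : Fin n) : Fin n → ℤ :=
  if a.val = 0 then fun j => if j.val ≤ 1 then 1 else 0
  else Pi.single a 1 - Pi.single ⟨a.val - 1, by omega⟩ 1

/-- The product `s_{a_1} ⋯ s_{a_k}` of simple reflections. -/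
def wordProdD {n : ℕ} (as : List (Fin n)) : Module.End ℤ (Fin n → ℤ) :=
  (as.map fun a => rootReflection (simpleRootD a)).prod

/-- `as` is a reduced expression of `w` in the simple reflections `s_0, …, s_{n-1}`. -/
def IsReducedD {n : ℕ} (w : weylD n) (as : List (Fin n)) : Prop :=
  wordProdD as = (w : (Fin n → ℤ) ≃ₗ[ℤ] (Fin n → ℤ)).toLinearMap ∧
    ∀ bs : List (Fin n),
      wordProdD bs = (w : (Fin n → ℤ) ≃ₗ[ℤ] (Fin n → ℤ)).toLinearMap → as.length ≤ bs.length

end Weyl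

/-! ### The algebras `V` and `W`

Positions `1, …, n` are indexed by `Fin n` starting from `0`, whereas the index of `psi` is the usual
one. So `psi b` with `b ≠ 0` belongs to the pair of positions `(k, b)` of `Fin n` with `k + 1 = b`,
which is the pair `(b, b + 1)` in the usual numbering. -/

section Algebras

variable {K : Type*} [Field K] {n : ℕ}

/-- Stability under the action of `W(B_n)` on `n`-tuples: `r_0` inverts the first entry, and the other
generators exchange two neighbouring entries. -/
def IsStableB (β : Finset (Fin n → K)) : Prop :=
  (∀ i ∈ β, ∀ z : Fin n, z.val = 0 → Function.update i z (i z)⁻¹ ∈ β) ∧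
  (∀ i ∈ β, ∀ k b : Fin n, k.val + 1 = b.val → i ∘ Equiv.swap k b ∈ β)

/-- The generators `ψ_a` (or `Ψ_a`), `y_j` and `e(i)`. -/
inductive Gen (β : Finset (Fin n → K)) : Type _
  | psi (a : Fin n) : Gen β
  | y (j : Fin n) : Gen β
  | e (i : β) : Gen β

/-- `psi a` in the free algebra. -/
abbrev fpsi (β : Finset (Fin n → K)) (a : Fin n) : FreeAlgebra K (Gen β) := FreeAlgebra.ι K (.psi a)

/-- `y j` in the free algebra. -/
abbrev fy (β : Finset (Fin n → K)) (j : Fin n) : FreeAlgebra K (Gen β) := FreeAlgebra.ι K (.y j)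

/-- `e(i)` in the free algebra. -/
abbrev fe {β : Finset (Fin n → K)} (i : β) : FreeAlgebra K (Gen β) := FreeAlgebra.ι K (.e i)

/-- The defining relations that `V` and `W` have in common: those that do not involve the generator
`psi` with index `0`. -/
inductive RelA (q : K) (β : Finset (Fin n → K)) :
    FreeAlgebra K (Gen β) → FreeAlgebra K (Gen β) → Prop
  | e_sum : RelA q β (∑ i : β, fe i) 1
  | e_idem (i : β) : RelA q β (fe i * fe i) (fe i)
  | e_orth (i j : β) (h : i ≠ j) : RelA q β (fe i * fe j) 0
  | y_comm (j j' : Fin n) : RelA q β (fy β j * fy β j') (fy β j' * fy β j)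
  | y_e (j : Fin n) (i : β) : RelA q β (fy β j * fe i) (fe i * fy β j)
  | psi_e (k b : Fin n) (hb : k.val + 1 = b.val) (i i' : β) (h : i'.1 = i.1 ∘ Equiv.swap k b) :
      RelA q β (fpsi β b * fe i) (fe i' * fpsi β b)
  | psi_y_left (k b : Fin n) (hb : k.val + 1 = b.val) (i : β) (h : i.1 k = i.1 b) :
      RelA q β ((fpsi β b * fy β k - fy β b * fpsi β b) * fe i) (-fe i)
  | psi_y_right (k b : Fin n) (hb : k.val + 1 = b.val) (i : β) (h : i.1 k = i.1 b) :
      RelA q β ((fpsi β b * fy β b - fy β k * fpsi β b) * fe i) (fe i)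
  | psi_y_else (k b : Fin n) (hb : k.val + 1 = b.val) (j : Fin n) (i : β)
      (h : ¬((j = k ∨ j = b) ∧ i.1 k = i.1 b)) :
      RelA q β ((fpsi β b * fy β j - fy β (Equiv.swap k b j) * fpsi β b) * fe i) 0
  | psi_comm (a b : Fin n) (ha : a.val ≠ 0) (hb : b.val ≠ 0)
      (h : a.val + 1 < b.val ∨ b.val + 1 < a.val) :
      RelA q β (fpsi β a * fpsi β b) (fpsi β b * fpsi β a)
  | sq_eq (k b : Fin n) (hb : k.val + 1 = b.val) (i : β) (h : i.1 k = i.1 b) :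
      RelA q β (fpsi β b ^ 2 * fe i) 0
  | sq_none (k b : Fin n) (hb : k.val + 1 = b.val) (i : β) (h : NoArrow q (i.1 k) (i.1 b)) :
      RelA q β (fpsi β b ^ 2 * fe i) (fe i)
  | sq_to (k b : Fin n) (hb : k.val + 1 = b.val) (i : β) (h : ArrowTo q (i.1 k) (i.1 b)) :
      RelA q β (fpsi β b ^ 2 * fe i) ((fy β b - fy β k) * fe i)
  | sq_from (k b : Fin n) (hb : k.val + 1 = b.val) (i : β) (h : ArrowFrom q (i.1 k) (i.1 b)) :
      RelA q β (fpsi β b ^ 2 * fe i) ((fy β k - fy β b) * fe i)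
  | sq_both (k b : Fin n) (hb : k.val + 1 = b.val) (i : β) (h : ArrowBoth q (i.1 k) (i.1 b)) :
      RelA q β (fpsi β b ^ 2 * fe i) ((fy β b - fy β k) * (fy β k - fy β b) * fe i)
  | braid_to (k b c : Fin n) (hb : k.val + 1 = b.val) (hc : b.val + 1 = c.val) (i : β)
      (h : i.1 k = i.1 c ∧ ArrowTo q (i.1 c) (i.1 b)) :
      RelA q β ((fpsi β b * fpsi β c * fpsi β b - fpsi β c * fpsi β b * fpsi β c) * fe i) (fe i)
  | braid_from (k b c : Fin n) (hb : k.val + 1 = b.val) (hc : b.val + 1 = c.val) (i : β)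
      (h : i.1 k = i.1 c ∧ ArrowFrom q (i.1 c) (i.1 b)) :
      RelA q β ((fpsi β b * fpsi β c * fpsi β b - fpsi β c * fpsi β b * fpsi β c) * fe i) (-fe i)
  | braid_both (k b c : Fin n) (hb : k.val + 1 = b.val) (hc : b.val + 1 = c.val) (i : β)
      (h : i.1 k = i.1 c ∧ ArrowBoth q (i.1 c) (i.1 b)) :
      RelA q β ((fpsi β b * fpsi β c * fpsi β b - fpsi β c * fpsi β b * fpsi β c) * fe i)
        ((fy β c - 2 * fy β b + fy β k) * fe i)
  | braid_else (k b c : Fin n) (hb : k.val + 1 = b.val) (hc : b.val + 1 = c.val) (i : β)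
      (h : ¬(i.1 k = i.1 c ∧ (ArrowTo q (i.1 c) (i.1 b) ∨ ArrowFrom q (i.1 c) (i.1 b) ∨
        ArrowBoth q (i.1 c) (i.1 b)))) :
      RelA q β ((fpsi β b * fpsi β c * fpsi β b - fpsi β c * fpsi β b * fpsi β c) * fe i) 0

/-- The defining relations of `V`. Here `z`, `o` are the indices with values `0`, `1`. -/
inductive RelV (q : K) (β : Finset (Fin n → K)) :
    FreeAlgebra K (Gen β) → FreeAlgebra K (Gen β) → Prop
  | common {x x' : FreeAlgebra K (Gen β)} (h : RelA q β x x') : RelV q β x x'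
  | psi0_e (z : Fin n) (hz : z.val = 0) (i i' : β)
      (h : i'.1 = Function.update i.1 z (i.1 z)⁻¹) :
      RelV q β (fpsi β z * fe i) (fe i' * fpsi β z)
  | psi0_comm (z b : Fin n) (hz : z.val = 0) (hb : 1 < b.val) :
      RelV q β (fpsi β z * fpsi β b) (fpsi β b * fpsi β z)
  | psi0_y_first (z : Fin n) (hz : z.val = 0) :
      RelV q β (fpsi β z * fy β z + fy β z * fpsi β z) 0
  | psi0_y (z j : Fin n) (hz : z.val = 0) (hj : j ≠ z) :
      RelV q β (fpsi β z * fy β j) (fy β j * fpsi β z)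
  | psi0_sq (z : Fin n) (hz : z.val = 0) : RelV q β (fpsi β z ^ 2) 1
  | psi0_braid (z o : Fin n) (hz : z.val = 0) (ho : o.val = 1) :
      RelV q β ((fpsi β z * fpsi β o) ^ 2 - (fpsi β o * fpsi β z) ^ 2) 0

/-- The defining relations of `W`. Here `z`, `o`, `t` are the indices with values `0`, `1`, `2`. -/
inductive RelW (q : K) (β : Finset (Fin n → K)) :
    FreeAlgebra K (Gen β) → FreeAlgebra K (Gen β) → Prop
  | common {x x' : FreeAlgebra K (Gen β)} (h : RelA q β x x') : RelW q β x x'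
  | psi0_e (z o : Fin n) (hz : z.val = 0) (ho : o.val = 1) (i i' : β)
      (h : i'.1 = Function.update (Function.update i.1 z (i.1 o)⁻¹) o (i.1 z)⁻¹) :
      RelW q β (fpsi β z * fe i) (fe i' * fpsi β z)
  | psi0_y_eq (z o : Fin n) (hz : z.val = 0) (ho : o.val = 1) (j : Fin n) (hj : j = z ∨ j = o)
      (i : β) (h : (i.1 z)⁻¹ = i.1 o) :
      RelW q β (fpsi β z * fy β j * fe i) ((-fy β (Equiv.swap z o j) * fpsi β z + 1) * fe i)
  | psi0_y_ne (z o : Fin n) (hz : z.val = 0) (ho : o.val = 1) (j : Fin n) (hj : j = z ∨ j = o)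
      (i : β) (h : (i.1 z)⁻¹ ≠ i.1 o) :
      RelW q β (fpsi β z * fy β j * fe i) (-fy β (Equiv.swap z o j) * fpsi β z * fe i)
  | psi0_y_else (z : Fin n) (hz : z.val = 0) (j : Fin n) (hj : 1 < j.val) (i : β) :
      RelW q β (fpsi β z * fy β j * fe i) (fy β j * fpsi β z * fe i)
  | psi0_comm (z b : Fin n) (hz : z.val = 0) (hb : b.val = 1 ∨ 2 < b.val) :
      RelW q β (fpsi β z * fpsi β b) (fpsi β b * fpsi β z)
  | sq0_eq (z o : Fin n) (hz : z.val = 0) (ho : o.val = 1) (i : β) (h : (i.1 z)⁻¹ = i.1 o) :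
      RelW q β (fpsi β z ^ 2 * fe i) 0
  | sq0_none (z o : Fin n) (hz : z.val = 0) (ho : o.val = 1) (i : β)
      (h : NoArrow q (i.1 z)⁻¹ (i.1 o)) :
      RelW q β (fpsi β z ^ 2 * fe i) (fe i)
  | sq0_to (z o : Fin n) (hz : z.val = 0) (ho : o.val = 1) (i : β)
      (h : ArrowTo q (i.1 z)⁻¹ (i.1 o)) :
      RelW q β (fpsi β z ^ 2 * fe i) ((fy β z + fy β o) * fe i)
  | sq0_from (z o : Fin n) (hz : z.val = 0) (ho : o.val = 1) (i : β)
      (h : ArrowFrom q (i.1 z)⁻¹ (i.1 o)) :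
      RelW q β (fpsi β z ^ 2 * fe i) (-(fy β z + fy β o) * fe i)
  | sq0_both (z o : Fin n) (hz : z.val = 0) (ho : o.val = 1) (i : β)
      (h : ArrowBoth q (i.1 z)⁻¹ (i.1 o)) :
      RelW q β (fpsi β z ^ 2 * fe i) (-(fy β z + fy β o) ^ 2 * fe i)
  | braid0_to (z o t : Fin n) (hz : z.val = 0) (ho : o.val = 1) (ht : t.val = 2) (i : β)
      (h : (i.1 z)⁻¹ = i.1 t ∧ ArrowTo q (i.1 t) (i.1 o)) :
      RelW q β ((fpsi β z * fpsi β t * fpsi β z - fpsi β t * fpsi β z * fpsi β t) * fe i) (fe i)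
  | braid0_from (z o t : Fin n) (hz : z.val = 0) (ho : o.val = 1) (ht : t.val = 2) (i : β)
      (h : (i.1 z)⁻¹ = i.1 t ∧ ArrowFrom q (i.1 t) (i.1 o)) :
      RelW q β ((fpsi β z * fpsi β t * fpsi β z - fpsi β t * fpsi β z * fpsi β t) * fe i) (-fe i)
  | braid0_both (z o t : Fin n) (hz : z.val = 0) (ho : o.val = 1) (ht : t.val = 2) (i : β)
      (h : (i.1 z)⁻¹ = i.1 t ∧ ArrowBoth q (i.1 t) (i.1 o)) :
      RelW q β ((fpsi β z * fpsi β t * fpsi β z - fpsi β t * fpsi β z * fpsi β t) * fe i)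
        ((fy β t - 2 * fy β o - fy β z) * fe i)
  | braid0_else (z o t : Fin n) (hz : z.val = 0) (ho : o.val = 1) (ht : t.val = 2) (i : β)
      (h : ¬((i.1 z)⁻¹ = i.1 t ∧ (ArrowTo q (i.1 t) (i.1 o) ∨ ArrowFrom q (i.1 t) (i.1 o) ∨
        ArrowBoth q (i.1 t) (i.1 o)))) :
      RelW q β ((fpsi β z * fpsi β t * fpsi β z - fpsi β t * fpsi β z * fpsi β t) * fe i) 0

/-- The algebra `V` of type B. -/
def AlgV (q : K) (β : Finset (Fin n → K)) : Type _ := RingQuot (RelV q β)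

noncomputable instance (q : K) (β : Finset (Fin n → K)) : Ring (AlgV q β) :=
  inferInstanceAs (Ring (RingQuot (RelV q β)))

noncomputable instance (q : K) (β : Finset (Fin n → K)) : Algebra K (AlgV q β) :=
  inferInstanceAs (Algebra K (RingQuot (RelV q β)))

/-- The quotient map from the free algebra to `V`. -/
noncomputable def mkV (q : K) (β : Finset (Fin n → K)) : FreeAlgebra K (Gen β) →ₐ[K] AlgV q β :=
  RingQuot.mkAlgHom K (RelV q β)

/-- The algebra `W` of type D. -/
def AlgW (q : K) (β : Finset (Fin n → K)) : Type _ := RingQuot (RelW q β)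

noncomputable instance (q : K) (β : Finset (Fin n → K)) : Ring (AlgW q β) :=
  inferInstanceAs (Ring (RingQuot (RelW q β)))

noncomputable instance (q : K) (β : Finset (Fin n → K)) : Algebra K (AlgW q β) :=
  inferInstanceAs (Algebra K (RingQuot (RelW q β)))

/-- The quotient map from the free algebra to `W`. -/
noncomputable def mkW (q : K) (β : Finset (Fin n → K)) : FreeAlgebra K (Gen β) →ₐ[K] AlgW q β :=
  RingQuot.mkAlgHom K (RelW q β)

/-- A generator, seen in `V`. -/
noncomputable def genV (q : K) {β : Finset (Fin n → K)} (g : Gen β) : AlgV q β :=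
  mkV q β (FreeAlgebra.ι K g)

/-- A generator, seen in `W`. -/
noncomputable def genW (q : K) {β : Finset (Fin n → K)} (g : Gen β) : AlgW q β :=
  mkW q β (FreeAlgebra.ι K g)

/-- The element `y_1^{m_1} ⋯ y_n^{m_n} Ψ_{a_1} ⋯ Ψ_{a_k} e(i)` of `W`. -/
noncomputable def monomialW (q : K) {β : Finset (Fin n → K)} (m : Fin n → ℕ) (as : List (Fin n)) (i : β) :
    AlgW q β :=
  (List.ofFn fun j => genW q (Gen.y j) ^ m j).prod * (as.map fun a => genW q (Gen.psi a)).prod *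
    genW q (Gen.e i)

/-! ### The involution `ρ` of `V` -/

/-- The images of the generators under `ρ`: only `ψ_0` changes its sign. -/
noncomputable def rhoGen (q : K) (β : Finset (Fin n → K)) : Gen β → AlgV q β
  | .psi a => if a.val = 0 then -genV q (.psi a) else genV q (.psi a)
  | .y j => genV q (.y j)
  | .e i => genV q (.e i)

lemma rhoGen_lift_psi (q : K) (β : Finset (Fin n → K)) (b : Fin n) (hb : b.val ≠ 0) :
    FreeAlgebra.lift K (rhoGen q β) (fpsi β b) = mkV q β (fpsi β b) := by
  simp [rhoGen, genV, hb]

lemma rhoGen_lift_psi0 (q : K) (β : Finset (Fin n → K)) (z : Fin n) (hz : z.val = 0) :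
    FreeAlgebra.lift K (rhoGen q β) (fpsi β z) = -mkV q β (fpsi β z) := by
  simp [rhoGen, genV, hz]

lemma rhoGen_lift_y (q : K) (β : Finset (Fin n → K)) (j : Fin n) :
    FreeAlgebra.lift K (rhoGen q β) (fy β j) = mkV q β (fy β j) := by
  simp [rhoGen, genV]

lemma rhoGen_lift_e (q : K) (β : Finset (Fin n → K)) (i : β) :
    FreeAlgebra.lift K (rhoGen q β) (fe i) = mkV q β (fe i) := by
  simp [rhoGen, genV]

lemma rhoGen_relA (q : K) (β : Finset (Fin n → K)) {x x' : FreeAlgebra K (Gen β)}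
    (h : RelA q β x x') :
    FreeAlgebra.lift K (rhoGen q β) x = FreeAlgebra.lift K (rhoGen q β) x' := by
  have key : mkV q β x = mkV q β x' := RingQuot.mkAlgHom_rel K (RelV.common h)
  have suc : ∀ {k b : Fin n}, k.val + 1 = b.val → b.val ≠ 0 := fun h => by omega
  cases h
  all_goals
    simp only [map_sum, map_mul, map_sub, map_add, map_neg, map_pow, map_one, map_zero, map_ofNat]
      at key ⊢
    try simp only [rhoGen_lift_y, rhoGen_lift_e]
    try rw [rhoGen_lift_psi q β _ (by first | assumption | exact suc (by assumption))]
    try rw [rhoGen_lift_psi q β _ (by first | assumption | exact suc (by assumption))]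
    exact key

lemma rhoGen_relV (q : K) (β : Finset (Fin n → K)) {x x' : FreeAlgebra K (Gen β)}
    (h : RelV q β x x') :
    FreeAlgebra.lift K (rhoGen q β) x = FreeAlgebra.lift K (rhoGen q β) x' := by
  have key : mkV q β x = mkV q β x' := RingQuot.mkAlgHom_rel K h
  cases h with
  | common h => exact rhoGen_relA q β h
  | psi0_e z hz i i' h =>
    simp only [map_mul] at key ⊢
    rw [rhoGen_lift_psi0 q β z hz, rhoGen_lift_e, rhoGen_lift_e, neg_mul, mul_neg, key]
  | psi0_comm z b hz hb =>
    simp only [map_mul] at key ⊢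
    rw [rhoGen_lift_psi0 q β z hz, rhoGen_lift_psi q β b (by omega), neg_mul, mul_neg, key]
  | psi0_y_first z hz =>
    simp only [map_mul, map_add, map_zero] at key ⊢
    rw [rhoGen_lift_psi0 q β z hz, rhoGen_lift_y, neg_mul, mul_neg, ← neg_add, key, neg_zero]
  | psi0_y z j hz hj =>
    simp only [map_mul] at key ⊢
    rw [rhoGen_lift_psi0 q β z hz, rhoGen_lift_y, neg_mul, mul_neg, key]
  | psi0_sq z hz =>
    simp only [map_pow, map_one] at key ⊢
    rw [rhoGen_lift_psi0 q β z hz, neg_sq, key]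
  | psi0_braid z o hz ho =>
    simp only [map_mul, map_pow, map_sub, map_zero] at key ⊢
    rw [rhoGen_lift_psi0 q β z hz, rhoGen_lift_psi q β o (by omega), neg_mul, mul_neg, neg_sq,
      neg_sq, key]

/-- `ρ` as an endomorphism of `V`. -/
noncomputable def rhoHom (q : K) (β : Finset (Fin n → K)) : AlgV q β →ₐ[K] AlgV q β :=
  RingQuot.liftAlgHom K ⟨FreeAlgebra.lift K (rhoGen q β), fun _ _ h => rhoGen_relV q β h⟩

lemma rhoHom_gen (q : K) (β : Finset (Fin n → K)) (g : Gen β) :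
    rhoHom q β (genV q g) = rhoGen q β g := by
  have h : rhoHom q β (genV q g) = FreeAlgebra.lift K (rhoGen q β) (FreeAlgebra.ι K g) :=
    RingQuot.liftAlgHom_mkAlgHom_apply K _ _ _
  rw [h, FreeAlgebra.lift_ι_apply]

lemma rhoHom_comp (q : K) (β : Finset (Fin n → K)) :
    (rhoHom q β).comp (rhoHom q β) = AlgHom.id K (AlgV q β) := by
  apply RingQuot.ringQuot_ext'
  apply FreeAlgebra.hom_ext
  funext g
  change rhoHom q β (rhoHom q β (genV q g)) = genV q g
  rw [rhoHom_gen]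
  cases g with
  | psi a => by_cases ha : a.val = 0 <;> simp [rhoGen, ha, rhoHom_gen]
  | y j => simp [rhoGen, rhoHom_gen]
  | e i => simp [rhoGen, rhoHom_gen]

/-- The involutive automorphism `ρ` of `V` with `ψ_0 ↦ -ψ_0` that fixes the other generators. -/
noncomputable def rho (q : K) (β : Finset (Fin n → K)) : AlgV q β ≃ₐ[K] AlgV q β :=
  AlgEquiv.ofAlgHom (rhoHom q β) (rhoHom q β) (rhoHom_comp q β) (rhoHom_comp q β)

/-- The subalgebra of the elements `x` of `V` with `ρ x = x`. -/
noncomputable def fixedV (q : K) (β : Finset (Fin n → K)) : Subalgebra K (AlgV q β) :=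
  AlgHom.equalizer (rho q β).toAlgHom (AlgHom.id K (AlgV q β))

end Algebras

end QuiverHecke

/-! Write V and W for the algebras of types B and D. Conjugation by `ψ_0` in V (`conjV`) is an
involution: it sends `y_1` to `-y_1` and `e(i)` to `e(r_0 i)`, and it fixes the other `y_j` and the
`ψ_b` with `b > 1`. The relations of W that involve `Ψ_0` are conjugates of the relations for `ψ_1`,
apart from `Ψ_0 Ψ_1 = Ψ_1 Ψ_0`, which is the four-term braid relation of V. This gives the
homomorphism `phiHom` (`phiGen_relW`). Its image A is stable under the conjugation, so V = A +
A`ψ_0` (`exists_phiHom_add`). Since `ρ` fixes A pointwise and negates `ψ_0`, and 2 is invertible,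
the fixed points of `ρ` are exactly A. What remains is the basis of W and the injectivity of
`phiHom`; one representation yields the linear independence needed for both.

Spanning. The `y_j` can be moved to the left, and words in the `Ψ_a` behave like words in the
Coxeter generators modulo shorter words: two reduced words of the same element agree modulo shorter
words (`psiWord_sub_mem`), and a word that is not reduced is a combination of shorter ones
(`psiWord_mem_of_not_reduced`). The Coxeter theory behind this is derived from the length function
`lenD`, which counts the positive roots that pair negatively with `w ρ`, where here `ρ = (0, 1, …, n
- 1)`. A simple reflection changes it by exactly one, and only the identity has length 0.

Independence. Let L be the field of rational functions in n variables. V acts on functions from `β`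
to L (`repV`): `y_j` multiplies by a variable, `e(i)` is a projection, `ψ_0` inverts the first entry
and negates the first variable, and `ψ_b` combines a reflection with the identity, as a divided
difference up to sign where the two entries agree. Through `phiHom`, a word in the `Ψ_a` sends
functions supported at one tuple to functions supported at one tuple, by an operator `c w + (shorter
elements)` with `c ≠ 0` (`repW_psiWord`). By Dedekind, distinct elements of the Weyl group are
independent over L as operators; triangularity transfers this to the `Ψ_w`, and the monomials in the
variables are independent over K. So the monomials of W act independently. This gives the basis, and
since the action factors through `phiHom`, also its injectivity (`phiHom_injective`). -/

namespace QuiverHecke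

/-! ### The Weyl group of type D: length, descents, reduced words -/

section WeylCombinatorics

variable {n : ℕ}

lemma sq_le_dotProduct_self (v : Fin n → ℤ) (i : Fin n) : v i * v i ≤ v ⬝ᵥ v :=
  Finset.single_le_sum (f := fun j => v j * v j) (fun j _ => mul_self_nonneg (v j))
    (Finset.mem_univ i)

lemma dotProduct_sub_single (v : Fin n → ℤ) (i : Fin n) :
    (v - Pi.single i (v i)) ⬝ᵥ (v - Pi.single i (v i)) = v ⬝ᵥ v - v i * v i := by
  simp [sub_dotProduct, dotProduct_sub]

lemma int_eq_one_or_neg_one {a : ℤ} (h0 : a ≠ 0) (h : a * a ≤ 2) : a = 1 ∨ a = -1 := by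
  have h1 : a ≤ 1 := by nlinarith
  have h2 : -1 ≤ a := by nlinarith
  omega

lemma eq_single_of_dotProduct_self_eq_one {v : Fin n → ℤ} (h : v ⬝ᵥ v = 1) :
    ∃ k σ, (σ = 1 ∨ σ = -1) ∧ v = Pi.single k σ := by
  have hv : v ≠ 0 := by rintro rfl; simp at h
  obtain ⟨k, hk⟩ := Function.ne_iff.1 hv
  have hk1 := int_eq_one_or_neg_one hk ((sq_le_dotProduct_self v k).trans (by omega))
  refine ⟨k, v k, hk1, ?_⟩
  have := dotProduct_sub_single v k
  have hz : v - Pi.single k (v k) = 0 := by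
    apply dotProduct_self_eq_zero.1
    rw [this, h]
    rcases hk1 with h | h <;> rw [h] <;> norm_num
  exact sub_eq_zero.1 hz

/-- A nonzero coordinate of an integral vector of squared length 2 is `1` or `-1`, and removing it
leaves squared length 1. In this form, stability of the roots under isometries is immediate. -/
lemma mem_rootsD_iff {α : Fin n → ℤ} : α ∈ rootsD n ↔ α ⬝ᵥ α = 2 := by
  constructor
  · rintro ⟨i, j, σ, τ, hij, hσ, hτ, rfl⟩
    have : σ * σ + τ * τ = 2 := by
      rcases hσ with rfl | rfl <;> rcases hτ with rfl | rfl <;> norm_num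
    simp [Pi.single_eq_of_ne hij, Pi.single_eq_of_ne hij.symm, this]
  · intro h
    have hv : α ≠ 0 := by rintro rfl; simp at h
    obtain ⟨i, hi⟩ := Function.ne_iff.1 hv
    have hi1 := int_eq_one_or_neg_one hi ((sq_le_dotProduct_self α i).trans (by omega))
    have h1 := dotProduct_sub_single α i
    have h2 : α i * α i = 1 := by rcases hi1 with h | h <;> rw [h] <;> norm_num
    rw [h, h2] at h1
    obtain ⟨j, τ, hτ, hj⟩ := eq_single_of_dotProduct_self_eq_one h1
    refine ⟨i, j, α i, τ, ?_, hi1, hτ, ?_⟩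
    · rintro rfl
      have := congrFun hj i
      simp at this
      omega
    · rw [← hj]; abel

lemma finite_rootsD : (rootsD n).Finite := by
  apply Set.Finite.subset (Set.Finite.pi' (fun _ : Fin n => Set.finite_Icc (-2 : ℤ) 2))
  intro α hα i
  have h := (sq_le_dotProduct_self α i).trans (mem_rootsD_iff.1 hα).le
  constructor <;> nlinarith

lemma rootReflection_apply (α x : Fin n → ℤ) : rootReflection α x = x - (α ⬝ᵥ x) • α := rfl

lemma rootReflection_dot {α : Fin n → ℤ} (hα : α ∈ rootsD n) (x y : Fin n → ℤ) :
    rootReflection α x ⬝ᵥ rootReflection α y = x ⬝ᵥ y := by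
  rw [mem_rootsD_iff] at hα
  simp only [rootReflection_apply, sub_dotProduct, dotProduct_sub, smul_dotProduct, dotProduct_smul,
    hα, smul_eq_mul, dotProduct_comm x α]
  ring

lemma rootReflection_dot_left (α x y : Fin n → ℤ) :
    rootReflection α x ⬝ᵥ y = x ⬝ᵥ rootReflection α y := by
  simp only [rootReflection_apply, sub_dotProduct, dotProduct_sub, smul_dotProduct, dotProduct_smul,
    smul_eq_mul, dotProduct_comm x α]
  ring

lemma rootReflection_self {α : Fin n → ℤ} (hα : α ∈ rootsD n) : rootReflection α α = -α := by
  rw [mem_rootsD_iff] at hα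
  rw [rootReflection_apply, hα, two_smul]; abel

lemma rootReflection_rootReflection {α : Fin n → ℤ} (hα : α ∈ rootsD n) (x : Fin n → ℤ) :
    rootReflection α (rootReflection α x) = x := by
  rw [mem_rootsD_iff] at hα
  simp only [rootReflection_apply, dotProduct_sub, dotProduct_smul, hα, smul_eq_mul]
  rw [sub_sub, ← add_smul]
  ring_nf

lemma rootReflection_mem {α β : Fin n → ℤ} (hα : α ∈ rootsD n) (hβ : β ∈ rootsD n) :
    rootReflection α β ∈ rootsD n := by
  rw [mem_rootsD_iff] at *
  rw [rootReflection_dot (mem_rootsD_iff.2 hα), hβ]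

/-- The reflection in a root, as a linear equivalence. -/
def reflectionEquiv {α : Fin n → ℤ} (hα : α ∈ rootsD n) : (Fin n → ℤ) ≃ₗ[ℤ] (Fin n → ℤ) :=
  LinearEquiv.ofInvolutive (rootReflection α) (rootReflection_rootReflection hα)

@[simp] lemma reflectionEquiv_apply {α : Fin n → ℤ} (hα : α ∈ rootsD n) (x : Fin n → ℤ) :
    reflectionEquiv hα x = rootReflection α x := rfl

/-- The vector `(0, 1, …, n - 1)`, with which every simple root has inner product `1`. -/
def rhoVec (n : ℕ) : Fin n → ℤ := fun j => j.val

/-- The coordinates of `rhoVec` are distinct and nonnegative, so no sum or difference of two of them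
vanishes. Hence the sign of this product splits the roots into positive and negative ones. -/
lemma rhoVec_dot_root_ne {α : Fin n → ℤ} (hα : α ∈ rootsD n) : rhoVec n ⬝ᵥ α ≠ 0 := by
  obtain ⟨i, j, σ, τ, hij, hσ, hτ, rfl⟩ := hα
  have hij' : i.val ≠ j.val := fun h => hij (Fin.ext h)
  simp only [dotProduct_add, dotProduct_single, rhoVec]
  rcases hσ with rfl | rfl <;> rcases hτ with rfl | rfl <;> omega

lemma simpleRootD_zero (hn : 2 ≤ n) {a : Fin n} (ha : a.val = 0) :
    simpleRootD a = Pi.single ⟨0, by omega⟩ 1 + Pi.single ⟨1, by omega⟩ 1 := by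
  funext j
  simp only [simpleRootD, if_pos ha, Pi.add_apply, Pi.single_apply, Fin.ext_iff]
  split_ifs <;> omega

lemma simpleRootD_pos {a : Fin n} (ha : a.val ≠ 0) :
    simpleRootD a = Pi.single a 1 - Pi.single ⟨a.val - 1, by omega⟩ 1 := by
  simp only [simpleRootD, if_neg ha]

lemma dot_simpleRootD_zero (hn : 2 ≤ n) {a : Fin n} (ha : a.val = 0) (x : Fin n → ℤ) :
    x ⬝ᵥ simpleRootD a = x ⟨0, by omega⟩ + x ⟨1, by omega⟩ := by
  rw [simpleRootD_zero hn ha]; simp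

lemma dot_simpleRootD_pos {a : Fin n} (ha : a.val ≠ 0) (x : Fin n → ℤ) :
    x ⬝ᵥ simpleRootD a = x a - x ⟨a.val - 1, by omega⟩ := by
  rw [simpleRootD_pos ha, dotProduct_sub]; simp

lemma simpleRootD_mem (hn : 2 ≤ n) (a : Fin n) : simpleRootD a ∈ rootsD n := by
  by_cases ha : a.val = 0
  · exact ⟨_, _, 1, 1, by simp, by simp, by simp, simpleRootD_zero hn ha⟩
  · refine ⟨a, ⟨a.val - 1, by omega⟩, 1, -1, ?_, by simp, by simp, ?_⟩
    · rw [Ne, Fin.ext_iff]; simp only; omega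
    · rw [simpleRootD_pos ha, Pi.single_neg, sub_eq_add_neg]

lemma rhoVec_dot_simpleRootD (hn : 2 ≤ n) (a : Fin n) : rhoVec n ⬝ᵥ simpleRootD a = 1 := by
  by_cases ha : a.val = 0
  · rw [dot_simpleRootD_zero hn ha]; simp [rhoVec]
  · rw [dot_simpleRootD_pos ha]; simp only [rhoVec]; omega

/-- The positive roots that have a negative inner product with `x`. -/
def inversions (x : Fin n → ℤ) : Set (Fin n → ℤ) :=
  {α | α ∈ rootsD n ∧ 0 < rhoVec n ⬝ᵥ α ∧ x ⬝ᵥ α < 0}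

lemma finite_inversions (x : Fin n → ℤ) : (inversions x).Finite :=
  finite_rootsD.subset fun _ h => h.1

/-- Distinct roots have inner product at most 1, because their difference has positive squared
length. So the reflection lowers the positive integer `(ρ, α)` by at most 1, and the result is not
0. -/
lemma reflection_pos (hn : 2 ≤ n) (a : Fin n) {α : Fin n → ℤ} (hα : α ∈ rootsD n)
    (hpos : 0 < rhoVec n ⬝ᵥ α) (hne : α ≠ simpleRootD a) :
    0 < rhoVec n ⬝ᵥ rootReflection (simpleRootD a) α := by
  have hs := simpleRootD_mem hn a
  have h0 := rhoVec_dot_root_ne (rootReflection_mem hs hα)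
  have h1 : rhoVec n ⬝ᵥ rootReflection (simpleRootD a) α =
      rhoVec n ⬝ᵥ α - simpleRootD a ⬝ᵥ α := by
    simp only [rootReflection_apply, dotProduct_sub, dotProduct_smul, rhoVec_dot_simpleRootD hn,
      smul_eq_mul, mul_one]
  have h2 : (α - simpleRootD a) ⬝ᵥ (α - simpleRootD a) = 4 - 2 * (simpleRootD a ⬝ᵥ α) := by
    rw [mem_rootsD_iff] at hs hα
    simp only [sub_dotProduct, dotProduct_sub, hs, hα, dotProduct_comm α]
    ring
  have h3 : 0 ≤ (α - simpleRootD a) ⬝ᵥ (α - simpleRootD a) :=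
    Finset.sum_nonneg fun j _ => mul_self_nonneg _
  have h4 : (α - simpleRootD a) ⬝ᵥ (α - simpleRootD a) ≠ 0 := fun h =>
    hne (sub_eq_zero.1 (dotProduct_self_eq_zero.1 h))
  omega

/-- The reflection permutes the positive roots other than the simple root itself. It therefore
carries the old inversions to the new ones, and the simple root is the only one added. -/
lemma ncard_inversions_reflection_of_pos (hn : 2 ≤ n) (a : Fin n) {x : Fin n → ℤ}
    (hx : 0 < x ⬝ᵥ simpleRootD a) :
    (inversions (rootReflection (simpleRootD a) x)).ncard = (inversions x).ncard + 1 := by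
  have hs := simpleRootD_mem hn a
  have hinv := rootReflection_rootReflection hs
  have hset : inversions (rootReflection (simpleRootD a) x) =
      insert (simpleRootD a) (rootReflection (simpleRootD a) '' inversions x) := by
    ext β
    simp only [Set.mem_insert_iff, Set.mem_image]
    constructor
    · rintro ⟨h1, h2, h3⟩
      by_cases hβ : β = simpleRootD a
      · exact Or.inl hβ
      · rw [rootReflection_dot_left] at h3
        exact Or.inr ⟨_, ⟨rootReflection_mem hs h1, reflection_pos hn a h1 h2 hβ, h3⟩, hinv β⟩
    · rintro (rfl | ⟨γ, ⟨h1, h2, h3⟩, rfl⟩)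
      · refine ⟨hs, by rw [rhoVec_dot_simpleRootD hn]; norm_num, ?_⟩
        rw [rootReflection_dot_left, rootReflection_self hs, dotProduct_neg]; omega
      · have hγ : γ ≠ simpleRootD a := by rintro rfl; omega
        refine ⟨rootReflection_mem hs h1, reflection_pos hn a h1 h2 hγ, ?_⟩
        rwa [rootReflection_dot hs]
  rw [hset, Set.ncard_insert_of_notMem _ ((finite_inversions x).image _),
    Set.ncard_image_of_injective _ (Function.LeftInverse.injective hinv)]
  · rintro ⟨γ, ⟨_, h2, _⟩, h⟩
    have : γ = -simpleRootD a := by rw [← hinv γ, h, rootReflection_self hs]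
    rw [this, dotProduct_neg, rhoVec_dot_simpleRootD hn] at h2
    omega

lemma ncard_inversions_reflection_of_neg (hn : 2 ≤ n) (a : Fin n) {x : Fin n → ℤ}
    (hx : x ⬝ᵥ simpleRootD a < 0) :
    (inversions (rootReflection (simpleRootD a) x)).ncard + 1 = (inversions x).ncard := by
  have hs := simpleRootD_mem hn a
  have h := ncard_inversions_reflection_of_pos hn a (x := rootReflection (simpleRootD a) x)
    (by rw [rootReflection_dot_left, rootReflection_self hs, dotProduct_neg]; omega)
  rw [rootReflection_rootReflection hs] at h
  omega

lemma monotone_of_simple_nonneg {x : Fin n → ℤ} (hx : ∀ a : Fin n, 0 ≤ x ⬝ᵥ simpleRootD a)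
    {i j : Fin n} (hij : i ≤ j) : x i ≤ x j := by
  obtain ⟨i, hi⟩ := i
  obtain ⟨j, hj⟩ := j
  simp only [Fin.mk_le_mk] at hij
  induction j, hij using Nat.le_induction with
  | base => exact le_rfl
  | succ k hk ih =>
    have := hx ⟨k + 1, hj⟩
    rw [dot_simpleRootD_pos (by simp)] at this
    simp only [Nat.add_sub_cancel] at this
    have := ih (by omega)
    omega

/-- If no simple root pairs negatively with `x`, the coordinates increase weakly and the first two
have a nonnegative sum. Every positive root then pairs nonnegatively with `x`. -/
lemma exists_simple_neg (hn : 2 ≤ n) {x : Fin n → ℤ} (hx : (inversions x).ncard ≠ 0) :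
    ∃ a : Fin n, x ⬝ᵥ simpleRootD a < 0 := by
  by_contra! hcon
  obtain ⟨α, hα, hpos, hneg⟩ := Set.nonempty_of_ncard_ne_zero hx
  have hm : ∀ {i j : Fin n}, i ≤ j → x i ≤ x j := fun h => monotone_of_simple_nonneg hcon h
  have h01 := hcon ⟨0, by omega⟩
  rw [dot_simpleRootD_zero hn rfl] at h01
  obtain ⟨i, j, σ, τ, hij, hσ, hτ, rfl⟩ := hα
  simp only [dotProduct_add, dotProduct_single, rhoVec] at hpos hneg
  have hi0 := hm (i := ⟨0, by omega⟩) (j := i) (Fin.le_def.2 (Nat.zero_le _))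
  have hj0 := hm (i := ⟨0, by omega⟩) (j := j) (Fin.le_def.2 (Nat.zero_le _))
  have hsum : 0 ≤ x i + x j := by
    rcases lt_or_gt_of_ne hij with h | h <;> rw [Fin.lt_def] at h
    · have := hm (i := ⟨1, by omega⟩) (j := j) (Fin.le_def.2 (by simp only; omega))
      omega
    · have := hm (i := ⟨1, by omega⟩) (j := i) (Fin.le_def.2 (by simp only; omega))
      omega
  rcases hσ with rfl | rfl <;> rcases hτ with rfl | rfl
  · omega
  · have := hm (i := j) (j := i) (Fin.le_def.2 (by omega))
    omega
  · have := hm (i := i) (j := j) (Fin.le_def.2 (by omega))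
    omega
  · omega

/-- Positive integers are at least 1, so the coordinates dominate those of `rhoVec` from position 1
on. Equality of the squared lengths leaves no room for a strict inequality. -/
lemma eq_rhoVec_of_simple_pos (hn : 2 ≤ n) {x : Fin n → ℤ}
    (hx : ∀ a : Fin n, 0 < x ⬝ᵥ simpleRootD a) (hnorm : x ⬝ᵥ x = rhoVec n ⬝ᵥ rhoVec n) :
    x = rhoVec n := by
  have h01 := hx ⟨0, by omega⟩
  rw [dot_simpleRootD_zero hn rfl] at h01
  have hlow : ∀ k (hk : k < n), 1 ≤ k → (k : ℤ) ≤ x ⟨k, hk⟩ := by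
    intro k hk h1
    induction k, h1 using Nat.le_induction with
    | base =>
      have := hx ⟨1, hk⟩
      rw [dot_simpleRootD_pos (by simp)] at this
      simp only [Nat.sub_self] at this
      push_cast
      omega
    | succ k hk1 ih =>
      have := hx ⟨k + 1, hk⟩
      rw [dot_simpleRootD_pos (by simp)] at this
      simp only [Nat.add_sub_cancel] at this
      have := ih (by omega)
      push_cast
      omega
  have hterm : ∀ j ∈ Finset.univ, rhoVec n j * rhoVec n j ≤ x j * x j := by
    rintro ⟨k, hk⟩ -
    rcases Nat.eq_zero_or_pos k with rfl | h
    · simpa [rhoVec] using mul_self_nonneg _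
    · exact mul_self_le_mul_self (by simp [rhoVec]) (hlow k hk h)
  have heq := (Finset.sum_eq_sum_iff_of_le hterm).1 hnorm.symm
  funext ⟨k, hk⟩
  have := heq ⟨k, hk⟩ (Finset.mem_univ _)
  rcases Nat.eq_zero_or_pos k with rfl | h
  · simp only [rhoVec] at this ⊢
    have h0 : x ⟨0, hk⟩ * x ⟨0, hk⟩ = 0 := by rw [← this]; simp
    simpa using h0
  · have := hlow k hk h
    simp only [rhoVec] at *
    nlinarith

lemma weylD_induction {p : ((Fin n → ℤ) ≃ₗ[ℤ] (Fin n → ℤ)) → Prop} (h1 : p 1)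
    (hmul : ∀ (α : Fin n → ℤ) (hα : α ∈ rootsD n) g, p g → p (reflectionEquiv hα * g))
    (w : weylD n) : p w := by
  have hw := w.2
  have hinv : ∀ α (hα : α ∈ rootsD n), (reflectionEquiv hα)⁻¹ = reflectionEquiv hα := by
    intro α hα
    rw [inv_eq_iff_mul_eq_one]
    ext1 x
    exact rootReflection_rootReflection hα x
  have heq : ∀ {g : (Fin n → ℤ) ≃ₗ[ℤ] (Fin n → ℤ)} {α} (hα : α ∈ rootsD n),
      (g : Module.End ℤ (Fin n → ℤ)) = rootReflection α → g = reflectionEquiv hα := by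
    intro g α hα h
    ext1 x
    exact LinearMap.congr_fun h x
  refine Subgroup.closure_induction_left (p := fun g _ => p g) h1 ?_ ?_ hw
  · rintro g ⟨α, hα, hg⟩ y _ hy
    rw [heq hα hg]
    exact hmul α hα y hy
  · rintro g ⟨α, hα, hg⟩ y _ hy
    rw [heq hα hg, hinv]
    exact hmul α hα y hy

lemma weylD_dot (w : weylD n) (x y : Fin n → ℤ) : w.1 x ⬝ᵥ w.1 y = x ⬝ᵥ y := by
  refine weylD_induction (p := fun g => ∀ x y, g x ⬝ᵥ g y = x ⬝ᵥ y) (fun _ _ => rfl) ?_ w x y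
  intro α hα g hg x y
  rw [LinearEquiv.mul_apply, LinearEquiv.mul_apply, reflectionEquiv_apply, reflectionEquiv_apply,
    rootReflection_dot hα, hg]

/-- This invariant separates type D from type B: changing one sign in the all-ones vector alters the
sum of its coordinates by 2, which the congruence modulo 4 forbids. -/
lemma weylD_parity (w : weylD n) : (∀ j, w.1 1 j % 2 = 1) ∧ (4 : ℤ) ∣ ∑ j, w.1 1 j - n := by
  refine weylD_induction (p := fun g => (∀ j, g 1 j % 2 = 1) ∧ (4 : ℤ) ∣ ∑ j, g 1 j - n) ?_ ?_ w
  · constructor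
    · intro j; simp
    · simp
  · rintro α hα g ⟨h1, h2⟩
    have happ : (reflectionEquiv hα * g) 1 = g 1 - (α ⬝ᵥ g 1) • α := rfl
    rw [happ]
    obtain ⟨i, j, σ, τ, hij, hσ, hτ, rfl⟩ := hα
    simp only [add_dotProduct, single_dotProduct]
    set x := g 1
    have hi := h1 i
    have hj := h1 j
    constructor
    · intro k
      have hk := h1 k
      simp only [Pi.sub_apply, Pi.smul_apply, smul_eq_mul]
      have : (σ * x i + τ * x j) % 2 = 0 := by
        rcases hσ with rfl | rfl <;> rcases hτ with rfl | rfl <;> omega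
      obtain ⟨c, hc⟩ := Int.dvd_of_emod_eq_zero this
      rw [hc, mul_assoc]
      omega
    · have hsum : ∑ k, (x - (σ * x i + τ * x j) •
          (Pi.single i σ + Pi.single j τ : Fin n → ℤ)) k =
          ∑ k, x k - (σ * x i + τ * x j) * (σ + τ) := by
        simp [Finset.sum_sub_distrib, ← Finset.mul_sum, Finset.sum_add_distrib]
        ring
      rw [hsum]
      -- The correction is 0 when the signs differ and `2 (x i + x j)` when they agree; a sum of two
      -- odd numbers is even.
      rcases hσ with rfl | rfl <;> rcases hτ with rfl | rfl <;> omega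

/-- Basis vectors go to basis vectors up to sign, and pairing with `rhoVec` recovers the position
and the sign. Only the sign at position 0 stays open, because `rhoVec` vanishes there;
`weylD_parity` settles it. -/
lemma weylD_eq_one_of_fix (w : weylD n) (hw : w.1 (rhoVec n) = rhoVec n) : w = 1 := by
  have hdot : ∀ x, rhoVec n ⬝ᵥ w.1 x = rhoVec n ⬝ᵥ x := by
    intro x
    conv_lhs => rw [← hw]
    exact weylD_dot w _ _
  have hbasis : ∀ j : Fin n, ∃ k σ, (σ = 1 ∨ σ = -1) ∧ w.1 (Pi.single j 1) = Pi.single k σ := by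
    intro j
    apply eq_single_of_dotProduct_self_eq_one
    rw [weylD_dot]; simp
  have hkey : ∀ j : Fin n, w.1 (Pi.single j 1) = Pi.single j 1 ∨
      (j.val = 0 ∧ w.1 (Pi.single j 1) = Pi.single j (-1)) := by
    intro j
    obtain ⟨k, σ, hσ, hk⟩ := hbasis j
    have h := hdot (Pi.single j 1)
    rw [hk] at h
    simp only [dotProduct_single, rhoVec, mul_one] at h
    have hjk : k = j := by
      apply Fin.ext
      rcases hσ with rfl | rfl <;> omega
    subst hjk
    rcases hσ with rfl | rfl
    · exact Or.inl hk
    · exact Or.inr ⟨by omega, hk⟩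
  have hall : ∀ j : Fin n, w.1 (Pi.single j 1) = Pi.single j 1 := by
    intro j
    rcases hkey j with h | ⟨hj, h⟩
    · exact h
    · exfalso
      have hone : (1 : Fin n → ℤ) = ∑ k, Pi.single k 1 := by
        funext k; simp [Finset.sum_apply]
      have h1 : w.1 1 = 1 - 2 • Pi.single j 1 := by
        rw [hone, map_sum, ← Finset.add_sum_erase _ _ (Finset.mem_univ j), h,
          ← Finset.add_sum_erase (f := fun k => (Pi.single k 1 : Fin n → ℤ)) _ (Finset.mem_univ j)]
        have : ∑ k ∈ Finset.univ.erase j, w.1 (Pi.single k 1) =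
            ∑ k ∈ Finset.univ.erase j, Pi.single k 1 := by
          refine Finset.sum_congr rfl fun k hk => ?_
          rcases hkey k with h | ⟨hk0, _⟩
          · exact h
          · exact absurd (Fin.ext (hk0.trans hj.symm)) (Finset.ne_of_mem_erase hk)
        rw [this, Pi.single_neg, two_smul]
        abel
      have h2 := (weylD_parity w).2
      rw [h1] at h2
      simp [Finset.sum_sub_distrib, ← Finset.mul_sum] at h2
  apply Subtype.ext
  apply LinearEquiv.toLinearMap_injective
  apply LinearMap.pi_ext'
  intro j
  ext1
  simpa using hall j

/-- The reflection in a simple root, as an element of the Weyl group. -/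
def simpleD (hn : 2 ≤ n) (a : Fin n) : weylD n :=
  ⟨reflectionEquiv (simpleRootD_mem hn a),
    Subgroup.subset_closure ⟨simpleRootD a, simpleRootD_mem hn a, rfl⟩⟩

lemma simpleD_apply (hn : 2 ≤ n) (a : Fin n) (x : Fin n → ℤ) :
    (simpleD hn a).1 x = rootReflection (simpleRootD a) x := rfl

lemma simpleD_mul_self (hn : 2 ≤ n) (a : Fin n) : simpleD hn a * simpleD hn a = 1 := by
  apply Subtype.ext
  ext1 x
  exact rootReflection_rootReflection (simpleRootD_mem hn a) x

lemma simpleD_mul_cancel (hn : 2 ≤ n) (a : Fin n) (w : weylD n) :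
    simpleD hn a * (simpleD hn a * w) = w := by
  rw [← mul_assoc, simpleD_mul_self, one_mul]

/-- The product of a word in the simple reflections. -/
def wordW (hn : 2 ≤ n) (as : List (Fin n)) : weylD n := (as.map (simpleD hn)).prod

@[simp] lemma wordW_nil (hn : 2 ≤ n) : wordW hn [] = 1 := rfl

@[simp] lemma wordW_cons (hn : 2 ≤ n) (a : Fin n) (as : List (Fin n)) :
    wordW hn (a :: as) = simpleD hn a * wordW hn as := by simp [wordW]

lemma wordProdD_eq (hn : 2 ≤ n) (as : List (Fin n)) :
    wordProdD as = (wordW hn as).1.toLinearMap := by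
  induction as with
  | nil => rfl
  | cons a as ih =>
    rw [wordW_cons, wordProdD, List.map_cons, List.prod_cons]
    change _ * wordProdD as = _
    rw [ih]
    rfl

lemma wordProdD_eq_iff (hn : 2 ≤ n) (as : List (Fin n)) (w : weylD n) :
    wordProdD as = (w : (Fin n → ℤ) ≃ₗ[ℤ] (Fin n → ℤ)).toLinearMap ↔ wordW hn as = w := by
  rw [wordProdD_eq hn]
  exact LinearEquiv.toLinearMap_injective.eq_iff.trans Subtype.ext_iff.symm

/-- The number of inversions of an element of the Weyl group. -/
noncomputable def lenD (w : weylD n) : ℕ := (inversions (w.1 (rhoVec n))).ncard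

lemma lenD_one : lenD (1 : weylD n) = 0 := by
  have : inversions (rhoVec n) = ∅ := by
    ext α
    refine iff_of_false ?_ (Set.notMem_empty α)
    rintro ⟨_, h1, h2⟩
    omega
  change (inversions (rhoVec n)).ncard = 0
  rw [this, Set.ncard_empty]

lemma weylD_dot_root_ne (w : weylD n) {α : Fin n → ℤ} (hα : α ∈ rootsD n) :
    w.1 (rhoVec n) ⬝ᵥ α ≠ 0 := by
  have h : w.1 (w.1.symm α) = α := w.1.apply_symm_apply α
  rw [← h, weylD_dot]
  apply rhoVec_dot_root_ne
  rw [mem_rootsD_iff] at *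
  rw [← weylD_dot w, h, hα]

/-- `a` is a left descent of `w`. -/
def IsDescent (w : weylD n) (a : Fin n) : Prop := w.1 (rhoVec n) ⬝ᵥ simpleRootD a < 0

lemma lenD_simple_mul_of_descent (hn : 2 ≤ n) {w : weylD n} {a : Fin n} (h : IsDescent w a) :
    lenD (simpleD hn a * w) + 1 = lenD w :=
  ncard_inversions_reflection_of_neg hn a h

lemma lenD_simple_mul_of_not_descent (hn : 2 ≤ n) {w : weylD n} {a : Fin n}
    (h : ¬IsDescent w a) : lenD (simpleD hn a * w) = lenD w + 1 := by
  have h0 := weylD_dot_root_ne w (simpleRootD_mem hn a)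
  exact ncard_inversions_reflection_of_pos hn a (lt_of_le_of_ne (not_lt.1 h) h0.symm)

lemma lenD_simple_mul_le (hn : 2 ≤ n) (w : weylD n) (a : Fin n) :
    lenD (simpleD hn a * w) ≤ lenD w + 1 := by
  by_cases h : IsDescent w a
  · have := lenD_simple_mul_of_descent hn h; omega
  · exact (lenD_simple_mul_of_not_descent hn h).le

lemma lenD_wordW_le (hn : 2 ≤ n) (as : List (Fin n)) : lenD (wordW hn as) ≤ as.length := by
  induction as with
  | nil => simp [lenD_one]
  | cons a as ih =>
    rw [wordW_cons, List.length_cons]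
    exact (lenD_simple_mul_le hn _ a).trans (by omega)

lemma exists_descent (hn : 2 ≤ n) {w : weylD n} (h : lenD w ≠ 0) : ∃ a, IsDescent w a :=
  exists_simple_neg hn h

lemma eq_one_of_lenD_eq_zero (hn : 2 ≤ n) {w : weylD n} (h : lenD w = 0) : w = 1 := by
  apply weylD_eq_one_of_fix
  apply eq_rhoVec_of_simple_pos hn
  · intro a
    have h0 := weylD_dot_root_ne w (simpleRootD_mem hn a)
    by_contra hcon
    have hd : IsDescent w a := lt_of_le_of_ne (not_lt.1 hcon) h0
    have := lenD_simple_mul_of_descent hn hd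
    omega
  · exact weylD_dot w _ _

lemma exists_word (hn : 2 ≤ n) (w : weylD n) :
    ∃ as : List (Fin n), wordW hn as = w ∧ as.length = lenD w := by
  obtain ⟨k, hk⟩ : ∃ k, lenD w = k := ⟨_, rfl⟩
  induction k generalizing w with
  | zero => exact ⟨[], (eq_one_of_lenD_eq_zero hn hk).symm, hk.symm⟩
  | succ k ih =>
    obtain ⟨a, ha⟩ := exists_descent hn (w := w) (by omega)
    have := lenD_simple_mul_of_descent hn ha
    obtain ⟨as, h1, h2⟩ := ih (simpleD hn a * w) (by omega)
    refine ⟨a :: as, ?_, ?_⟩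
    · rw [wordW_cons, h1, simpleD_mul_cancel]
    · rw [List.length_cons]; omega

lemma IsReducedD.wordW_eq (hn : 2 ≤ n) {w : weylD n} {as : List (Fin n)} (h : IsReducedD w as) :
    wordW hn as = w := (wordProdD_eq_iff hn as w).1 h.1

/-- Minimal word length and number of inversions agree: `lenD_wordW_le` is one inequality, and
stripping descents (`exists_word`) gives a word that attains it. -/
lemma IsReducedD.length_eq (hn : 2 ≤ n) {w : weylD n} {as : List (Fin n)} (h : IsReducedD w as) :
    as.length = lenD w := by
  obtain ⟨bs, h1, h2⟩ := exists_word hn w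
  have h3 := h.2 bs ((wordProdD_eq_iff hn bs w).2 h1)
  have h4 := lenD_wordW_le hn as
  rw [h.wordW_eq hn] at h4
  omega

lemma isDescent_simple_mul (hn : 2 ≤ n) (w : weylD n) (a b : Fin n) :
    IsDescent (simpleD hn a * w) b ↔
      w.1 (rhoVec n) ⬝ᵥ simpleRootD b
        - (simpleRootD a ⬝ᵥ simpleRootD b) * (w.1 (rhoVec n) ⬝ᵥ simpleRootD a) < 0 := by
  unfold IsDescent
  change rootReflection (simpleRootD a) (w.1 (rhoVec n)) ⬝ᵥ simpleRootD b < 0 ↔ _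
  rw [rootReflection_dot_left, rootReflection_apply, dotProduct_sub, dotProduct_smul, smul_eq_mul]

lemma simpleD_comm (hn : 2 ≤ n) {a b : Fin n} (h : simpleRootD a ⬝ᵥ simpleRootD b = 0) :
    simpleD hn a * simpleD hn b = simpleD hn b * simpleD hn a := by
  have h' := h
  rw [dotProduct_comm] at h'
  apply Subtype.ext
  ext1 x
  change rootReflection _ (rootReflection _ x) = rootReflection _ (rootReflection _ x)
  simp only [rootReflection_apply, dotProduct_sub, dotProduct_smul, h, h', smul_zero, sub_zero]
  abel

lemma simpleD_braid (hn : 2 ≤ n) {a b : Fin n} (h : simpleRootD a ⬝ᵥ simpleRootD b = -1) :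
    simpleD hn a * (simpleD hn b * simpleD hn a) =
      simpleD hn b * (simpleD hn a * simpleD hn b) := by
  have h' := h
  rw [dotProduct_comm] at h'
  have ha := mem_rootsD_iff.1 (simpleRootD_mem hn a)
  have hb := mem_rootsD_iff.1 (simpleRootD_mem hn b)
  apply Subtype.ext
  ext1 x
  change rootReflection _ (rootReflection _ (rootReflection _ x)) =
    rootReflection _ (rootReflection _ (rootReflection _ x))
  simp only [rootReflection_apply, dotProduct_sub, dotProduct_smul, h, h', ha, hb, smul_eq_mul]
  funext j
  simp only [Pi.sub_apply, Pi.smul_apply, smul_eq_mul]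
  ring

end WeylCombinatorics

/-! ### The homomorphism from W to V and the fixed points of the involution -/

section Homomorphism

variable {K : Type*} [Field K] {n : ℕ} {q : K} {β : Finset (Fin n → K)}

/-- The index before `b`. -/
def pre (b : Fin n) : Fin n := ⟨b.val - 1, by omega⟩

lemma pre_val_add_one {b : Fin n} (hb : b.val ≠ 0) : (pre b).val + 1 = b.val := by
  simp only [pre]; omega

lemma pre_ne {b : Fin n} (hb : b.val ≠ 0) : pre b ≠ b := by
  intro h
  have := pre_val_add_one hb
  rw [h] at this
  omega

lemma eq_pre {k b : Fin n} (hb : k.val + 1 = b.val) : k = pre b := by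
  apply Fin.ext
  simp only [pre]; omega

/-- The action of the generators `r_b` of `W(B_n)` on `β`. -/
def actB (hst : IsStableB β) (b : Fin n) (i : β) : β :=
  if hb : b.val = 0 then ⟨Function.update i.1 b (i.1 b)⁻¹, hst.1 i.1 i.2 b hb⟩
  else ⟨i.1 ∘ Equiv.swap (pre b) b, hst.2 i.1 i.2 (pre b) b (pre_val_add_one hb)⟩

lemma actB_zero (hst : IsStableB β) {b : Fin n} (hb : b.val = 0) (i : β) :
    (actB hst b i).1 = Function.update i.1 b (i.1 b)⁻¹ := by
  simp [actB, hb]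

lemma actB_pos (hst : IsStableB β) {b : Fin n} (hb : b.val ≠ 0) (i : β) :
    (actB hst b i).1 = i.1 ∘ Equiv.swap (pre b) b := by
  simp [actB, hb]

lemma actB_zero_same (hst : IsStableB β) {b : Fin n} (hb : b.val = 0) (i : β) :
    (actB hst b i).1 b = (i.1 b)⁻¹ := by
  simp [actB_zero hst hb]

lemma actB_zero_of_ne (hst : IsStableB β) {b j : Fin n} (hb : b.val = 0) (hj : j ≠ b) (i : β) :
    (actB hst b i).1 j = i.1 j := by
  simp [actB_zero hst hb, hj]

lemma actB_actB (hst : IsStableB β) (b : Fin n) (i : β) : actB hst b (actB hst b i) = i := by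
  apply Subtype.ext
  by_cases hb : b.val = 0
  · simp [actB_zero hst hb]
  · rw [actB_pos hst hb, actB_pos hst hb]
    funext j
    simp

lemma mkV_rel {x x' : FreeAlgebra K (Gen β)} (h : RelV q β x x') : mkV q β x = mkV q β x' :=
  RingQuot.mkAlgHom_rel K h

lemma mkW_rel {x x' : FreeAlgebra K (Gen β)} (h : RelW q β x x') : mkW q β x = mkW q β x' :=
  RingQuot.mkAlgHom_rel K h

lemma psi0_sqV {z : Fin n} (hz : z.val = 0) :
    genV q (β := β) (.psi z) * genV q (.psi z) = 1 := by
  have := mkV_rel (q := q) (β := β) (RelV.psi0_sq z hz)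
  rwa [map_pow, map_one, sq] at this

lemma psi0_y_firstV {z : Fin n} (hz : z.val = 0) :
    genV q (β := β) (.psi z) * genV q (.y z) = -genV q (.y z) * genV q (.psi z) := by
  have := mkV_rel (q := q) (β := β) (RelV.psi0_y_first z hz)
  simp only [map_mul, map_add, map_zero] at this
  rw [neg_mul]
  exact eq_neg_of_add_eq_zero_left this

lemma psi0_yV {z j : Fin n} (hz : z.val = 0) (hj : j ≠ z) :
    genV q (β := β) (.psi z) * genV q (.y j) = genV q (.y j) * genV q (.psi z) := by
  have := mkV_rel (q := q) (β := β) (RelV.psi0_y z j hz hj)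
  rwa [map_mul, map_mul] at this

lemma psi0_eV (hst : IsStableB β) {z : Fin n} (hz : z.val = 0) (i : β) :
    genV q (.psi z) * genV q (.e i) = genV q (.e (actB hst z i)) * genV q (.psi z) := by
  have := mkV_rel (q := q) (β := β) (RelV.psi0_e z hz i (actB hst z i) (actB_zero hst hz i))
  rwa [map_mul, map_mul] at this

lemma psi0_psiV {z b : Fin n} (hz : z.val = 0) (hb : 1 < b.val) :
    genV q (β := β) (.psi z) * genV q (.psi b) = genV q (.psi b) * genV q (.psi z) := by
  have := mkV_rel (q := q) (β := β) (RelV.psi0_comm z b hz hb)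
  rwa [map_mul, map_mul] at this

/-- Conjugation with `ψ_0`, as an endomorphism of `V`. -/
noncomputable def conjV (q : K) (β : Finset (Fin n → K)) {z : Fin n} (hz : z.val = 0) :
    AlgV q β →ₐ[K] AlgV q β where
  toFun x := genV q (.psi z) * x * genV q (.psi z)
  map_one' := by rw [mul_one, psi0_sqV hz]
  map_mul' x y := by
    have h := psi0_sqV (q := q) (β := β) hz
    calc genV q (.psi z) * (x * y) * genV q (.psi z)
        = genV q (.psi z) * x * 1 * (y * genV q (.psi z)) := by noncomm_ring
      _ = _ := by rw [← h]; noncomm_ring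
  map_zero' := by simp
  map_add' x y := by noncomm_ring
  commutes' r := by
    rw [← Algebra.commutes, mul_assoc, psi0_sqV hz, mul_one]

lemma conjV_apply {z : Fin n} (hz : z.val = 0) (x : AlgV q β) :
    conjV q β hz x = genV q (.psi z) * x * genV q (.psi z) := rfl

lemma conjV_of_comm {z : Fin n} (hz : z.val = 0) {x x' : AlgV q β}
    (h : genV q (.psi z) * x = x' * genV q (.psi z)) : conjV q β hz x = x' := by
  rw [conjV_apply, h, mul_assoc, psi0_sqV hz, mul_one]

lemma psi0_mul_eq_conjV {z : Fin n} (hz : z.val = 0) (x : AlgV q β) :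
    genV q (.psi z) * x = conjV q β hz x * genV q (.psi z) := by
  rw [conjV_apply, mul_assoc, psi0_sqV hz, mul_one]

lemma conjV_conjV {z : Fin n} (hz : z.val = 0) (x : AlgV q β) :
    conjV q β hz (conjV q β hz x) = x := by
  apply conjV_of_comm hz
  rw [conjV_apply, ← mul_assoc, ← mul_assoc, psi0_sqV hz, one_mul]

lemma conjV_y_first {z : Fin n} (hz : z.val = 0) :
    conjV q β hz (mkV q β (fy β z)) = -mkV q β (fy β z) :=
  conjV_of_comm hz (psi0_y_firstV hz)

lemma conjV_y {z j : Fin n} (hz : z.val = 0) (hj : j ≠ z) :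
    conjV q β hz (mkV q β (fy β j)) = mkV q β (fy β j) :=
  conjV_of_comm hz (psi0_yV hz hj)

lemma conjV_e (hst : IsStableB β) {z : Fin n} (hz : z.val = 0) (i : β) :
    conjV q β hz (mkV q β (fe i)) = mkV q β (fe (actB hst z i)) :=
  conjV_of_comm hz (psi0_eV hst hz i)

lemma conjV_psi {z b : Fin n} (hz : z.val = 0) (hb : 1 < b.val) :
    conjV q β hz (mkV q β (fpsi β b)) = mkV q β (fpsi β b) :=
  conjV_of_comm hz (psi0_psiV hz hb)

/-- The images of the generators of `W` in `V`. -/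
noncomputable def phiGen (q : K) (β : Finset (Fin n → K)) : Gen β → AlgV q β
  | .psi a => if h : 2 ≤ n ∧ a.val = 0 then
      genV q (.psi a) * genV q (.psi ⟨1, h.1⟩) * genV q (.psi a) else genV q (.psi a)
  | .y j => genV q (.y j)
  | .e i => genV q (.e i)

lemma phiGen_lift_psi (b : Fin n) (hb : b.val ≠ 0) :
    FreeAlgebra.lift K (phiGen q β) (fpsi β b) = mkV q β (fpsi β b) := by
  simp [phiGen, genV, hb]

lemma phiGen_lift_psi0 (z o : Fin n) (hz : z.val = 0) (ho : o.val = 1) :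
    FreeAlgebra.lift K (phiGen q β) (fpsi β z) = conjV q β hz (mkV q β (fpsi β o)) := by
  have hn : 2 ≤ n := by omega
  have : o = ⟨1, hn⟩ := Fin.ext ho
  subst this
  simp [phiGen, genV, hz, hn, conjV_apply]

lemma phiGen_lift_y (j : Fin n) :
    FreeAlgebra.lift K (phiGen q β) (fy β j) = mkV q β (fy β j) := by
  simp [phiGen, genV]

lemma phiGen_lift_e (i : β) :
    FreeAlgebra.lift K (phiGen q β) (fe i) = mkV q β (fe i) := by
  simp [phiGen, genV]

lemma phiGen_relA {x x' : FreeAlgebra K (Gen β)} (h : RelA q β x x') :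
    FreeAlgebra.lift K (phiGen q β) x = FreeAlgebra.lift K (phiGen q β) x' := by
  have key : mkV q β x = mkV q β x' := RingQuot.mkAlgHom_rel K (RelV.common h)
  have suc : ∀ {k b : Fin n}, k.val + 1 = b.val → b.val ≠ 0 := fun h => by omega
  cases h
  all_goals
    simp only [map_sum, map_mul, map_sub, map_add, map_neg, map_pow, map_one, map_zero, map_ofNat]
      at key ⊢
    try simp only [phiGen_lift_y, phiGen_lift_e]
    try rw [phiGen_lift_psi _ (by first | assumption | exact suc (by assumption))]
    try rw [phiGen_lift_psi _ (by first | assumption | exact suc (by assumption))]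
    exact key

/-- A defining relation of `V`, conjugated with `ψ_0`. -/
lemma conjV_rel {z : Fin n} (hz : z.val = 0) {x x' : FreeAlgebra K (Gen β)}
    (h : RelA q β x x') : conjV q β hz (mkV q β x) = conjV q β hz (mkV q β x') := by
  rw [mkV_rel (RelV.common h)]

/-- A relation of W for `Ψ_0` at `e(i)` is the relation of V for `ψ_1` at `e(r_0 i)`, conjugated by
`ψ_0`. The first entry becomes its inverse and `y_1` becomes `-y_1`, which explains the conditions
on `i_1⁻¹` and the signs. As `ψ_2` is fixed by the conjugation, the braid relation of `ψ_1` and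
`ψ_2` becomes that of `Ψ_0` and `Ψ_2`. -/
lemma phiGen_relW (hst : IsStableB β) {x x' : FreeAlgebra K (Gen β)} (h : RelW q β x x') :
    FreeAlgebra.lift K (phiGen q β) x = FreeAlgebra.lift K (phiGen q β) x' := by
  have hne : ∀ {z o : Fin n}, z.val = 0 → o.val ≠ 0 → o ≠ z := fun hz ho h => by
    rw [h] at ho; omega
  have hzo : ∀ {z o : Fin n}, z.val = 0 → o.val = 1 → z.val + 1 = o.val := fun hz ho => by omega
  have hoz : ∀ {z o : Fin n}, z.val = 0 → o.val = 1 → o ≠ z := fun hz ho => hne hz (by omega)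
  have hot : ∀ {o t : Fin n}, o.val = 1 → t.val = 2 → o.val + 1 = t.val := fun hz ho => by omega
  have hvz : ∀ {z : Fin n} (hz : z.val = 0) (i : β), (i.1 z)⁻¹ = (actB hst z i).1 z :=
    fun hz i => (actB_zero_same hst hz i).symm
  have hvj : ∀ {z o : Fin n} (hz : z.val = 0) (_ : o.val ≠ 0) (i : β),
      i.1 o = (actB hst z i).1 o :=
    fun hz ho i => (actB_zero_of_ne hst hz (hne hz ho) i).symm
  cases h with
  | common h => exact phiGen_relA h
  | psi0_e z o hz ho i i' h =>
    have key := conjV_rel (q := q) hz (RelA.psi_e z o (hzo hz ho) (actB hst z i) (actB hst z i') (by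
      rw [actB_zero hst hz, actB_zero hst hz, h]
      funext j
      have := hoz hz ho
      by_cases hjz : j = z
      · subst hjz; simp [this, this.symm]
      by_cases hjo : j = o
      · subst hjo; simp [this]
      simp [hjz, hjo, Equiv.swap_apply_of_ne_of_ne]))
    simp only [map_mul, conjV_e hst, actB_actB] at key
    simp only [map_mul, phiGen_lift_e, phiGen_lift_psi0 z o hz ho]
    exact key
  | psi0_y_eq z o hz ho j hj i h =>
    rw [hvz hz, hvj hz (o := o) (by omega)] at h
    simp only [map_mul, map_add, map_neg, map_one, phiGen_lift_e, phiGen_lift_y,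
      phiGen_lift_psi0 z o hz ho]
    rcases hj with rfl | rfl
    · have key := conjV_rel (q := q) hz (RelA.psi_y_left j o (hzo hz ho) (actB hst j i) h)
      simp only [map_mul, map_sub, map_neg, conjV_e hst, actB_actB, conjV_y_first,
        conjV_y hz (hoz hz ho), mul_neg, neg_mul, sub_mul] at key
      rw [Equiv.swap_apply_left]
      simp only [add_mul, neg_mul, one_mul]
      linear_combination (norm := abel) -key
    · have key := conjV_rel (q := q) hz (RelA.psi_y_right z j (hzo hz ho) (actB hst z i) h)
      simp only [map_mul, map_sub, conjV_e hst, actB_actB, conjV_y_first,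
        conjV_y hz (hoz hz ho), neg_mul, sub_mul] at key
      rw [Equiv.swap_apply_right]
      simp only [add_mul, neg_mul, one_mul]
      linear_combination (norm := abel) key
  | psi0_y_ne z o hz ho j hj i h =>
    rw [hvz hz, hvj hz (o := o) (by omega)] at h
    have key := conjV_rel (q := q) hz (RelA.psi_y_else z o (hzo hz ho) j (actB hst z i)
      (fun hh => h hh.2))
    simp only [map_mul, map_neg, phiGen_lift_e, phiGen_lift_y, phiGen_lift_psi0 z o hz ho]
    rcases hj with rfl | rfl
    · rw [Equiv.swap_apply_left] at key ⊢
      simp only [map_mul, map_sub, map_zero, conjV_e hst, actB_actB, conjV_y_first,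
        conjV_y hz (hoz hz ho), mul_neg, neg_mul, sub_mul] at key ⊢
      linear_combination (norm := abel) -key
    · rw [Equiv.swap_apply_right] at key ⊢
      simp only [map_mul, map_sub, map_zero, conjV_e hst, actB_actB, conjV_y_first,
        conjV_y hz (hoz hz ho), neg_mul, sub_mul] at key ⊢
      linear_combination (norm := abel) key
  | psi0_y_else z hz j hj i =>
    obtain ⟨o, ho⟩ : ∃ o : Fin n, o.val = 1 := ⟨⟨1, by omega⟩, rfl⟩
    have hjz : j ≠ z := hne hz (by omega)
    have hjo : j ≠ o := fun h => by rw [h] at hj; omega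
    have key := conjV_rel (q := q) hz (RelA.psi_y_else z o (hzo hz ho) j (actB hst z i)
      (fun hh => hh.1.elim hjz hjo))
    rw [Equiv.swap_apply_of_ne_of_ne hjz hjo] at key
    simp only [map_mul, map_sub, map_zero, conjV_e hst, actB_actB, conjV_y hz hjz, sub_mul] at key
    simp only [map_mul, phiGen_lift_e, phiGen_lift_y, phiGen_lift_psi0 z o hz ho]
    exact sub_eq_zero.1 key
  | psi0_comm z b hz hb =>
    obtain ⟨o, ho⟩ : ∃ o : Fin n, o.val = 1 := ⟨⟨1, by omega⟩, rfl⟩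
    simp only [map_mul, phiGen_lift_psi0 z o hz ho, phiGen_lift_psi b (by omega)]
    rcases hb with hb | hb
    · have : b = o := Fin.ext (hb.trans ho.symm)
      subst this
      -- The four-term braid relation, bracketed as `(ψ_0 ψ_1 ψ_0) ψ_1 = ψ_1 (ψ_0 ψ_1 ψ_0)`.
      have key := mkV_rel (q := q) (β := β) (RelV.psi0_braid z b hz hb)
      simp only [map_mul, map_sub, map_zero, sq] at key
      have := sub_eq_zero.1 key
      rw [conjV_apply]
      simp only [genV]
      simpa only [mul_assoc] using this
    · have key := conjV_rel (q := q) (β := β) hz (RelA.psi_comm o b (by omega) (by omega)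
        (Or.inl (by omega)))
      simpa only [map_mul, conjV_psi hz (b := b) (by omega)] using key
  | sq0_eq z o hz ho i h =>
    rw [hvz hz, hvj hz (o := o) (by omega)] at h
    have key := conjV_rel (q := q) hz (RelA.sq_eq z o (hzo hz ho) (actB hst z i) h)
    simp only [map_mul, map_pow, map_zero, conjV_e hst, actB_actB] at key
    simpa only [map_mul, map_pow, map_zero, phiGen_lift_e, phiGen_lift_psi0 z o hz ho] using key
  | sq0_none z o hz ho i h =>
    rw [hvz hz, hvj hz (o := o) (by omega)] at h
    have key := conjV_rel (q := q) hz (RelA.sq_none z o (hzo hz ho) (actB hst z i) h)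
    simp only [map_mul, map_pow, conjV_e hst, actB_actB] at key
    simpa only [map_mul, map_pow, phiGen_lift_e, phiGen_lift_psi0 z o hz ho] using key
  | sq0_to z o hz ho i h =>
    rw [hvz hz, hvj hz (o := o) (by omega)] at h
    have key := conjV_rel (q := q) hz (RelA.sq_to z o (hzo hz ho) (actB hst z i) h)
    simp only [map_mul, map_pow, map_sub, conjV_e hst, actB_actB, conjV_y_first,
      conjV_y hz (hoz hz ho)] at key
    simp only [map_mul, map_pow, map_add, phiGen_lift_e, phiGen_lift_y, phiGen_lift_psi0 z o hz ho]
    rw [key]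
    noncomm_ring
  | sq0_from z o hz ho i h =>
    rw [hvz hz, hvj hz (o := o) (by omega)] at h
    have key := conjV_rel (q := q) hz (RelA.sq_from z o (hzo hz ho) (actB hst z i) h)
    simp only [map_mul, map_pow, map_sub, conjV_e hst, actB_actB, conjV_y_first,
      conjV_y hz (hoz hz ho)] at key
    simp only [map_mul, map_pow, map_add, map_neg, phiGen_lift_e, phiGen_lift_y,
      phiGen_lift_psi0 z o hz ho]
    rw [key]
    noncomm_ring
  | sq0_both z o hz ho i h =>
    rw [hvz hz, hvj hz (o := o) (by omega)] at h
    have key := conjV_rel (q := q) hz (RelA.sq_both z o (hzo hz ho) (actB hst z i) h)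
    have hcomm := mkV_rel (q := q) (β := β) (RelV.common (RelA.y_comm z o))
    simp only [map_mul] at hcomm
    simp only [map_mul, map_pow, map_sub, conjV_e hst, actB_actB, conjV_y_first,
      conjV_y hz (hoz hz ho)] at key
    simp only [map_mul, map_pow, map_add, map_neg, phiGen_lift_e, phiGen_lift_y,
      phiGen_lift_psi0 z o hz ho]
    rw [key]
    congr 1
    simp only [sq, mul_add, add_mul, sub_mul, mul_sub, neg_mul, mul_neg, hcomm]
    abel
  | braid0_to z o t hz ho ht i h =>
    rw [hvz hz, hvj hz (o := o) (by omega), hvj hz (o := t) (by omega)] at h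
    have key := conjV_rel (q := q) hz
      (RelA.braid_to z o t (hzo hz ho) (hot ho ht) (actB hst z i) h)
    simp only [map_mul, map_sub, conjV_e hst, actB_actB, conjV_psi hz (b := t) (by omega)] at key
    simpa only [map_mul, map_sub, phiGen_lift_e, phiGen_lift_psi0 z o hz ho,
      phiGen_lift_psi t (by omega)] using key
  | braid0_from z o t hz ho ht i h =>
    rw [hvz hz, hvj hz (o := o) (by omega), hvj hz (o := t) (by omega)] at h
    have key := conjV_rel (q := q) hz
      (RelA.braid_from z o t (hzo hz ho) (hot ho ht) (actB hst z i) h)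
    simp only [map_mul, map_sub, map_neg, conjV_e hst, actB_actB,
      conjV_psi hz (b := t) (by omega)] at key
    simpa only [map_mul, map_sub, map_neg, phiGen_lift_e, phiGen_lift_psi0 z o hz ho,
      phiGen_lift_psi t (by omega)] using key
  | braid0_both z o t hz ho ht i h =>
    rw [hvz hz, hvj hz (o := o) (by omega), hvj hz (o := t) (by omega)] at h
    have key := conjV_rel (q := q) hz
      (RelA.braid_both z o t (hzo hz ho) (hot ho ht) (actB hst z i) h)
    simp only [map_mul, map_sub, map_add, map_ofNat, conjV_e hst, actB_actB,
      conjV_psi hz (b := t) (by omega), conjV_y_first, conjV_y hz (hoz hz ho),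
      conjV_y hz (hne hz (o := t) (by omega))] at key
    simp only [map_mul, map_sub, map_ofNat, phiGen_lift_e, phiGen_lift_y,
      phiGen_lift_psi0 z o hz ho, phiGen_lift_psi t (by omega)]
    rw [key, ← sub_eq_add_neg]
  | braid0_else z o t hz ho ht i h =>
    rw [hvz hz, hvj hz (o := o) (by omega), hvj hz (o := t) (by omega)] at h
    have key := conjV_rel (q := q) hz
      (RelA.braid_else z o t (hzo hz ho) (hot ho ht) (actB hst z i) h)
    simp only [map_mul, map_sub, map_zero, conjV_e hst, actB_actB,
      conjV_psi hz (b := t) (by omega)] at key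
    simpa only [map_mul, map_sub, map_zero, phiGen_lift_e, phiGen_lift_psi0 z o hz ho,
      phiGen_lift_psi t (by omega)] using key

/-- The homomorphism from `W` to `V`. -/
noncomputable def phiHom (q : K) (hst : IsStableB β) : AlgW q β →ₐ[K] AlgV q β :=
  RingQuot.liftAlgHom K ⟨FreeAlgebra.lift K (phiGen q β), fun _ _ h => phiGen_relW hst h⟩

lemma phiHom_gen (hst : IsStableB β) (g : Gen β) : phiHom q hst (genW q g) = phiGen q β g := by
  have h : phiHom q hst (genW q g) = FreeAlgebra.lift K (phiGen q β) (FreeAlgebra.ι K g) :=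
    RingQuot.liftAlgHom_mkAlgHom_apply K _ _ _
  rw [h, FreeAlgebra.lift_ι_apply]

lemma genV_induction {p : AlgV q β → Prop} (hK : ∀ r, p (algebraMap K _ r))
    (hgen : ∀ g, p (genV q g)) (hmul : ∀ x y, p x → p y → p (x * y))
    (hadd : ∀ x y, p x → p y → p (x + y)) (x : AlgV q β) : p x := by
  obtain ⟨x, rfl⟩ := RingQuot.mkAlgHom_surjective K (RelV q β) x
  change p (mkV q β x)
  induction x using FreeAlgebra.induction with
  | grade0 r => rw [AlgHom.commutes]; exact hK r
  | grade1 g => exact hgen g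
  | mul a b ha hb => rw [map_mul]; exact hmul _ _ ha hb
  | add a b ha hb => rw [map_add]; exact hadd _ _ ha hb

lemma genW_induction {p : AlgW q β → Prop} (hK : ∀ r, p (algebraMap K _ r))
    (hgen : ∀ g, p (genW q g)) (hmul : ∀ x y, p x → p y → p (x * y))
    (hadd : ∀ x y, p x → p y → p (x + y)) (x : AlgW q β) : p x := by
  obtain ⟨x, rfl⟩ := RingQuot.mkAlgHom_surjective K (RelW q β) x
  change p (mkW q β x)
  induction x using FreeAlgebra.induction with
  | grade0 r => rw [AlgHom.commutes]; exact hK r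
  | grade1 g => exact hgen g
  | mul a b ha hb => rw [map_mul]; exact hmul _ _ ha hb
  | add a b ha hb => rw [map_add]; exact hadd _ _ ha hb

lemma phiHom_psi (hst : IsStableB β) {b : Fin n} (hb : b.val ≠ 0) :
    phiHom q hst (genW q (.psi b)) = genV q (.psi b) := by
  simp [phiHom_gen, phiGen, hb]

lemma phiHom_psi0 (hst : IsStableB β) {z o : Fin n} (hz : z.val = 0) (ho : o.val = 1) :
    phiHom q hst (genW q (.psi z)) = conjV q β hz (genV q (.psi o)) := by
  have h := phiGen_lift_psi0 (q := q) (β := β) z o hz ho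
  rw [FreeAlgebra.lift_ι_apply] at h
  rw [phiHom_gen, h, genV]

lemma phiHom_y (hst : IsStableB β) (j : Fin n) :
    phiHom q hst (genW q (.y j)) = genV q (.y j) := phiHom_gen hst _

lemma phiHom_e (hst : IsStableB β) (i : β) :
    phiHom q hst (genW q (.e i)) = genV q (.e i) := phiHom_gen hst _

/-- Conjugation by `ψ_0` exchanges the images of `Ψ_0` and `Ψ_1` and permutes the images of the
other generators up to sign, so it preserves the image of W. -/
lemma conjV_phiHom (hst : IsStableB β) {z o : Fin n} (hz : z.val = 0) (ho : o.val = 1)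
    (x : AlgW q β) : ∃ x', conjV q β hz (phiHom q hst x) = phiHom q hst x' := by
  induction x using genW_induction with
  | hK r => exact ⟨algebraMap K _ r, by simp⟩
  | hmul x y hx hy =>
    obtain ⟨x', hx⟩ := hx
    obtain ⟨y', hy⟩ := hy
    exact ⟨x' * y', by rw [map_mul, map_mul, map_mul, hx, hy]⟩
  | hadd x y hx hy =>
    obtain ⟨x', hx⟩ := hx
    obtain ⟨y', hy⟩ := hy
    exact ⟨x' + y', by rw [map_add, map_add, map_add, hx, hy]⟩
  | hgen g =>
    cases g with
    | psi a =>
      rcases Nat.lt_or_ge 1 a.val with h | h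
      · exact ⟨genW q (.psi a), by
          rw [phiHom_psi hst (by omega)]; exact conjV_psi hz h⟩
      rcases Nat.eq_zero_or_pos a.val with h0 | h0
      · obtain rfl : a = z := Fin.ext (h0.trans hz.symm)
        exact ⟨genW q (.psi o), by
          rw [phiHom_psi0 hst hz ho, conjV_conjV, phiHom_psi hst (by omega)]⟩
      · obtain rfl : a = o := Fin.ext (by omega)
        exact ⟨genW q (.psi z), by rw [phiHom_psi0 hst hz ho, phiHom_psi hst (by omega)]⟩
    | y j =>
      by_cases hj : j = z
      · subst hj
        exact ⟨-genW q (.y j), by rw [map_neg, phiHom_y]; exact conjV_y_first hz⟩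
      · exact ⟨genW q (.y j), by rw [phiHom_y]; exact conjV_y hz hj⟩
    | e i => exact ⟨genW q (.e (actB hst z i)), by rw [phiHom_e, phiHom_e]; exact conjV_e hst hz i⟩

/-- Since `ψ_0` normalises the image A and squares to 1, the sum A + A`ψ_0` is closed under
products; it contains all generators of V. -/
lemma exists_phiHom_add (hst : IsStableB β) {z o : Fin n} (hz : z.val = 0) (ho : o.val = 1)
    (x : AlgV q β) : ∃ a b, x = phiHom q hst a + phiHom q hst b * genV q (.psi z) := by
  induction x using genV_induction with
  | hK r => exact ⟨algebraMap K _ r, 0, by simp⟩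
  | hmul x y hx hy =>
    obtain ⟨a, b, rfl⟩ := hx
    obtain ⟨c, d, rfl⟩ := hy
    obtain ⟨c', hc⟩ := conjV_phiHom hst hz ho c
    obtain ⟨d', hd⟩ := conjV_phiHom hst hz ho d
    have hc' := psi0_mul_eq_conjV hz (phiHom q hst c)
    have hd' := psi0_mul_eq_conjV hz (phiHom q hst d)
    rw [hc] at hc'
    rw [hd] at hd'
    refine ⟨a * c + b * d', a * d + b * c', ?_⟩
    have hsq := psi0_sqV (q := q) (β := β) hz
    simp only [map_add, map_mul, mul_add, add_mul]
    rw [mul_assoc (phiHom q hst b) _ (phiHom q hst c), hc',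
      mul_assoc (phiHom q hst b) _ (phiHom q hst d * _),
      ← mul_assoc (genV q (.psi z)) (phiHom q hst d), hd', mul_assoc (phiHom q hst d'), hsq, mul_one]
    simp only [mul_assoc]
    abel
  | hadd x y hx hy =>
    obtain ⟨a, b, rfl⟩ := hx
    obtain ⟨c, d, rfl⟩ := hy
    refine ⟨a + c, b + d, ?_⟩
    simp only [map_add, add_mul]
    abel
  | hgen g =>
    cases g with
    | psi a =>
      by_cases h0 : a.val = 0
      · obtain rfl : a = z := Fin.ext (h0.trans hz.symm)
        exact ⟨0, 1, by simp⟩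
      · exact ⟨genW q (.psi a), 0, by simp [phiHom_psi hst h0]⟩
    | y j => exact ⟨genW q (.y j), 0, by simp [phiHom_y]⟩
    | e i => exact ⟨genW q (.e i), 0, by simp [phiHom_e]⟩

lemma rhoHom_phiHom (hst : IsStableB β) (hn : 2 ≤ n) (x : AlgW q β) :
    rhoHom q β (phiHom q hst x) = phiHom q hst x := by
  induction x using genW_induction with
  | hK r => simp
  | hmul x y hx hy => rw [map_mul, map_mul, hx, hy]
  | hadd x y hx hy => rw [map_add, map_add, hx, hy]
  | hgen g =>
    rw [phiHom_gen]
    cases g with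
    | psi a =>
      by_cases h0 : a.val = 0
      · simp [phiGen, h0, hn, rhoHom_gen, rhoGen]
      · simp [phiGen, h0, rhoHom_gen, rhoGen]
    | y j => simp [phiGen, rhoHom_gen, rhoGen]
    | e i => simp [phiGen, rhoHom_gen, rhoGen]

lemma mem_fixedV {x : AlgV q β} : x ∈ fixedV q β ↔ rhoHom q β x = x := Iff.rfl

/-- The involution maps `a + b ψ_0` to `a - b ψ_0`, so a fixed point satisfies `2 b ψ_0 = 0`. -/
lemma exists_phiHom_of_mem_fixedV (h2 : (2 : K) ≠ 0) (hst : IsStableB β) (hn : 2 ≤ n)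
    {x : AlgV q β} (hx : x ∈ fixedV q β) : ∃ a, phiHom q hst a = x := by
  obtain ⟨a, b, rfl⟩ := exists_phiHom_add hst (z := ⟨0, by omega⟩) (o := ⟨1, by omega⟩) rfl rfl x
  rw [mem_fixedV, map_add, map_mul, rhoHom_phiHom hst hn, rhoHom_phiHom hst hn, rhoHom_gen] at hx
  simp only [rhoGen, if_true, add_right_inj, mul_neg] at hx
  have h0 : (2 : K) • (phiHom q hst b * genV q (.psi ⟨0, by omega⟩)) = 0 := by
    rw [two_smul]
    nth_rw 1 [← hx]
    exact neg_add_cancel _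
  rw [smul_eq_zero_iff_right h2] at h0
  exact ⟨a, by rw [h0, add_zero]⟩

/-- The homomorphism from `W` to `V` as an isomorphism onto the fixed points of `ρ`. -/
noncomputable def phiEquiv (h2 : (2 : K) ≠ 0) (hst : IsStableB β) (hn : 2 ≤ n)
    (hinj : Function.Injective (phiHom q hst)) : AlgW q β ≃ₐ[K] fixedV q β :=
  AlgEquiv.ofBijective
    ((phiHom q hst).codRestrict (fixedV q β) fun x => mem_fixedV.2 (rhoHom_phiHom hst hn x))
    ⟨fun x y h => hinj (congrArg Subtype.val h), fun x => by
      obtain ⟨a, ha⟩ := exists_phiHom_of_mem_fixedV h2 hst hn x.2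
      exact ⟨a, Subtype.ext ha⟩⟩

lemma phiEquiv_coe (h2 : (2 : K) ≠ 0) (hst : IsStableB β) (hn : 2 ≤ n)
    (hinj : Function.Injective (phiHom q hst)) (x : AlgW q β) :
    (phiEquiv h2 hst hn hinj x : AlgV q β) = phiHom q hst x := rfl

end Homomorphism

/-! ### Coefficients of the representation, and arrows as equations -/

section Coefficients

variable {K L : Type*} [Field K] [Field L]

open Classical in
/-- The coefficient of the transposition in the action of `ψ_b`. -/
noncomputable def coeffSwap (q : K) (p p' : K) (u v : L) : L :=
  if p = p' then (u - v)⁻¹ else if p = q ^ 2 * p' then u - v else 1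

open Classical in
/-- The coefficient of the identity in the action of `ψ_b`. -/
noncomputable def coeffId {K : Type*} (p p' : K) (u v : L) : L :=
  if p = p' then -(u - v)⁻¹ else 0

open Classical in
/-- The scalar by which `ψ_b ^ 2` acts. -/
noncomputable def coeffSq (q : K) (p p' : K) (u v : L) : L :=
  if p = p' then 0 else coeffSwap q p p' u v * coeffSwap q p' p v u

lemma map_coeffSwap [Algebra K L] (f : L →ₐ[K] L) (q p p' : K) (u v : L) :
    f (coeffSwap q p p' u v) = coeffSwap q p p' (f u) (f v) := by
  unfold coeffSwap; split_ifs <;> simp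

lemma map_coeffId [Algebra K L] (f : L →ₐ[K] L) (p p' : K) (u v : L) :
    f (coeffId p p' u v) = coeffId p p' (f u) (f v) := by
  unfold coeffId; split_ifs <;> simp

lemma coeffId_of_ne {K : Type*} {p p' : K} (h : p ≠ p') (u v : L) : coeffId p p' u v = 0 := by
  simp [coeffId, h]

lemma coeffSwap_ne_zero (q p p' : K) {u v : L} (h : u ≠ v) : coeffSwap q p p' u v ≠ 0 := by
  have := sub_ne_zero.2 h
  unfold coeffSwap; split_ifs <;> simp [this]

lemma inv_eq_sq_mul_inv {q : K} (hq0 : q ≠ 0) {p p' : K} :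
    p'⁻¹ = q ^ 2 * p⁻¹ ↔ p = q ^ 2 * p' := by
  have h2 : q ^ 2 ≠ 0 := pow_ne_zero 2 hq0
  constructor
  · intro h
    have := congrArg Inv.inv h
    rw [inv_inv, mul_inv, inv_inv] at this
    rw [this, mul_inv_cancel_left₀ h2]
  · rintro rfl
    rw [mul_inv, mul_inv_cancel_left₀ h2]

/-- The coefficients depend only on the ratio of the entries and the difference of the variables.
This symmetry, with `coeffId_inv`, is what makes the four-term braid relation hold in the
representation. -/
lemma coeffSwap_inv {q : K} (hq0 : q ≠ 0) (p p' : K) (u v : L) :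
    coeffSwap q p'⁻¹ p⁻¹ (-v) (-u) = coeffSwap q p p' u v := by
  unfold coeffSwap
  rw [inv_eq_sq_mul_inv hq0, inv_inj, eq_comm (a := p')]
  simp only [neg_sub_neg]

lemma coeffId_inv (p p' : K) (u v : L) :
    coeffId p'⁻¹ p⁻¹ (-v) (-u) = coeffId p p' u v := by
  unfold coeffId
  rw [inv_inj, eq_comm (a := p')]
  simp only [neg_sub_neg]

/-- The `spec` lemmas express arrows by equations `x = q ^ 2 * y` in the two orders, which are the
conditions tested in `coeffSwap`. -/
lemma ArrowTo.spec {q : K} (hq0 : q ≠ 0) {i j : K} (h : ArrowTo q i j) :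
    j = q ^ 2 * i ∧ i ≠ q ^ 2 * j ∧ i ≠ j := by
  obtain ⟨h1, h2⟩ := h
  have hq2 : q ^ 2 ≠ 0 := pow_ne_zero 2 hq0
  have h3 : i ≠ q ^ 2 * j := fun h => h2 (by rw [← h1, h, inv_mul_cancel_left₀ hq2])
  refine ⟨h1, h3, ?_⟩
  rintro rfl
  exact h3 h1

lemma ArrowFrom.spec {q : K} (hq0 : q ≠ 0) {i j : K} (h : ArrowFrom q i j) :
    i = q ^ 2 * j ∧ j ≠ q ^ 2 * i ∧ i ≠ j := by
  obtain ⟨h1, h2⟩ := h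
  have hq2 : q ^ 2 ≠ 0 := pow_ne_zero 2 hq0
  have h3 : i = q ^ 2 * j := by rw [h1, mul_inv_cancel_left₀ hq2]
  have h4 : j ≠ q ^ 2 * i := fun h => h2 (by rw [← h1, ← h])
  refine ⟨h3, h4, ?_⟩
  rintro rfl
  exact h4 h3

/-- For a double arrow the two equations are symmetric, so they cannot separate `i` from `j`;
distinctness comes from `q ^ 2 ≠ 1` and `i ≠ 0`. -/
lemma ArrowBoth.spec {q : K} (hq0 : q ≠ 0) (hq : q ^ 2 ≠ 1) {i j : K} (hi : i ≠ 0)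
    (h : ArrowBoth q i j) : j = q ^ 2 * i ∧ i = q ^ 2 * j ∧ i ≠ j := by
  obtain ⟨h1, h2⟩ := h
  have hq2 : q ^ 2 ≠ 0 := pow_ne_zero 2 hq0
  refine ⟨h1, by rw [h1, h2, mul_inv_cancel_left₀ hq2], ?_⟩
  rintro rfl
  exact hq ((mul_eq_right₀ hi).1 h1.symm)

lemma NoArrow.spec {q : K} (hq0 : q ≠ 0) {i j : K} (h : NoArrow q i j) :
    j ≠ q ^ 2 * i ∧ i ≠ q ^ 2 * j ∧ i ≠ j := by
  obtain ⟨h1, h2, h3⟩ := h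
  have hq2 : q ^ 2 ≠ 0 := pow_ne_zero 2 hq0
  exact ⟨h2, fun h => h3 (by rw [h, inv_mul_cancel_left₀ hq2]), h1⟩

lemma not_arrow_spec {q : K} (hq0 : q ≠ 0) {i j : K}
    (h : ¬(ArrowTo q i j ∨ ArrowFrom q i j ∨ ArrowBoth q i j)) :
    j ≠ q ^ 2 * i ∧ i ≠ q ^ 2 * j := by
  have hq2 : q ^ 2 ≠ 0 := pow_ne_zero 2 hq0
  constructor
  · intro h1
    by_cases h2 : q ^ 2 * i = (q ^ 2)⁻¹ * i
    · exact h (Or.inr (Or.inr ⟨h1, h2⟩))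
    · exact h (Or.inl ⟨h1, h2⟩)
  · intro h1
    have h1' : j = (q ^ 2)⁻¹ * i := by rw [h1, inv_mul_cancel_left₀ hq2]
    by_cases h2 : q ^ 2 * i = (q ^ 2)⁻¹ * i
    · exact h (Or.inr (Or.inr ⟨h1'.trans h2.symm, h2⟩))
    · exact h (Or.inr (Or.inl ⟨h1', fun h => h2 h.symm⟩))

end Coefficients

/-! ### The representation of V on functions with values in a field -/

/-- A field in `n` variables with the action of the simple reflections of type B. -/
structure VarField (K L : Type*) [Field K] [Field L] [Algebra K L] (n : ℕ) where
  /-- The variables. -/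
  Y : Fin n → L
  Y_inj : Function.Injective Y
  hom_ext : ∀ f g : L →ₐ[K] L, (∀ j, f (Y j) = g (Y j)) → f = g
  /-- The simple reflections. -/
  s : Fin n → L →ₐ[K] L
  s_pos : ∀ b j : Fin n, b.val ≠ 0 → s b (Y j) = Y (Equiv.swap (pre b) b j)
  s_zero_same : ∀ b : Fin n, b.val = 0 → s b (Y b) = -Y b
  s_zero_ne : ∀ b j : Fin n, b.val = 0 → j ≠ b → s b (Y j) = Y j

namespace VarField

variable {K L : Type*} [Field K] [Field L] [Algebra K L] {n : ℕ} (M : VarField K L n)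

/-- The Coxeter relations between the reflections are all checked on the variables by means of this.
-/
lemma apply_eq {f g : L →ₐ[K] L} (h : ∀ j, f (M.Y j) = g (M.Y j)) (x : L) : f x = g x := by
  rw [M.hom_ext f g h]

lemma s_s (b : Fin n) (x : L) : M.s b (M.s b x) = x := by
  refine M.apply_eq (f := (M.s b).comp (M.s b)) (g := AlgHom.id K L) (fun j => ?_) x
  by_cases hb : b.val = 0
  · by_cases hj : j = b
    · subst hj; simp [M.s_zero_same _ hb]
    · simp [M.s_zero_ne _ _ hb hj]
  · simp [M.s_pos _ _ hb]

lemma s_comm {a b : Fin n} (ha : a.val ≠ 0) (hb : b.val ≠ 0)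
    (h : a.val + 1 < b.val ∨ b.val + 1 < a.val) (x : L) :
    M.s a (M.s b x) = M.s b (M.s a x) := by
  refine M.apply_eq (f := (M.s a).comp (M.s b)) (g := (M.s b).comp (M.s a)) (fun j => ?_) x
  simp only [AlgHom.comp_apply, M.s_pos _ _ ha, M.s_pos _ _ hb]
  congr 1
  have e1 := pre_val_add_one ha
  have e2 := pre_val_add_one hb
  have h1 : pre a ≠ pre b := fun h => by rw [h] at e1; omega
  have h2 : pre a ≠ b := fun h => by rw [h] at e1; omega
  have h3 : a ≠ pre b := fun h => by rw [← h] at e2; omega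
  have h4 : a ≠ b := fun h => by subst h; omega
  rw [← Equiv.Perm.mul_apply, ← Equiv.Perm.mul_apply]
  refine congrFun (congrArg _ (Equiv.Perm.Disjoint.commute ?_)) j
  intro t
  by_cases hta : t = a ∨ t = pre a
  · right
    rcases hta with rfl | rfl
    · exact Equiv.swap_apply_of_ne_of_ne h3 h4
    · exact Equiv.swap_apply_of_ne_of_ne h1 h2
  · left
    push Not at hta
    exact Equiv.swap_apply_of_ne_of_ne hta.2 hta.1

lemma s_zero_comm {z b : Fin n} (hz : z.val = 0) (hb : 1 < b.val) (x : L) :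
    M.s z (M.s b x) = M.s b (M.s z x) := by
  refine M.apply_eq (f := (M.s z).comp (M.s b)) (g := (M.s b).comp (M.s z)) (fun j => ?_) x
  have hb0 : b.val ≠ 0 := by omega
  have e2 := pre_val_add_one hb0
  have h1 : z ≠ pre b := fun h => by rw [← h] at e2; omega
  have h2 : z ≠ b := fun h => by rw [← h] at hb; omega
  simp only [AlgHom.comp_apply, M.s_pos _ _ hb0]
  by_cases hj : j = z
  · subst hj
    rw [Equiv.swap_apply_of_ne_of_ne h1 h2, M.s_zero_same _ hz, map_neg, M.s_pos _ _ hb0,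
      Equiv.swap_apply_of_ne_of_ne h1 h2]
  · have : Equiv.swap (pre b) b j ≠ z := by
      intro h
      rw [Equiv.swap_apply_eq_iff, Equiv.swap_apply_of_ne_of_ne h1 h2] at h
      exact hj h
    rw [M.s_zero_ne _ _ hz this, M.s_zero_ne _ _ hz hj, M.s_pos _ _ hb0]

lemma s_braid {b c : Fin n} (hb : b.val ≠ 0) (hc : b.val + 1 = c.val) (x : L) :
    M.s b (M.s c (M.s b x)) = M.s c (M.s b (M.s c x)) := by
  refine M.apply_eq (f := (M.s b).comp ((M.s c).comp (M.s b)))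
    (g := (M.s c).comp ((M.s b).comp (M.s c))) (fun j => ?_) x
  have hc0 : c.val ≠ 0 := by omega
  have e : pre c = b := (eq_pre hc).symm
  simp only [AlgHom.comp_apply, M.s_pos _ _ hb, M.s_pos _ _ hc0, e]
  congr 1
  have e1 := pre_val_add_one hb
  have h1 : pre b ≠ b := pre_ne hb
  have h2 : pre b ≠ c := fun h => by rw [h] at e1; omega
  have h3 : b ≠ c := fun h => by rw [h] at hc; omega
  by_cases hj1 : j = pre b
  · subst hj1
    simp [Equiv.swap_apply_of_ne_of_ne h1 h2, Equiv.swap_apply_of_ne_of_ne h2.symm h3.symm]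
  by_cases hj2 : j = b
  · subst hj2
    simp [Equiv.swap_apply_of_ne_of_ne h1 h2, Equiv.swap_apply_of_ne_of_ne h2.symm h3.symm]
  by_cases hj3 : j = c
  · subst hj3
    simp [Equiv.swap_apply_of_ne_of_ne h1 h2, Equiv.swap_apply_of_ne_of_ne h2.symm h3.symm]
  simp [Equiv.swap_apply_of_ne_of_ne, hj1, hj2, hj3]

lemma s_zero_braid {z o : Fin n} (hz : z.val = 0) (ho : o.val = 1) (x : L) :
    M.s z (M.s o (M.s z (M.s o x))) = M.s o (M.s z (M.s o (M.s z x))) := by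
  refine M.apply_eq (f := (M.s z).comp ((M.s o).comp ((M.s z).comp (M.s o))))
    (g := (M.s o).comp ((M.s z).comp ((M.s o).comp (M.s z)))) (fun j => ?_) x
  have ho0 : o.val ≠ 0 := by omega
  have e : pre o = z := (eq_pre (by omega)).symm
  have hoz : o ≠ z := fun h => by rw [h] at ho; omega
  simp only [AlgHom.comp_apply]
  by_cases hj1 : j = z
  · subst hj1
    simp [M.s_pos _ _ ho0, e, M.s_zero_same _ hz, M.s_zero_ne _ _ hz hoz]
  by_cases hj2 : j = o
  · subst hj2
    simp [M.s_pos _ _ ho0, e, M.s_zero_same _ hz, M.s_zero_ne _ _ hz hoz]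
  simp [M.s_pos _ _ ho0, e, M.s_zero_ne _ _ hz hj1, Equiv.swap_apply_of_ne_of_ne hj1 hj2]

variable {q : K} {β : Finset (Fin n → K)} (hst : IsStableB β)

/-- The coefficient of the reflection in the action of `ψ_b`. -/
noncomputable def cSwap (q : K) (b : Fin n) (t : β) : L :=
  if b.val = 0 then 1 else coeffSwap q (t.1 (pre b)) (t.1 b) (M.Y (pre b)) (M.Y b)

/-- The coefficient of the identity in the action of `ψ_b`. -/
noncomputable def cId (b : Fin n) (t : β) : L :=
  if b.val = 0 then 0 else coeffId (t.1 (pre b)) (t.1 b) (M.Y (pre b)) (M.Y b)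

/-- The action of `ψ_b`. -/
noncomputable def psiOp (q : K) (b : Fin n) : Module.End K (β → L) where
  toFun F t := M.cSwap q b t * M.s b (F (actB hst b t)) + M.cId b t * F t
  map_add' F G := by
    funext t
    simp only [Pi.add_apply, map_add]
    ring
  map_smul' r F := by
    funext t
    simp only [Pi.smul_apply, map_smul, RingHom.id_apply, mul_smul_comm, smul_add]

lemma psiOp_apply (b : Fin n) (F : β → L) (t : β) :
    M.psiOp hst q b F t = M.cSwap q b t * M.s b (F (actB hst b t)) + M.cId b t * F t := rfl

lemma psiOp_zero {b : Fin n} (hb : b.val = 0) (F : β → L) (t : β) :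
    M.psiOp hst q b F t = M.s b (F (actB hst b t)) := by
  simp [psiOp_apply, cSwap, cId, hb]

lemma psiOp_pos {b : Fin n} (hb : b.val ≠ 0) (F : β → L) (t : β) :
    M.psiOp hst q b F t =
      coeffSwap q (t.1 (pre b)) (t.1 b) (M.Y (pre b)) (M.Y b) * M.s b (F (actB hst b t)) +
        coeffId (t.1 (pre b)) (t.1 b) (M.Y (pre b)) (M.Y b) * F t := by
  simp [psiOp_apply, cSwap, cId, hb]

/-- The action of `y_j`. -/
noncomputable def yOp (β : Finset (Fin n → K)) (j : Fin n) : Module.End K (β → L) where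
  toFun F t := M.Y j * F t
  map_add' F G := by funext t; simp only [Pi.add_apply, mul_add]
  map_smul' r F := by funext t; simp only [Pi.smul_apply, RingHom.id_apply, mul_smul_comm]

lemma yOp_apply (j : Fin n) (F : β → L) (t : β) : M.yOp β j F t = M.Y j * F t := rfl

open Classical in
/-- The action of `e(i)`. -/
noncomputable def eOp (L : Type*) [Field L] [Algebra K L] (i : β) : Module.End K (β → L) where
  toFun F t := if t = i then F t else 0
  map_add' F G := by
    funext t
    simp only [Pi.add_apply]
    split_ifs <;> simp
  map_smul' r F := by
    funext t
    simp only [Pi.smul_apply, RingHom.id_apply]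
    split_ifs <;> simp

open Classical in
lemma eOp_apply (i : β) (F : β → L) (t : β) : eOp (K := K) L i F t = if t = i then F t else 0 :=
  rfl

/-- The action of the generators of `V`. -/
noncomputable def opGen (q : K) : Gen β → Module.End K (β → L)
  | .psi a => M.psiOp hst q a
  | .y j => M.yOp β j
  | .e i => eOp L i

-- In the relations `X e(i) = Z` below, `X` turns out to be pointwise multiplication by a function
-- on `β`; only its value at `i` then matters.
open Classical in
lemma mul_eOp_eq {X Z : Module.End K (β → L)} (c : β → L) (hX : ∀ G t, X G t = c t * G t) (i : β)
    (hZ : ∀ F t, Z F t = if t = i then c i * F i else 0) : X * eOp L i = Z := by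
  apply LinearMap.ext
  intro F
  funext t
  rw [Module.End.mul_apply, hX, hZ, eOp_apply]
  split_ifs with h
  · rw [h]
  · rw [mul_zero]

/-- The identity term of `ψ_b` occurs only where the two entries agree, and such tuples are fixed by
the exchange. Hence both terms of `ψ_b` map the component at `i` to the component at `r_b i`. -/
lemma cId_eq_zero_or (b : Fin n) (t : β) : M.cId b t = 0 ∨ actB hst b t = t := by
  by_cases hb : b.val = 0
  · left; simp [cId, hb]
  by_cases h : t.1 (pre b) = t.1 b
  · right
    apply Subtype.ext
    rw [actB_pos hst hb]
    funext j
    simp only [Function.comp_apply, Equiv.swap_apply_def]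
    split_ifs with h1 h2
    · rw [h1, h]
    · rw [h2, h]
    · rfl
  · left; simp [cId, hb, coeffId, h]

lemma psiOp_eOp (b : Fin n) (i i' : β) (h : i' = actB hst b i) :
    M.psiOp hst q b * eOp L i = eOp L i' * M.psiOp hst q b := by
  apply LinearMap.ext
  intro F
  funext t
  rw [Module.End.mul_apply, Module.End.mul_apply, eOp_apply, psiOp_apply, psiOp_apply, eOp_apply,
    eOp_apply]
  have h1 : t = i' ↔ actB hst b t = i := by
    rw [h]
    constructor
    · rintro rfl; exact actB_actB hst b i
    · rintro rfl; exact (actB_actB hst b t).symm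
  by_cases h3 : actB hst b t = i
  · rw [if_pos h3, if_pos (h1.2 h3)]
    rcases M.cId_eq_zero_or hst b t with h2 | h2
    · rw [h2, zero_mul, zero_mul]
    · rw [if_pos (h2.symm.trans h3)]
  · rw [if_neg h3, if_neg fun h => h3 (h1.1 h), map_zero, mul_zero, zero_add]
    rcases M.cId_eq_zero_or hst b t with h2 | h2
    · rw [h2, zero_mul]
    · rw [if_neg fun h => h3 (h2.trans h), mul_zero]

lemma actB_left {k b : Fin n} (hb : k.val + 1 = b.val) (t : β) :
    (actB hst b t).1 k = t.1 b := by
  rw [actB_pos hst (by omega), eq_pre hb]; simp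

lemma actB_right {k b : Fin n} (hb : k.val + 1 = b.val) (t : β) :
    (actB hst b t).1 b = t.1 k := by
  rw [actB_pos hst (by omega), eq_pre hb]; simp

lemma actB_of_ne {k b j : Fin n} (hb : k.val + 1 = b.val) (h1 : j.val ≠ k.val)
    (h2 : j.val ≠ b.val) (t : β) : (actB hst b t).1 j = t.1 j := by
  rw [actB_pos hst (by omega), ← eq_pre hb]
  simp [Equiv.swap_apply_of_ne_of_ne (Fin.val_ne_iff.1 h1) (Fin.val_ne_iff.1 h2)]

lemma s_left {k b : Fin n} (hb : k.val + 1 = b.val) : M.s b (M.Y k) = M.Y b := by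
  rw [M.s_pos _ _ (by omega), eq_pre hb]; simp

lemma s_right {k b : Fin n} (hb : k.val + 1 = b.val) : M.s b (M.Y b) = M.Y k := by
  rw [M.s_pos _ _ (by omega), eq_pre hb]; simp

lemma s_of_ne {k b j : Fin n} (hb : k.val + 1 = b.val) (h1 : j.val ≠ k.val)
    (h2 : j.val ≠ b.val) : M.s b (M.Y j) = M.Y j := by
  rw [M.s_pos _ _ (by omega), ← eq_pre hb,
    Equiv.swap_apply_of_ne_of_ne (Fin.val_ne_iff.1 h1) (Fin.val_ne_iff.1 h2)]

lemma psiOp_succ {k b : Fin n} (hb : k.val + 1 = b.val) (F : β → L) (t : β) :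
    M.psiOp hst q b F t =
      coeffSwap q (t.1 k) (t.1 b) (M.Y k) (M.Y b) * M.s b (F (actB hst b t)) +
        coeffId (t.1 k) (t.1 b) (M.Y k) (M.Y b) * F t := by
  rw [eq_pre hb, psiOp_pos M hst (by omega)]

/-- The reflection term cancels because `s_b` exchanges the two variables; only the identity term is
left. -/
lemma psiOp_y {k b : Fin n} (hb : k.val + 1 = b.val) (j : Fin n) (G : β → L) (t : β) :
    (M.psiOp hst q b * M.yOp β j - M.yOp β (Equiv.swap k b j) * M.psiOp hst q b) G t =
      coeffId (t.1 k) (t.1 b) (M.Y k) (M.Y b) * (M.Y j - M.Y (Equiv.swap k b j)) * G t := by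
  simp only [LinearMap.sub_apply, Module.End.mul_apply, Pi.sub_apply, yOp_apply,
    M.psiOp_succ hst hb, map_mul, M.s_pos b _ (show b.val ≠ 0 by omega), ← eq_pre hb]
  ring

lemma actB_eq_self {k b : Fin n} (hb : k.val + 1 = b.val) {t : β} (h : t.1 k = t.1 b) :
    actB hst b t = t := by
  apply Subtype.ext
  rw [actB_pos hst (by omega), ← eq_pre hb]
  funext j
  simp only [Function.comp_apply, Equiv.swap_apply_def]
  split_ifs with h1 h2
  · rw [h1, h]
  · rw [h2, h]
  · rfl

/-- Where the entries agree, `ψ_b` is a divided difference up to sign and squares to 0. Elsewhere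
the identity terms vanish and the two reflection coefficients multiply. -/
lemma psiOp_sq {k b : Fin n} (hb : k.val + 1 = b.val) (G : β → L) (t : β) :
    (M.psiOp hst q b ^ 2) G t =
      coeffSq q (t.1 k) (t.1 b) (M.Y k) (M.Y b) * G t := by
  rw [sq, Module.End.mul_apply, M.psiOp_succ hst hb, M.psiOp_succ hst hb, M.psiOp_succ hst hb]
  simp only [map_add, map_mul, map_coeffSwap, map_coeffId, actB_left hst hb, actB_right hst hb,
    M.s_left hb, M.s_right hb, M.s_s, actB_actB]
  by_cases h : t.1 k = t.1 b
  · have h1 : M.Y k - M.Y b ≠ 0 := sub_ne_zero.2 fun h => by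
      have := M.Y_inj h
      rw [this] at hb
      omega
    have h2 : M.Y b - M.Y k ≠ 0 := by rw [← neg_sub]; exact neg_ne_zero.2 h1
    simp only [actB_eq_self hst hb h, coeffSwap, coeffId, coeffSq, h, if_true]
    rw [← neg_sub (M.Y k) (M.Y b)]
    field_simp
    ring
  · have h' : t.1 b ≠ t.1 k := fun hh => h hh.symm
    simp only [coeffSq, if_neg h, coeffId_of_ne h, coeffId_of_ne h']
    ring

/-- The scalar by which the difference of the two sides of a braid relation acts. -/
noncomputable def coeffBraid (q p m r : K) (u v w : L) : L :=
  coeffId p r u w * (coeffSq q p m u v - coeffSq q m r v w)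

/-- The top terms of the two sides agree, and so do most of the lower ones. The exception arises
when only the outer entries agree: the middle factor then contributes its identity term, and the
outer two factors collapse to `ψ_b ^ 2` on one side and to `ψ_c ^ 2` on the other. This is the
difference recorded in `coeffBraid`. -/
lemma psiOp_braid {k b c : Fin n} (hb : k.val + 1 = b.val) (hc : b.val + 1 = c.val) (G : β → L)
    (t : β) :
    (M.psiOp hst q b * M.psiOp hst q c * M.psiOp hst q b -
      M.psiOp hst q c * M.psiOp hst q b * M.psiOp hst q c) G t =
      coeffBraid q (t.1 k) (t.1 b) (t.1 c) (M.Y k) (M.Y b) (M.Y c) * G t := by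
  have hck : c.val ≠ k.val := by omega
  have hcb : c.val ≠ b.val := by omega
  have hkb : k.val ≠ b.val := by omega
  have huv : M.Y k - M.Y b ≠ 0 := sub_ne_zero.2 fun h => hkb (congrArg _ (M.Y_inj h))
  have huw : M.Y k - M.Y c ≠ 0 := sub_ne_zero.2 fun h => hck (congrArg _ (M.Y_inj h)).symm
  have hvw : M.Y b - M.Y c ≠ 0 := sub_ne_zero.2 fun h => hcb (congrArg _ (M.Y_inj h)).symm
  have hact : actB hst b (actB hst c (actB hst b t)) = actB hst c (actB hst b (actB hst c t)) := by
    apply Subtype.ext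
    have e1 : pre c = b := (eq_pre hc).symm
    have e2 : pre b = k := (eq_pre hb).symm
    simp only [actB_pos hst (show b.val ≠ 0 by omega), actB_pos hst (show c.val ≠ 0 by omega), e1,
      e2]
    have h1 : k ≠ b := Fin.val_ne_iff.1 hkb
    have h2 : c ≠ k := Fin.val_ne_iff.1 hck
    have h3 : c ≠ b := Fin.val_ne_iff.1 hcb
    funext j
    simp only [Function.comp_apply]
    by_cases hj1 : j = k
    · subst hj1
      simp [Equiv.swap_apply_of_ne_of_ne h1 h2.symm, Equiv.swap_apply_of_ne_of_ne h2 h3]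
    by_cases hj2 : j = b
    · subst hj2
      simp [Equiv.swap_apply_of_ne_of_ne h1 h2.symm, Equiv.swap_apply_of_ne_of_ne h2 h3]
    by_cases hj3 : j = c
    · subst hj3
      simp [Equiv.swap_apply_of_ne_of_ne h1 h2.symm, Equiv.swap_apply_of_ne_of_ne h2 h3]
    simp [Equiv.swap_apply_of_ne_of_ne, hj1, hj2, hj3]
  simp only [LinearMap.sub_apply, Module.End.mul_apply, Pi.sub_apply, M.psiOp_succ hst hb,
    M.psiOp_succ hst hc, map_add, map_mul, map_coeffSwap, map_coeffId, actB_left hst hb,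
    actB_right hst hb, actB_left hst hc, actB_right hst hc, actB_of_ne hst hb hck hcb,
    actB_of_ne hst hc hkb hck.symm, M.s_left hb, M.s_right hb, M.s_left hc, M.s_right hc,
    M.s_of_ne hb hck hcb, M.s_of_ne hc hkb hck.symm, M.s_s, actB_actB, hact,
    M.s_braid (show b.val ≠ 0 by omega) hc]
  by_cases h1 : t.1 k = t.1 b
  · by_cases h2 : t.1 b = t.1 c
    -- Three equal entries: the braid relation of divided differences, an identity of rational
    -- functions in three variables.
    · have e1 := actB_eq_self hst hb h1
      have e2 := actB_eq_self hst hc h2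
      have h3 : t.1 k = t.1 c := h1.trans h2
      have h1' : t.1 c = t.1 b := h2.symm
      have h2' : t.1 c = t.1 k := h3.symm
      simp only [e1, e2, h1, h1', coeffBraid, coeffSwap, coeffId, coeffSq, if_true]
      generalize M.Y k = u at *
      generalize M.Y b = v at *
      generalize M.Y c = w at *
      rw [← neg_sub u v, ← neg_sub v w]
      generalize M.s b (G t) = g1
      generalize M.s c (G t) = g2
      field_simp
      ring
    · have h3 : t.1 k ≠ t.1 c := h1 ▸ h2
      have h2' : t.1 c ≠ t.1 b := fun h => h2 h.symm
      have h3' : t.1 c ≠ t.1 k := fun h => h3 h.symm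
      simp only [coeffBraid, coeffId_of_ne h2, coeffId_of_ne h3, coeffId_of_ne h2']
      ring
  · have h1' : t.1 b ≠ t.1 k := fun h => h1 h.symm
    by_cases h2 : t.1 b = t.1 c
    · have h3 : t.1 k ≠ t.1 c := h2 ▸ h1
      have h3' : t.1 c ≠ t.1 k := fun h => h3 h.symm
      simp only [coeffBraid, coeffId_of_ne h1, coeffId_of_ne h3, coeffId_of_ne h1']
      ring
    · have h2' : t.1 c ≠ t.1 b := fun h => h2 h.symm
      by_cases h3 : t.1 k = t.1 c
      · simp only [coeffBraid, coeffSq, if_neg h1, if_neg h2, coeffId_of_ne h1, coeffId_of_ne h2,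
          coeffId_of_ne h1', coeffId_of_ne h2']
        ring
      · have h3' : t.1 c ≠ t.1 k := fun h => h3 h.symm
        simp only [coeffBraid, coeffId_of_ne h1, coeffId_of_ne h2, coeffId_of_ne h3,
          coeffId_of_ne h1', coeffId_of_ne h2']
        ring

lemma psiOp_comm {a b : Fin n} (ha : a.val ≠ 0) (hb : b.val ≠ 0)
    (h : a.val + 1 < b.val ∨ b.val + 1 < a.val) :
    M.psiOp hst q a * M.psiOp hst q b = M.psiOp hst q b * M.psiOp hst q a := by
  apply LinearMap.ext
  intro F
  funext t
  have ea := pre_val_add_one ha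
  have eb := pre_val_add_one hb
  have hact : actB hst a (actB hst b t) = actB hst b (actB hst a t) := by
    apply Subtype.ext
    simp only [actB_pos hst ha, actB_pos hst hb]
    funext j
    -- The exchanges of positions commute because the reflections commute on the variables, which
    -- are distinct.
    have := M.s_comm ha hb h (M.Y j)
    simp only [M.s_pos _ _ ha, M.s_pos _ _ hb] at this
    simp only [Function.comp_apply]
    rw [M.Y_inj this]
  simp only [Module.End.mul_apply, M.psiOp_succ hst ea, M.psiOp_succ hst eb, map_add, map_mul,
    map_coeffSwap, map_coeffId, hact, M.s_comm ha hb h,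
    actB_of_ne hst ea (show b.val ≠ (pre a).val by omega) (show b.val ≠ a.val by omega),
    actB_of_ne hst ea (show (pre b).val ≠ (pre a).val by omega)
      (show (pre b).val ≠ a.val by omega),
    actB_of_ne hst eb (show a.val ≠ (pre b).val by omega) (show a.val ≠ b.val by omega),
    actB_of_ne hst eb (show (pre a).val ≠ (pre b).val by omega)
      (show (pre a).val ≠ b.val by omega),
    M.s_of_ne ea (show b.val ≠ (pre a).val by omega) (show b.val ≠ a.val by omega),
    M.s_of_ne ea (show (pre b).val ≠ (pre a).val by omega)
      (show (pre b).val ≠ a.val by omega),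
    M.s_of_ne eb (show a.val ≠ (pre b).val by omega) (show a.val ≠ b.val by omega),
    M.s_of_ne eb (show (pre a).val ≠ (pre b).val by omega)
      (show (pre a).val ≠ b.val by omega)]
  ring

lemma psiOp_zero_comm {z b : Fin n} (hz : z.val = 0) (hb : 1 < b.val) :
    M.psiOp hst q z * M.psiOp hst q b = M.psiOp hst q b * M.psiOp hst q z := by
  apply LinearMap.ext
  intro F
  funext t
  have hb0 : b.val ≠ 0 := by omega
  have eb := pre_val_add_one hb0
  have hbz : b ≠ z := fun h => by rw [h] at hb; omega
  have hpz : pre b ≠ z := fun h => by rw [h] at eb; omega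
  have hact : actB hst z (actB hst b t) = actB hst b (actB hst z t) := by
    apply Subtype.ext
    simp only [actB_pos hst hb0, actB_zero hst hz, Function.comp_apply,
      Equiv.swap_apply_of_ne_of_ne hpz.symm hbz.symm]
    funext j
    by_cases hj : j = z
    · subst hj
      simp [Equiv.swap_apply_of_ne_of_ne hpz.symm hbz.symm]
    · have : Equiv.swap (pre b) b j ≠ z := by
        intro h
        rw [Equiv.swap_apply_eq_iff, Equiv.swap_apply_of_ne_of_ne hpz.symm hbz.symm] at h
        exact hj h
      simp [hj, this]
  simp only [Module.End.mul_apply, M.psiOp_zero hst hz, M.psiOp_succ hst eb, map_add, map_mul,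
    map_coeffSwap, map_coeffId, hact, M.s_zero_comm hz hb, M.s_zero_ne _ _ hz hbz,
    M.s_zero_ne _ _ hz hpz, actB_zero_of_ne hst hz hbz, actB_zero_of_ne hst hz hpz]

/-- Each side contains two factors `ψ_1`, whose coefficients are taken at the pairs of entries `(t
z, t o)` and `((t z)⁻¹, t o)`, up to the symmetries `coeffSwap_inv` and `coeffId_inv`. -/
lemma psiOp_zero_braid (hq0 : q ≠ 0) {z o : Fin n} (hz : z.val = 0) (ho : o.val = 1) :
    (M.psiOp hst q z * M.psiOp hst q o) ^ 2 = (M.psiOp hst q o * M.psiOp hst q z) ^ 2 := by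
  apply LinearMap.ext
  intro F
  funext t
  have eo : z.val + 1 = o.val := by omega
  have hoz : o ≠ z := fun h => by rw [h] at ho; omega
  have hact : actB hst z (actB hst o (actB hst z (actB hst o t))) =
      actB hst o (actB hst z (actB hst o (actB hst z t))) := by
    apply Subtype.ext
    simp only [actB_pos hst (show o.val ≠ 0 by omega), actB_zero hst hz, ← eq_pre eo]
    funext j
    by_cases hj1 : j = z
    · subst hj1; simp [hoz]
    by_cases hj2 : j = o
    · subst hj2; simp [hoz]
    simp [hj1, hj2, Equiv.swap_apply_of_ne_of_ne]
  simp only [sq, Module.End.mul_apply, M.psiOp_zero hst hz, M.psiOp_succ hst eo, map_add, map_mul,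
    map_neg, map_coeffSwap, map_coeffId, ← hact, ← M.s_zero_braid hz ho, M.s_zero_same _ hz,
    M.s_zero_ne _ _ hz hoz, actB_zero_of_ne hst hz hoz, actB_zero_same hst hz, M.s_left eo,
    M.s_right eo, actB_left hst eo, actB_right hst eo, M.s_s, actB_actB, coeffSwap_inv hq0,
    coeffId_inv]
  -- Identifies the coefficient at `((t o)⁻¹, t z)` with the one at `((t z)⁻¹, t o)`.
  have h1 := coeffSwap_inv hq0 (t.1 z)⁻¹ (t.1 o) (-M.Y z) (M.Y o)
  have h2 := coeffId_inv (t.1 z)⁻¹ (t.1 o) (-M.Y z) (M.Y o)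
  rw [inv_inv, neg_neg] at h1 h2
  rw [h1, h2, neg_neg]
  ring

end VarField

namespace VarField

variable {K L : Type*} [Field K] [Field L] [Algebra K L] {n : ℕ} (M : VarField K L n)
  {q : K} {β : Finset (Fin n → K)} (hst : IsStableB β)

lemma Y_sub_ne_zero {k b : Fin n} (hb : k.val + 1 = b.val) : M.Y k - M.Y b ≠ 0 :=
  sub_ne_zero.2 fun h => by
    have := M.Y_inj h
    rw [this] at hb
    omega

/-- The quadratic, braid and `ψ y` relations reduce, by `mul_eOp_eq` and the formulas for
`psiOp_sq`, `psiOp_braid` and `psiOp_y`, to evaluating one scalar at the tuple `i`. -/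
lemma opGen_relA (hq0 : q ≠ 0) (hq : q ^ 2 ≠ 1) (hnz : ∀ i ∈ β, ∀ k, i k ≠ 0)
    {x x' : FreeAlgebra K (Gen β)} (h : RelA q β x x') :
    FreeAlgebra.lift K (M.opGen hst q) x = FreeAlgebra.lift K (M.opGen hst q) x' := by
  cases h
  all_goals
    simp only [map_sum, map_mul, map_sub, map_add, map_neg, map_pow, map_one, map_zero, map_ofNat,
      FreeAlgebra.lift_ι_apply, opGen]
  case e_sum =>
    apply LinearMap.ext
    intro F
    funext t
    simp [eOp_apply, Finset.sum_apply]
  case e_idem i =>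
    apply LinearMap.ext
    intro F
    funext t
    simp only [Module.End.mul_apply, eOp_apply]
    split_ifs <;> rfl
  case e_orth i j h =>
    apply LinearMap.ext
    intro F
    funext t
    simp only [Module.End.mul_apply, eOp_apply]
    split_ifs with h1 h2
    · exact absurd (h1.symm.trans h2) h
    · rfl
    · rfl
  case y_comm j j' =>
    apply LinearMap.ext
    intro F
    funext t
    simp only [Module.End.mul_apply, yOp_apply]
    ring
  case y_e j i =>
    apply LinearMap.ext
    intro F
    funext t
    simp only [Module.End.mul_apply, yOp_apply, eOp_apply]
    split_ifs <;> simp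
  case psi_e k b hb i i' h =>
    apply M.psiOp_eOp hst
    apply Subtype.ext
    rw [h, actB_pos hst (by omega), eq_pre hb]
  case psi_y_left k b hb i h =>
    have key := M.psiOp_y (q := q) hst hb k
    rw [Equiv.swap_apply_left] at key
    refine mul_eOp_eq _ key i fun F t => ?_
    have := M.Y_sub_ne_zero hb
    simp only [LinearMap.neg_apply, Pi.neg_apply, eOp_apply, coeffId, if_pos h, neg_mul,
      inv_mul_cancel₀ this, one_mul]
    split_ifs with h1 <;> simp [h1]
  case psi_y_right k b hb i h =>
    have key := M.psiOp_y (q := q) hst hb b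
    rw [Equiv.swap_apply_right] at key
    refine mul_eOp_eq _ key i fun F t => ?_
    have := M.Y_sub_ne_zero hb
    rw [← neg_sub (M.Y k)]
    simp only [eOp_apply, coeffId, if_pos h, neg_mul_neg, inv_mul_cancel₀ this, one_mul]
    split_ifs with h1 <;> simp [h1]
  case psi_y_else k b hb j i h =>
    refine mul_eOp_eq _ (M.psiOp_y (q := q) hst hb j) i fun F t => ?_
    have : coeffId (i.1 k) (i.1 b) (M.Y k) (M.Y b) * (M.Y j - M.Y (Equiv.swap k b j)) = 0 := by
      by_cases h1 : i.1 k = i.1 b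
      · have hj : ¬(j = k ∨ j = b) := fun h2 => h ⟨h2, h1⟩
        push Not at hj
        rw [Equiv.swap_apply_of_ne_of_ne hj.1 hj.2, sub_self, mul_zero]
      · rw [coeffId_of_ne h1, zero_mul]
    simp [this]
  case psi_comm a b ha hb h => exact M.psiOp_comm hst ha hb h
  case sq_eq k b hb i h =>
    refine mul_eOp_eq _ (M.psiOp_sq (q := q) hst hb) i fun F t => ?_
    simp [coeffSq, h]
  case sq_none k b hb i h =>
    refine mul_eOp_eq _ (M.psiOp_sq (q := q) hst hb) i fun F t => ?_
    obtain ⟨h1, h2, h3⟩ := h.spec hq0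
    simp only [coeffSq, coeffSwap, if_neg h1, if_neg h2, if_neg h3, if_neg h3.symm, eOp_apply]
    split_ifs with h4 <;> simp [h4]
  case sq_to k b hb i h =>
    refine mul_eOp_eq _ (M.psiOp_sq (q := q) hst hb) i fun F t => ?_
    obtain ⟨h1, h2, h3⟩ := h.spec hq0
    simp only [coeffSq, coeffSwap, if_pos h1, if_neg h2, if_neg h3, if_neg h3.symm, eOp_apply,
      Module.End.mul_apply, LinearMap.sub_apply, Pi.sub_apply, yOp_apply]
    split_ifs with h4
    · rw [h4]; ring
    · ring
  case sq_from k b hb i h =>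
    refine mul_eOp_eq _ (M.psiOp_sq (q := q) hst hb) i fun F t => ?_
    obtain ⟨h1, h2, h3⟩ := h.spec hq0
    simp only [coeffSq, coeffSwap, if_pos h1, if_neg h2, if_neg h3, if_neg h3.symm, eOp_apply,
      Module.End.mul_apply, LinearMap.sub_apply, Pi.sub_apply, yOp_apply]
    split_ifs with h4
    · rw [h4]; ring
    · ring
  case sq_both k b hb i h =>
    refine mul_eOp_eq _ (M.psiOp_sq (q := q) hst hb) i fun F t => ?_
    obtain ⟨h1, h2, h3⟩ := h.spec hq0 hq (hnz _ i.2 _)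
    simp only [coeffSq, coeffSwap, if_pos h1, if_pos h2, if_neg h3, if_neg h3.symm, eOp_apply,
      Module.End.mul_apply, LinearMap.sub_apply, Pi.sub_apply, yOp_apply]
    split_ifs with h4
    · rw [h4]; ring
    · ring
  case braid_to k b c hb hc i h =>
    refine mul_eOp_eq _ (M.psiOp_braid (q := q) hst hb hc) i fun F t => ?_
    obtain ⟨h0, h⟩ := h
    obtain ⟨h1, h2, h3⟩ := h.spec hq0
    have hne : M.Y k - M.Y c ≠ 0 := sub_ne_zero.2 fun h => by have := M.Y_inj h; omega
    -- With `u, v, w` for the three variables, the two quadratic scalars are `v - u` and `v - w`;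
    -- their difference `w - u` cancels against `-(u - w)⁻¹`.
    have hcoef : coeffBraid q (i.1 k) (i.1 b) (i.1 c) (M.Y k) (M.Y b) (M.Y c) = 1 := by
      rw [h0]
      simp only [coeffBraid, coeffId, coeffSq, coeffSwap, if_pos h1, if_neg h2, if_neg h3,
        if_neg h3.symm, if_true]
      field_simp
      ring
    rw [hcoef, eOp_apply]
    split_ifs with h4 <;> simp [h4]
  case braid_from k b c hb hc i h =>
    refine mul_eOp_eq _ (M.psiOp_braid (q := q) hst hb hc) i fun F t => ?_
    obtain ⟨h0, h⟩ := h
    obtain ⟨h1, h2, h3⟩ := h.spec hq0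
    have hne : M.Y k - M.Y c ≠ 0 := sub_ne_zero.2 fun h => by have := M.Y_inj h; omega
    have hcoef : coeffBraid q (i.1 k) (i.1 b) (i.1 c) (M.Y k) (M.Y b) (M.Y c) = -1 := by
      rw [h0]
      simp only [coeffBraid, coeffId, coeffSq, coeffSwap, if_pos h1, if_neg h2, if_neg h3,
        if_neg h3.symm, if_true]
      field_simp
      ring
    rw [hcoef, LinearMap.neg_apply, Pi.neg_apply, eOp_apply]
    split_ifs with h4 <;> simp [h4]
  case braid_both k b c hb hc i h =>
    refine mul_eOp_eq _ (M.psiOp_braid (q := q) hst hb hc) i fun F t => ?_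
    obtain ⟨h0, h⟩ := h
    obtain ⟨h1, h2, h3⟩ := h.spec hq0 hq (hnz _ i.2 _)
    have hne : M.Y k - M.Y c ≠ 0 := sub_ne_zero.2 fun h => by have := M.Y_inj h; omega
    -- The quadratic scalars are now `-(u - v) ^ 2` and `-(v - w) ^ 2`, and their difference is `(u
    -- - w) (2 v - u - w)`.
    have hcoef : coeffBraid q (i.1 k) (i.1 b) (i.1 c) (M.Y k) (M.Y b) (M.Y c) =
        M.Y c - 2 * M.Y b + M.Y k := by
      rw [h0]
      simp only [coeffBraid, coeffId, coeffSq, coeffSwap, if_pos h1, if_pos h2, if_neg h3,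
        if_neg h3.symm, if_true]
      field_simp
      ring
    rw [hcoef, two_mul, two_mul]
    simp only [Module.End.mul_apply, LinearMap.sub_apply, LinearMap.add_apply, Pi.sub_apply,
      Pi.add_apply, yOp_apply, eOp_apply]
    split_ifs with h4
    · rw [h4]; ring
    · ring
  case braid_else k b c hb hc i h =>
    refine mul_eOp_eq _ (M.psiOp_braid (q := q) hst hb hc) i fun F t => ?_
    have hcoef : coeffBraid q (i.1 k) (i.1 b) (i.1 c) (M.Y k) (M.Y b) (M.Y c) = 0 := by
      by_cases h0 : i.1 k = i.1 c
      · obtain ⟨h1, h2⟩ := not_arrow_spec hq0 fun h' => h ⟨h0, h'⟩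
        by_cases h3 : i.1 c = i.1 b
        · simp [coeffBraid, coeffSq, h0, h3]
        · have h3' : i.1 b ≠ i.1 c := fun h => h3 h.symm
          simp [coeffBraid, coeffSq, coeffSwap, h0, h3, h3', h1, h2]
      · rw [coeffBraid, coeffId_of_ne h0, zero_mul]
    simp [hcoef]

lemma opGen_relV (hq0 : q ≠ 0) (hq : q ^ 2 ≠ 1) (hnz : ∀ i ∈ β, ∀ k, i k ≠ 0)
    {x x' : FreeAlgebra K (Gen β)} (h : RelV q β x x') :
    FreeAlgebra.lift K (M.opGen hst q) x = FreeAlgebra.lift K (M.opGen hst q) x' := by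
  cases h with
  | common h => exact M.opGen_relA hst hq0 hq hnz h
  | psi0_e z hz i i' h =>
    simp only [map_mul, FreeAlgebra.lift_ι_apply, opGen]
    apply M.psiOp_eOp hst
    apply Subtype.ext
    rw [h, actB_zero hst hz]
  | psi0_comm z b hz hb =>
    simp only [map_mul, FreeAlgebra.lift_ι_apply, opGen]
    exact M.psiOp_zero_comm hst hz hb
  | psi0_y_first z hz =>
    simp only [map_mul, map_add, map_zero, FreeAlgebra.lift_ι_apply, opGen]
    apply LinearMap.ext
    intro F
    funext t
    simp [psiOp_zero M hst hz, yOp_apply, M.s_zero_same z hz]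
  | psi0_y z j hz hj =>
    simp only [map_mul, FreeAlgebra.lift_ι_apply, opGen]
    apply LinearMap.ext
    intro F
    funext t
    simp [psiOp_zero M hst hz, yOp_apply, M.s_zero_ne z j hz hj]
  | psi0_sq z hz =>
    simp only [map_pow, map_one, FreeAlgebra.lift_ι_apply, opGen]
    apply LinearMap.ext
    intro F
    funext t
    simp [sq, psiOp_zero M hst hz, s_s, actB_actB]
  | psi0_braid z o hz ho =>
    simp only [map_mul, map_sub, map_pow, map_zero, FreeAlgebra.lift_ι_apply, opGen]
    rw [M.psiOp_zero_braid hst hq0 hz ho, sub_self]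

/-- The representation of `V` on `L`-valued functions on `β`. -/
noncomputable def repV (hq0 : q ≠ 0) (hq : q ^ 2 ≠ 1) (hnz : ∀ i ∈ β, ∀ k, i k ≠ 0) :
    AlgV q β →ₐ[K] Module.End K (β → L) :=
  RingQuot.liftAlgHom K
    ⟨FreeAlgebra.lift K (M.opGen hst q), fun _ _ h => M.opGen_relV hst hq0 hq hnz h⟩

lemma repV_gen (hq0 : q ≠ 0) (hq : q ^ 2 ≠ 1) (hnz : ∀ i ∈ β, ∀ k, i k ≠ 0) (g : Gen β) :
    M.repV hst hq0 hq hnz (genV q g) = M.opGen hst q g := by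
  have h : M.repV hst hq0 hq hnz (genV q g) =
      FreeAlgebra.lift K (M.opGen hst q) (FreeAlgebra.ι K g) :=
    RingQuot.liftAlgHom_mkAlgHom_apply K _ _ _
  rw [h, FreeAlgebra.lift_ι_apply]

end VarField

/-! ### Words in the generators of W modulo shorter words -/

section Spanning

variable {K : Type*} [Field K] {n : ℕ} {q : K} {β : Finset (Fin n → K)}

lemma arrow_cases {q : K} (hq0 : q ≠ 0) (i j : K) :
    i = j ∨ NoArrow q i j ∨ ArrowTo q i j ∨ ArrowFrom q i j ∨ ArrowBoth q i j := by
  have hq2 : q ^ 2 ≠ 0 := pow_ne_zero 2 hq0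
  by_cases h : ArrowTo q i j ∨ ArrowFrom q i j ∨ ArrowBoth q i j
  · exact Or.inr (Or.inr h)
  · obtain ⟨h1, h2⟩ := not_arrow_spec hq0 h
    by_cases h3 : i = j
    · exact Or.inl h3
    · exact Or.inr (Or.inl ⟨h3, h1, fun h => h2 (by rw [h, mul_inv_cancel_left₀ hq2])⟩)

variable (q β) in
/-- The subalgebra of `W` generated by the `y_j`. -/
noncomputable def ySubalgebra : Subalgebra K (AlgW q β) :=
  Algebra.adjoin K (Set.range fun j : Fin n => genW q (.y j))

lemma y_mem (j : Fin n) : genW q (.y j) ∈ ySubalgebra q β :=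
  Algebra.subset_adjoin ⟨j, rfl⟩

lemma y_commW (j j' : Fin n) :
    genW q (β := β) (.y j) * genW q (.y j') = genW q (.y j') * genW q (.y j) := by
  have := mkW_rel (q := q) (β := β) (RelW.common (RelA.y_comm j j'))
  rwa [map_mul, map_mul] at this

lemma y_eW (j : Fin n) (i : β) :
    genW q (.y j) * genW q (.e i) = genW q (.e i) * genW q (.y j) := by
  have := mkW_rel (q := q) (β := β) (RelW.common (RelA.y_e j i))
  rwa [map_mul, map_mul] at this

lemma e_idemW (i : β) : genW q (.e i) * genW q (.e i) = genW q (.e i) := by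
  have := mkW_rel (q := q) (β := β) (RelW.common (RelA.e_idem i))
  rwa [map_mul] at this

lemma e_orthW {i j : β} (h : i ≠ j) : genW q (.e i) * genW q (.e j) = 0 := by
  have := mkW_rel (q := q) (β := β) (RelW.common (RelA.e_orth i j h))
  rwa [map_mul, map_zero] at this

lemma e_sumW : ∑ i : β, genW q (.e i) = (1 : AlgW q β) := by
  have := mkW_rel (q := q) (β := β) (RelW.common RelA.e_sum)
  rwa [map_sum, map_one] at this

lemma ySubalgebra_comm_e {p : AlgW q β} (hp : p ∈ ySubalgebra q β) (i : β) :
    p * genW q (.e i) = genW q (.e i) * p := by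
  induction hp using Algebra.adjoin_induction with
  | mem x hx => obtain ⟨j, rfl⟩ := hx; exact y_eW j i
  | algebraMap r => exact Algebra.commutes r _
  | add x y _ _ hx hy => rw [add_mul, mul_add, hx, hy]
  | mul x y _ _ hx hy => rw [mul_assoc, hy, ← mul_assoc, hx, mul_assoc]

/-- The action of the simple reflections of `W(D_n)` on `β`. -/
def actD (hst : IsStableB β) (hn : 2 ≤ n) (a : Fin n) (i : β) : β :=
  if a.val = 0 then actB hst a (actB hst ⟨1, hn⟩ (actB hst a i)) else actB hst a i

lemma actD_zero (hst : IsStableB β) (hn : 2 ≤ n) {z o : Fin n} (hz : z.val = 0) (ho : o.val = 1)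
    (i : β) : actD hst hn z i = actB hst z (actB hst o (actB hst z i)) := by
  have : o = ⟨1, hn⟩ := Fin.ext ho
  rw [actD, if_pos hz, this]

lemma actD_zero_coe (hst : IsStableB β) (hn : 2 ≤ n) {z o : Fin n} (hz : z.val = 0)
    (ho : o.val = 1) (i : β) : (actD hst hn z i).1 =
      Function.update (Function.update i.1 z (i.1 o)⁻¹) o (i.1 z)⁻¹ := by
  have eo : z.val + 1 = o.val := by omega
  have hoz : o ≠ z := fun h => by rw [h] at ho; omega
  rw [actD_zero hst hn hz ho, actB_zero hst hz, actB_pos hst (show o.val ≠ 0 by omega),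
    actB_zero hst hz, ← eq_pre eo]
  funext j
  by_cases hj1 : j = z
  · subst hj1; simp [hoz, hoz.symm]
  by_cases hj2 : j = o
  · subst hj2; simp [hoz]
  simp [hj1, hj2, Equiv.swap_apply_of_ne_of_ne]

lemma actD_pos (hst : IsStableB β) (hn : 2 ≤ n) {b : Fin n} (hb : b.val ≠ 0) (i : β) :
    actD hst hn b i = actB hst b i := if_neg hb

lemma psi_eW (hst : IsStableB β) (hn : 2 ≤ n) (a : Fin n) (i : β) :
    genW q (.psi a) * genW q (.e i) = genW q (.e (actD hst hn a i)) * genW q (.psi a) := by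
  by_cases ha : a.val = 0
  · have := mkW_rel (q := q) (β := β) (RelW.psi0_e a ⟨1, hn⟩ ha rfl i _
      (actD_zero_coe hst hn ha rfl i))
    rwa [map_mul, map_mul] at this
  · have := mkW_rel (q := q) (β := β) (RelW.common (RelA.psi_e (pre a) a (pre_val_add_one ha) i
      (actD hst hn a i) (by rw [actD_pos hst hn ha, actB_pos hst ha])))
    rwa [map_mul, map_mul] at this

/-- Spanning needs only the shape of the relations: moving `Ψ_a` past a variable costs a term
without `Ψ_a`. The exact coefficients are forgotten here and in `psi_sqW`. -/
lemma psi_yW (hn : 2 ≤ n) (a j : Fin n) (i : β) :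
    ∃ p ∈ ySubalgebra q β, ∃ p' ∈ ySubalgebra q β,
      genW q (.psi a) * genW q (.y j) * genW q (.e i) =
        (p * genW q (.psi a) + p') * genW q (.e i) := by
  by_cases ha : a.val = 0
  · by_cases hj : j = a ∨ j = ⟨1, hn⟩
    · by_cases h : (i.1 a)⁻¹ = i.1 ⟨1, hn⟩
      · have := mkW_rel (q := q) (RelW.psi0_y_eq a ⟨1, hn⟩ ha rfl j hj i h)
        simp only [map_mul, map_add, map_neg, map_one] at this
        exact ⟨_, neg_mem (y_mem _), 1, one_mem _, this⟩
      · have := mkW_rel (q := q) (RelW.psi0_y_ne a ⟨1, hn⟩ ha rfl j hj i h)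
        simp only [map_mul, map_neg] at this
        refine ⟨_, neg_mem (y_mem (Equiv.swap a ⟨1, hn⟩ j)), 0, zero_mem _, ?_⟩
        rw [add_zero]
        exact this
    · push Not at hj
      have hj1 : 1 < j.val := by
        have h1 : j.val ≠ a.val := Fin.val_ne_iff.2 hj.1
        have h2 : j.val ≠ 1 := Fin.val_ne_iff.2 hj.2
        omega
      have := mkW_rel (q := q) (RelW.psi0_y_else a ha j hj1 i)
      simp only [map_mul] at this
      refine ⟨_, y_mem j, 0, zero_mem _, ?_⟩
      rw [add_zero]
      exact this
  · have hk := pre_val_add_one ha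
    by_cases h : (j = pre a ∨ j = a) ∧ i.1 (pre a) = i.1 a
    · obtain ⟨rfl | rfl, h⟩ := h
      · have := mkW_rel (q := q) (RelW.common (RelA.psi_y_left _ a hk i h))
        simp only [map_mul, map_sub, map_neg] at this
        refine ⟨_, y_mem a, -1, neg_mem (one_mem _), ?_⟩
        rw [add_mul, neg_one_mul, ← sub_eq_iff_eq_add', ← sub_mul]
        exact this
      · have := mkW_rel (q := q) (RelW.common (RelA.psi_y_right _ j hk i h))
        simp only [map_mul, map_sub] at this
        refine ⟨_, y_mem (pre j), 1, one_mem _, ?_⟩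
        rw [add_mul, one_mul, ← sub_eq_iff_eq_add', ← sub_mul]
        exact this
    · have := mkW_rel (q := q) (RelW.common (RelA.psi_y_else _ a hk j i h))
      simp only [map_mul, map_sub, map_zero] at this
      refine ⟨_, y_mem (Equiv.swap (pre a) a j), 0, zero_mem _, ?_⟩
      rw [add_mul, zero_mul, ← sub_eq_iff_eq_add', ← sub_mul]
      exact this

lemma psi_sqW (hq0 : q ≠ 0) (hn : 2 ≤ n) (a : Fin n) (i : β) :
    ∃ p ∈ ySubalgebra q β, genW q (.psi a) * genW q (.psi a) * genW q (.e i) =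
      p * genW q (.e i) := by
  have hy : ∀ j, mkW q β (fy β j) ∈ ySubalgebra q β := y_mem
  rw [← sq]
  by_cases ha : a.val = 0
  · set o : Fin n := ⟨1, hn⟩ with ho
    rcases arrow_cases hq0 (i.1 a)⁻¹ (i.1 o) with h | h | h | h | h
    · have := mkW_rel (q := q) (RelW.sq0_eq a o ha rfl i h)
      simp only [map_mul, map_pow, map_zero] at this
      exact ⟨0, zero_mem _, by rw [zero_mul]; exact this⟩
    · have := mkW_rel (q := q) (RelW.sq0_none a o ha rfl i h)
      simp only [map_mul, map_pow] at this
      exact ⟨1, one_mem _, by rw [one_mul]; exact this⟩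
    · have := mkW_rel (q := q) (RelW.sq0_to a o ha rfl i h)
      simp only [map_mul, map_pow, map_add] at this
      exact ⟨_, add_mem (hy _) (hy _), this⟩
    · have := mkW_rel (q := q) (RelW.sq0_from a o ha rfl i h)
      simp only [map_mul, map_pow, map_add, map_neg] at this
      exact ⟨_, neg_mem (add_mem (hy _) (hy _)), this⟩
    · have := mkW_rel (q := q) (RelW.sq0_both a o ha rfl i h)
      simp only [map_mul, map_pow, map_add, map_neg] at this
      exact ⟨_, neg_mem (pow_mem (add_mem (hy _) (hy _)) 2), this⟩
  · have hk := pre_val_add_one ha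
    rcases arrow_cases hq0 (i.1 (pre a)) (i.1 a) with h | h | h | h | h
    · have := mkW_rel (q := q) (RelW.common (RelA.sq_eq _ a hk i h))
      simp only [map_mul, map_pow, map_zero] at this
      exact ⟨0, zero_mem _, by rw [zero_mul]; exact this⟩
    · have := mkW_rel (q := q) (RelW.common (RelA.sq_none _ a hk i h))
      simp only [map_mul, map_pow] at this
      exact ⟨1, one_mem _, by rw [one_mul]; exact this⟩
    · have := mkW_rel (q := q) (RelW.common (RelA.sq_to _ a hk i h))
      simp only [map_mul, map_pow, map_sub] at this
      exact ⟨_, sub_mem (hy _) (hy _), this⟩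
    · have := mkW_rel (q := q) (RelW.common (RelA.sq_from _ a hk i h))
      simp only [map_mul, map_pow, map_sub] at this
      exact ⟨_, sub_mem (hy _) (hy _), this⟩
    · have := mkW_rel (q := q) (RelW.common (RelA.sq_both _ a hk i h))
      simp only [map_mul, map_pow, map_sub] at this
      exact ⟨_, mul_mem (sub_mem (hy _) (hy _)) (sub_mem (hy _) (hy _)), this⟩

/-- The relation between two of the generators `Ψ_a` and `Ψ_b`, according to the inner product of the
corresponding simple roots. -/
def PairRel (q : K) (β : Finset (Fin n → K)) (a b : Fin n) : Prop :=
  (simpleRootD a ⬝ᵥ simpleRootD b = 0 ∧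
    genW q (β := β) (.psi a) * genW q (.psi b) = genW q (.psi b) * genW q (.psi a)) ∨
  (simpleRootD a ⬝ᵥ simpleRootD b = -1 ∧ ∀ i : β, ∃ p ∈ ySubalgebra q β,
    (genW q (.psi a) * genW q (.psi b) * genW q (.psi a) -
      genW q (.psi b) * genW q (.psi a) * genW q (.psi b)) * genW q (.e i) = p * genW q (.e i))

lemma PairRel.symm {a b : Fin n} (h : PairRel q β a b) : PairRel q β b a := by
  rcases h with ⟨h1, h2⟩ | ⟨h1, h2⟩
  · exact Or.inl ⟨by rwa [dotProduct_comm], h2.symm⟩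
  · refine Or.inr ⟨by rwa [dotProduct_comm], fun i => ?_⟩
    obtain ⟨p, hp, h⟩ := h2 i
    refine ⟨-p, neg_mem hp, ?_⟩
    rw [neg_mul, ← h, ← neg_mul, neg_sub]

/-- The Dynkin diagram: `0` is joined to `2` only, consecutive positive indices are joined, and all
other pairs commute. -/
lemma pairRel_of_lt (hn : 2 ≤ n) {a b : Fin n} (hab : a.val < b.val) : PairRel q β a b := by
  have hy : ∀ j, mkW q β (fy β j) ∈ ySubalgebra q β := y_mem
  have hb : b.val ≠ 0 := by omega
  by_cases ha : a.val = 0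
  · rcases Nat.lt_trichotomy b.val 2 with h2 | h2 | h2
    · left
      constructor
      · rw [dot_simpleRootD_pos hb]
        simp only [simpleRootD, if_pos ha]
        rw [if_pos (by omega), if_pos (by omega)]
        norm_num
      · have := mkW_rel (q := q) (β := β) (RelW.psi0_comm a b ha (Or.inl (by omega)))
        rwa [map_mul, map_mul] at this
    · right
      constructor
      · rw [dot_simpleRootD_pos hb]
        simp only [simpleRootD, if_pos ha]
        rw [if_neg (by omega), if_pos (by omega)]
        norm_num
      · intro i
        set o : Fin n := ⟨1, hn⟩ with ho
        by_cases h : (i.1 a)⁻¹ = i.1 b ∧ (ArrowTo q (i.1 b) (i.1 o) ∨ ArrowFrom q (i.1 b) (i.1 o) ∨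
            ArrowBoth q (i.1 b) (i.1 o))
        · obtain ⟨h0, h | h | h⟩ := h
          · have := mkW_rel (q := q) (RelW.braid0_to a o b ha rfl h2 i ⟨h0, h⟩)
            simp only [map_mul, map_sub] at this
            exact ⟨1, one_mem _, by rw [one_mul]; exact this⟩
          · have := mkW_rel (q := q) (RelW.braid0_from a o b ha rfl h2 i ⟨h0, h⟩)
            simp only [map_mul, map_sub, map_neg] at this
            exact ⟨-1, neg_mem (one_mem _), by rw [neg_one_mul]; exact this⟩
          · have := mkW_rel (q := q) (RelW.braid0_both a o b ha rfl h2 i ⟨h0, h⟩)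
            simp only [map_mul, map_sub, map_ofNat] at this
            exact ⟨_, sub_mem (sub_mem (hy _) (mul_mem (ofNat_mem _ 2) (hy _))) (hy _), this⟩
        · have := mkW_rel (q := q) (RelW.braid0_else a o b ha rfl h2 i h)
          simp only [map_mul, map_sub, map_zero] at this
          exact ⟨0, zero_mem _, by rw [zero_mul]; exact this⟩
    · left
      constructor
      · rw [dot_simpleRootD_pos hb]
        simp only [simpleRootD, if_pos ha]
        rw [if_neg (by omega), if_neg (by omega)]
        norm_num
      · have := mkW_rel (q := q) (β := β) (RelW.psi0_comm a b ha (Or.inr h2))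
        rwa [map_mul, map_mul] at this
  · have hk := pre_val_add_one ha
    by_cases hc : a.val + 1 = b.val
    · right
      constructor
      · rw [dot_simpleRootD_pos hb, simpleRootD_pos ha]
        simp only [Pi.sub_apply, Pi.single_apply, Fin.ext_iff]
        rw [if_neg (by omega), if_neg (by omega), if_pos (by omega), if_neg (by omega)]
        norm_num
      · intro i
        by_cases h : i.1 (pre a) = i.1 b ∧ (ArrowTo q (i.1 b) (i.1 a) ∨
            ArrowFrom q (i.1 b) (i.1 a) ∨ ArrowBoth q (i.1 b) (i.1 a))
        · obtain ⟨h0, h | h | h⟩ := h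
          · have := mkW_rel (q := q) (RelW.common (RelA.braid_to _ a b hk hc i ⟨h0, h⟩))
            simp only [map_mul, map_sub] at this
            exact ⟨1, one_mem _, by rw [one_mul]; exact this⟩
          · have := mkW_rel (q := q) (RelW.common (RelA.braid_from _ a b hk hc i ⟨h0, h⟩))
            simp only [map_mul, map_sub, map_neg] at this
            exact ⟨-1, neg_mem (one_mem _), by rw [neg_one_mul]; exact this⟩
          · have := mkW_rel (q := q) (RelW.common (RelA.braid_both _ a b hk hc i ⟨h0, h⟩))
            simp only [map_mul, map_sub, map_add, map_ofNat] at this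
            exact ⟨_, add_mem (sub_mem (hy _) (mul_mem (ofNat_mem _ 2) (hy _))) (hy _), this⟩
        · have := mkW_rel (q := q) (RelW.common (RelA.braid_else _ a b hk hc i h))
          simp only [map_mul, map_sub, map_zero] at this
          exact ⟨0, zero_mem _, by rw [zero_mul]; exact this⟩
    · left
      constructor
      · rw [dot_simpleRootD_pos hb, simpleRootD_pos ha]
        simp only [Pi.sub_apply, Pi.single_apply, Fin.ext_iff]
        rw [if_neg (by omega), if_neg (by omega), if_neg (by omega), if_neg (by omega)]
        norm_num
      · have := mkW_rel (q := q) (β := β) (RelW.common (RelA.psi_comm a b ha hb (Or.inl (by omega))))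
        rwa [map_mul, map_mul] at this

lemma pairRel (hn : 2 ≤ n) {a b : Fin n} (hab : a ≠ b) : PairRel q β a b := by
  rcases lt_or_gt_of_ne (Fin.val_ne_iff.2 hab) with h | h
  · exact pairRel_of_lt hn h
  · exact (pairRel_of_lt hn h).symm

/-- The product `Ψ_{a_1} ⋯ Ψ_{a_k}`. -/
noncomputable def psiWord (q : K) (β : Finset (Fin n → K)) (as : List (Fin n)) : AlgW q β :=
  (as.map fun a => genW q (Gen.psi a)).prod

@[simp] lemma psiWord_nil : psiWord q β [] = 1 := rfl

@[simp] lemma psiWord_cons (a : Fin n) (as : List (Fin n)) :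
    psiWord q β (a :: as) = genW q (.psi a) * psiWord q β as := by simp [psiWord]

lemma psiWord_e (hst : IsStableB β) (hn : 2 ≤ n) (as : List (Fin n)) (i : β) :
    ∃ j, psiWord q β as * genW q (.e i) = genW q (.e j) * psiWord q β as := by
  induction as with
  | nil => exact ⟨i, by simp⟩
  | cons a as ih =>
    obtain ⟨j, hj⟩ := ih
    exact ⟨actD hst hn a j, by
      rw [psiWord_cons, mul_assoc, hj, ← mul_assoc, psi_eW hst hn, mul_assoc]⟩

variable (q β) in
/-- The span of the elements `p Ψ_{a_1} ⋯ Ψ_{a_r} e(i)` with `p` a polynomial in the `y_j` and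
`r < k`. -/
noncomputable def wordSpan (k : ℕ) : Submodule K (AlgW q β) :=
  Submodule.span K {x | ∃ p ∈ ySubalgebra q β, ∃ as : List (Fin n), as.length < k ∧ ∃ i : β,
    x = p * psiWord q β as * genW q (.e i)}

lemma mem_wordSpan {p : AlgW q β} (hp : p ∈ ySubalgebra q β) {as : List (Fin n)} {k : ℕ}
    (h : as.length < k) (i : β) : p * psiWord q β as * genW q (.e i) ∈ wordSpan q β k :=
  Submodule.subset_span ⟨p, hp, as, h, i, rfl⟩

lemma wordSpan_mono {k k' : ℕ} (h : k ≤ k') : wordSpan q β k ≤ wordSpan q β k' := by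
  apply Submodule.span_mono
  rintro x ⟨p, hp, as, ha, i, rfl⟩
  exact ⟨p, hp, as, ha.trans_le h, i, rfl⟩

/-- For a product `x * y`, the idempotent is carried past `y` to bring the formula for `x` into
play; this is possible because the variables commute with the idempotents. -/
lemma psi_mul_ySubalgebra (hn : 2 ≤ n) (a : Fin n) {p : AlgW q β} (hp : p ∈ ySubalgebra q β)
    (i : β) : ∃ p' ∈ ySubalgebra q β, ∃ p'' ∈ ySubalgebra q β,
      genW q (.psi a) * p * genW q (.e i) = (p' * genW q (.psi a) + p'') * genW q (.e i) := by
  induction hp using Algebra.adjoin_induction with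
  | mem x hx => obtain ⟨j, rfl⟩ := hx; exact psi_yW hn a j i
  | algebraMap r =>
    exact ⟨algebraMap K _ r, Subalgebra.algebraMap_mem _ _, 0, zero_mem _, by
      rw [add_zero, Algebra.commutes r]⟩
  | add x y _ _ hx hy =>
    obtain ⟨p1, h1, p2, h2, hx⟩ := hx
    obtain ⟨p3, h3, p4, h4, hy⟩ := hy
    refine ⟨p1 + p3, add_mem h1 h3, p2 + p4, add_mem h2 h4, ?_⟩
    rw [mul_add, add_mul, hx, hy]
    noncomm_ring
  | mul x y hx' hy' hx hy =>
    obtain ⟨p1, h1, p2, h2, hx⟩ := hx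
    obtain ⟨p3, h3, p4, h4, hy⟩ := hy
    refine ⟨p1 * p3, mul_mem h1 h3, p1 * p4 + p2 * y, add_mem (mul_mem h1 h4) (mul_mem h2 hy'), ?_⟩
    calc genW q (.psi a) * (x * y) * genW q (.e i)
        = genW q (.psi a) * x * (y * genW q (.e i)) := by noncomm_ring
      _ = (genW q (.psi a) * x * genW q (.e i)) * y := by
          rw [ySubalgebra_comm_e hy', ← mul_assoc]
      _ = p1 * (genW q (.psi a) * (genW q (.e i) * y)) + p2 * (genW q (.e i) * y) := by
          rw [hx]; noncomm_ring
      _ = p1 * (genW q (.psi a) * y * genW q (.e i)) + p2 * y * genW q (.e i) := by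
          rw [← ySubalgebra_comm_e hy']; noncomm_ring
      _ = _ := by rw [hy]; noncomm_ring

lemma ySubalgebra_mul_wordSpan {k : ℕ} {p x : AlgW q β} (hp : p ∈ ySubalgebra q β)
    (hx : x ∈ wordSpan q β k) : p * x ∈ wordSpan q β k := by
  induction hx using Submodule.span_induction with
  | mem x hx =>
    obtain ⟨p', hp', as, ha, i, rfl⟩ := hx
    rw [← mul_assoc, ← mul_assoc]
    exact mem_wordSpan (mul_mem hp hp') ha i
  | zero => rw [mul_zero]; exact zero_mem _
  | add x y _ _ hx hy => rw [mul_add]; exact add_mem hx hy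
  | smul c x _ hx => rw [mul_smul_comm]; exact Submodule.smul_mem _ c hx

lemma psi_mul_wordSpan (hst : IsStableB β) (hn : 2 ≤ n) {k : ℕ} (a : Fin n) {x : AlgW q β}
    (hx : x ∈ wordSpan q β k) : genW q (.psi a) * x ∈ wordSpan q β (k + 1) := by
  induction hx using Submodule.span_induction with
  | mem x hx =>
    obtain ⟨p, hp, as, ha, i, rfl⟩ := hx
    obtain ⟨j, hj⟩ := psiWord_e (q := q) hst hn as i
    obtain ⟨p1, h1, p2, h2, h⟩ := psi_mul_ySubalgebra hn a hp j
    have : genW q (.psi a) * (p * psiWord q β as * genW q (.e i)) =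
        p1 * psiWord q β (a :: as) * genW q (.e i) + p2 * psiWord q β as * genW q (.e i) := by
      rw [mul_assoc p, hj, ← mul_assoc, ← mul_assoc, h, mul_assoc, ← hj, psiWord_cons]
      noncomm_ring
    rw [this]
    exact add_mem (mem_wordSpan h1 (by simpa using ha) i) (mem_wordSpan h2 (by omega) i)
  | zero => rw [mul_zero]; exact zero_mem _
  | add x y _ _ hx hy => rw [mul_add]; exact add_mem hx hy
  | smul c x _ hx => rw [mul_smul_comm]; exact Submodule.smul_mem _ c hx

lemma psiWord_cons_sub (hst : IsStableB β) (hn : 2 ≤ n) (a : Fin n) {as bs : List (Fin n)} {k : ℕ}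
    {i : β} (h : (psiWord q β as - psiWord q β bs) * genW q (.e i) ∈ wordSpan q β k) :
    (psiWord q β (a :: as) - psiWord q β (a :: bs)) * genW q (.e i) ∈ wordSpan q β (k + 1) := by
  have := psi_mul_wordSpan hst hn a h
  rwa [← mul_assoc, mul_sub, ← psiWord_cons, ← psiWord_cons] at this

/-- Relations hold only in front of an idempotent. To use one at the head of a word, `e(i)` is
pulled through the word, changing its index, and afterwards pushed back. -/
lemma mem_wordSpan_of_head (hst : IsStableB β) (hn : 2 ≤ n) {x : AlgW q β}
    (hx : ∀ i : β, ∃ p ∈ ySubalgebra q β, x * genW q (.e i) = p * genW q (.e i))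
    {as : List (Fin n)} {k : ℕ} (h : as.length < k) (i : β) :
    x * psiWord q β as * genW q (.e i) ∈ wordSpan q β k := by
  obtain ⟨j, hj⟩ := psiWord_e (q := q) hst hn as i
  obtain ⟨p, hp, h1⟩ := hx j
  have : x * psiWord q β as * genW q (.e i) = p * psiWord q β as * genW q (.e i) := by
    rw [mul_assoc, hj, ← mul_assoc, h1, mul_assoc, ← hj, mul_assoc]
  rw [this]
  exact mem_wordSpan hp h i

/-- Two reduced words of the same element of the Weyl group give the same product of the `Ψ_a` up to
products of fewer factors. -/
lemma psiWord_sub_mem (hst : IsStableB β) (hn : 2 ≤ n) (k : ℕ) :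
    ∀ as bs : List (Fin n), as.length = k → bs.length = k → wordW hn as = wordW hn bs →
      lenD (wordW hn as) = k → ∀ i : β,
        (psiWord q β as - psiWord q β bs) * genW q (.e i) ∈ wordSpan q β k := by
  induction k using Nat.strong_induction_on with
  | _ k ih =>
  intro as bs hla hlb hab hlen i
  rcases as with _ | ⟨s, as⟩
  · rw [List.length_nil] at hla
    rw [List.length_eq_zero_iff.1 (hlb.trans hla.symm), sub_self, zero_mul]
    exact zero_mem _
  rcases bs with _ | ⟨t, bs⟩
  · simp only [List.length_nil, List.length_cons] at hla hlb
    omega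
  simp only [List.length_cons] at hla hlb
  obtain ⟨w, hw⟩ : ∃ w, w = wordW hn (s :: as) := ⟨_, rfl⟩
  rw [← hw] at hab hlen
  have hsw : simpleD hn s * w = wordW hn as := by rw [hw, wordW_cons, simpleD_mul_cancel]
  have htw : simpleD hn t * w = wordW hn bs := by rw [hab, wordW_cons, simpleD_mul_cancel]
  -- A tail of length `k - 1` has at most `k - 1` inversions while `w` has `k`, so the first letter
  -- is a descent and the tail is reduced.
  have hdesc : ∀ a : Fin n, ∀ cs : List (Fin n), cs.length + 1 = k →
      simpleD hn a * w = wordW hn cs → IsDescent w a ∧ lenD (wordW hn cs) + 1 = k := by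
    intro a cs hcs hcw
    have h1 := lenD_wordW_le hn cs
    have hd : IsDescent w a := by
      by_contra hcon
      have h2 := lenD_simple_mul_of_not_descent hn hcon
      rw [hcw] at h2
      omega
    have h2 := lenD_simple_mul_of_descent hn hd
    rw [hcw] at h2
    exact ⟨hd, by omega⟩
  obtain ⟨hs, hls⟩ := hdesc s as hla hsw
  obtain ⟨ht, hlt⟩ := hdesc t bs hlb htw
  -- Words with the same first letter: the induction hypothesis applies to their tails.
  have hcomp : ∀ (a : Fin n) (cs ds : List (Fin n)), cs.length + 1 = k → ds.length + 1 = k →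
      wordW hn cs = wordW hn ds → lenD (wordW hn cs) + 1 = k →
      (psiWord q β (a :: cs) - psiWord q β (a :: ds)) * genW q (.e i) ∈ wordSpan q β k := by
    intro a cs ds h1 h2 h3 h4
    have := psiWord_cons_sub hst hn a (ih (k - 1) (by omega) cs ds (by omega) (by omega) h3
      (by omega) i)
    rwa [Nat.sub_add_cancel (by omega)] at this
  by_cases hst' : s = t
  · subst hst'
    exact hcomp s as bs hla hlb (hsw.symm.trans htw) hls
  have hs' := hs
  have ht' := ht
  unfold IsDescent at hs' ht'
  rcases pairRel (q := q) (β := β) hn hst' with ⟨hdot, hrel⟩ | ⟨hdot, hrel⟩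
  · have h1 : IsDescent (simpleD hn s * w) t := by
      rw [isDescent_simple_mul, hdot, zero_mul, sub_zero]; exact ht
    have h2 := lenD_simple_mul_of_descent hn h1
    rw [hsw] at h2
    -- Both letters can be removed from `w`, so `s :: t :: cs` and `t :: s :: cs` are reduced words
    -- of `w`. They share a first letter with the given words, and their products are equal.
    obtain ⟨cs, hcs, hlc⟩ := exists_word hn (simpleD hn t * (simpleD hn s * w))
    rw [hsw] at hlc
    have e1 := hcomp s as (t :: cs) hla (by simp only [List.length_cons]; omega)
      (by rw [wordW_cons, hcs, simpleD_mul_cancel, hsw]) hls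
    have e2 := hcomp t bs (s :: cs) hlb (by simp only [List.length_cons]; omega)
      (by rw [wordW_cons, hcs, ← mul_assoc (simpleD hn t), simpleD_comm hn
        (by rwa [dotProduct_comm]), mul_assoc, simpleD_mul_cancel, htw]) hlt
    have e3 : psiWord q β (s :: t :: cs) = psiWord q β (t :: s :: cs) := by
      simp only [psiWord_cons, ← mul_assoc, hrel]
    rw [e3] at e1
    have := sub_mem e1 e2
    rwa [← sub_mul, sub_sub_sub_cancel_right] at this
  · have hdot' : simpleRootD t ⬝ᵥ simpleRootD s = -1 := by rwa [dotProduct_comm]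
    have h1 : IsDescent (simpleD hn s * w) t := by
      rw [isDescent_simple_mul, hdot]; omega
    have h2 := lenD_simple_mul_of_descent hn h1
    have h3 : IsDescent (simpleD hn t * (simpleD hn s * w)) s := by
      rw [isDescent_simple_mul, hdot']
      have e1 : (simpleD hn s * w).1 (rhoVec n) ⬝ᵥ simpleRootD s =
          -(w.1 (rhoVec n) ⬝ᵥ simpleRootD s) := by
        change rootReflection _ (w.1 (rhoVec n)) ⬝ᵥ _ = _
        rw [rootReflection_dot_left, rootReflection_self (simpleRootD_mem hn s), dotProduct_neg]
      have e2 : (simpleD hn s * w).1 (rhoVec n) ⬝ᵥ simpleRootD t =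
          w.1 (rhoVec n) ⬝ᵥ simpleRootD t + w.1 (rhoVec n) ⬝ᵥ simpleRootD s := by
        change rootReflection _ (w.1 (rhoVec n)) ⬝ᵥ _ = _
        rw [rootReflection_dot_left, rootReflection_apply, dotProduct_sub, dotProduct_smul, hdot,
          smul_eq_mul]
        ring
      rw [e1, e2]
      omega
    have h4 := lenD_simple_mul_of_descent hn h3
    rw [hsw] at h2 h4
    -- The letters `s`, `t`, `s` are successive descents, so `cs` has length `k - 3`, and `w` has
    -- the reduced words `s t s cs` and `t s t cs`.
    obtain ⟨cs, hcs, hlc⟩ := exists_word hn (simpleD hn s * (simpleD hn t * (simpleD hn s * w)))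
    rw [hsw] at hlc
    have e1 := hcomp s as (t :: s :: cs) hla (by simp only [List.length_cons]; omega)
      (by rw [wordW_cons, wordW_cons, hcs, simpleD_mul_cancel, simpleD_mul_cancel, hsw]) hls
    have hbr : simpleD hn s * (simpleD hn t * (simpleD hn s * w)) =
        simpleD hn t * (simpleD hn s * (simpleD hn t * w)) := by
      have := congrArg (· * w) (simpleD_braid hn hdot)
      simpa only [mul_assoc] using this
    have e2 := hcomp t bs (s :: t :: cs) hlb (by simp only [List.length_cons]; omega)
      (by rw [wordW_cons, wordW_cons, hcs, hbr, simpleD_mul_cancel, simpleD_mul_cancel, htw]) hlt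
    -- The defect of the braid relation is a polynomial in the variables; in front of `cs` it leaves
    -- a word of length less than `k`.
    have e3 := mem_wordSpan_of_head hst hn hrel (as := cs) (k := k) (by omega) i
    have := sub_mem (add_mem e1 e3) e2
    convert! this using 1
    simp only [psiWord_cons]
    noncomm_ring

/-- If the tail is reduced, the first letter `s` is a descent of its product. Modulo shorter words
the tail may then be replaced by a reduced word that starts with `s`, and `Ψ_s ^ 2` is a polynomial
in the variables. -/
lemma psiWord_mem_of_not_reduced (hq0 : q ≠ 0) (hst : IsStableB β) (hn : 2 ≤ n)
    (as : List (Fin n)) (h : lenD (wordW hn as) < as.length) (i : β) :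
    psiWord q β as * genW q (.e i) ∈ wordSpan q β as.length := by
  induction as with
  | nil => simp at h
  | cons s as ih =>
    by_cases h1 : lenD (wordW hn as) < as.length
    · rw [psiWord_cons, mul_assoc]
      exact psi_mul_wordSpan hst hn s (ih h1)
    · have h2 := lenD_wordW_le hn as
      have h3 : IsDescent (wordW hn as) s := by
        by_contra hcon
        have := lenD_simple_mul_of_not_descent hn hcon
        rw [wordW_cons, List.length_cons] at h
        omega
      have h4 := lenD_simple_mul_of_descent hn h3
      obtain ⟨cs, hcs, hlc⟩ := exists_word hn (simpleD hn s * wordW hn as)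
      have e1 := psiWord_sub_mem (q := q) hst hn as.length as (s :: cs) rfl
        (by rw [List.length_cons]; omega) (by rw [wordW_cons, hcs, simpleD_mul_cancel]) (by omega) i
      have e2 := psiWord_cons_sub hst hn s e1
      have e3 := mem_wordSpan_of_head hst hn (psi_sqW (q := q) (β := β) hq0 hn s) (as := cs)
        (k := as.length + 1) (by omega) i
      have := add_mem e2 e3
      rw [List.length_cons]
      convert! this using 1
      simp only [psiWord_cons]
      noncomm_ring

end Spanning

/-! ### The monomials span W -/

section Basis

variable {K : Type*} [Field K] {n : ℕ} {q : K} {β : Finset (Fin n → K)}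

/-- The monomial `y_1^{m_1} ⋯ y_n^{m_n}`. -/
noncomputable def yMonomial (q : K) (β : Finset (Fin n → K)) (m : Fin n → ℕ) : AlgW q β :=
  (List.ofFn fun j => genW q (Gen.y j) ^ m j).prod

lemma monomialW_eq (m : Fin n → ℕ) (as : List (Fin n)) (i : β) :
    monomialW q m as i = yMonomial q β m * psiWord q β as * genW q (.e i) := rfl

/-- Polynomials are evaluated in a commutative ring, so `yEval` passes through this subalgebra. -/
noncomputable instance : CommRing (ySubalgebra q β) :=
  { (inferInstance : Ring (ySubalgebra q β)) with
    mul_comm := fun x y => Subtype.ext <|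
      Algebra.adjoin_induction₂ (p := fun x y _ _ => x * y = y * x)
        (by rintro _ _ ⟨j, rfl⟩ ⟨j', rfl⟩; exact y_commW j j')
        (fun _ _ => by rw [← map_mul, ← map_mul, mul_comm])
        (fun r x _ => Algebra.commutes r x)
        (fun r x _ => (Algebra.commutes r x).symm)
        (fun x y z _ _ _ h1 h2 => by rw [add_mul, mul_add, h1, h2])
        (fun x y z _ _ _ h1 h2 => by rw [add_mul, mul_add, h1, h2])
        (fun x y z _ _ _ h1 h2 => by rw [mul_assoc, h2, ← mul_assoc, h1, mul_assoc])
        (fun x y z _ _ _ h1 h2 => by rw [← mul_assoc, h1, mul_assoc, h2, mul_assoc]) x.2 y.2 }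

/-- The evaluation homomorphism from polynomials to `W`. -/
noncomputable def yEval (q : K) (β : Finset (Fin n → K)) :
    MvPolynomial (Fin n) K →ₐ[K] AlgW q β :=
  (ySubalgebra q β).val.comp
    (MvPolynomial.aeval fun j => (⟨genW q (.y j), y_mem j⟩ : ySubalgebra q β))

lemma yEval_X (j : Fin n) : yEval q β (MvPolynomial.X j) = genW q (.y j) := by
  simp [yEval]

lemma yEval_monomial (m : Fin n →₀ ℕ) (r : K) :
    yEval q β (MvPolynomial.monomial m r) = r • yMonomial q β m := by
  have h : MvPolynomial.monomial m r =
      r • (List.ofFn fun j => (MvPolynomial.X j : MvPolynomial (Fin n) K) ^ m j).prod := by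
    rw [MvPolynomial.monomial_eq, MvPolynomial.smul_eq_C_mul, List.prod_ofFn, Finsupp.prod_fintype]
    simp
  rw [h, map_smul, map_list_prod, List.map_ofFn, yMonomial]
  congr 3
  funext j
  simp [yEval_X]

lemma yMonomial_eq (m : Fin n → ℕ) : yMonomial q β m =
    yEval q β (MvPolynomial.monomial (Finsupp.equivFunOnFinite.symm m) 1) := by
  rw [yEval_monomial, one_smul]
  rfl

lemma ySubalgebra_le : ∀ p ∈ ySubalgebra q β, ∃ P, yEval q β P = p := by
  have : ySubalgebra q β ≤ (yEval q β).range := by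
    apply Algebra.adjoin_le
    rintro _ ⟨j, rfl⟩
    exact ⟨_, yEval_X j⟩
  exact this

variable (q β) in
/-- The span of the elements `y^m Ψ_w e(i)`. -/
noncomputable def basisSpan (word : weylD n → List (Fin n)) : Submodule K (AlgW q β) :=
  Submodule.span K (Set.range fun x : weylD n × (Fin n → ℕ) × β =>
    monomialW q x.2.1 (word x.1) x.2.2)

lemma mem_basisSpan {word : weylD n → List (Fin n)} {p : AlgW q β} (hp : p ∈ ySubalgebra q β)
    (w : weylD n) (i : β) : p * psiWord q β (word w) * genW q (.e i) ∈ basisSpan q β word := by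
  obtain ⟨P, rfl⟩ := ySubalgebra_le p hp
  clear hp
  induction P using MvPolynomial.induction_on' with
  | monomial m r =>
    rw [yEval_monomial, smul_mul_assoc, smul_mul_assoc, ← monomialW_eq]
    exact Submodule.smul_mem _ _ (Submodule.subset_span ⟨(w, m, i), rfl⟩)
  | add P Q hP hQ =>
    rw [map_add, add_mul, add_mul]
    exact add_mem hP hQ

lemma ySubalgebra_mul_basisSpan {word : weylD n → List (Fin n)} {p x : AlgW q β}
    (hp : p ∈ ySubalgebra q β) (hx : x ∈ basisSpan q β word) : p * x ∈ basisSpan q β word := by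
  induction hx using Submodule.span_induction with
  | mem x hx =>
    obtain ⟨⟨w, m, i⟩, rfl⟩ := hx
    simp only [monomialW_eq]
    rw [← mul_assoc, ← mul_assoc]
    refine mem_basisSpan (mul_mem hp ?_) w i
    exact list_prod_mem fun x hx => by
      obtain ⟨j, rfl⟩ := List.mem_ofFn.1 hx
      exact pow_mem (y_mem j) _
  | zero => rw [mul_zero]; exact zero_mem _
  | add x y _ _ hx hy => rw [mul_add]; exact add_mem hx hy
  | smul c x _ hx => rw [mul_smul_comm]; exact Submodule.smul_mem _ c hx

/-- By induction on the length bound: a word that is not reduced is already a combination of shorter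
words, and a reduced one equals the chosen word of its element modulo shorter words. -/
lemma wordSpan_le_basisSpan (hq0 : q ≠ 0) (hst : IsStableB β) (hn : 2 ≤ n)
    {word : weylD n → List (Fin n)} (hword : ∀ w, IsReducedD w (word w)) (k : ℕ) :
    wordSpan q β k ≤ basisSpan q β word := by
  induction k with
  | zero =>
    apply Submodule.span_le.2
    rintro x ⟨p, hp, as, ha, i, rfl⟩
    exact absurd ha (Nat.not_lt_zero _)
  | succ k ih =>
    apply Submodule.span_le.2
    rintro x ⟨p, hp, as, ha, i, rfl⟩
    rw [mul_assoc]
    refine ySubalgebra_mul_basisSpan hp ?_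
    have hle := lenD_wordW_le hn as
    by_cases h : lenD (wordW hn as) < as.length
    · exact ih (wordSpan_mono (by omega) (psiWord_mem_of_not_reduced hq0 hst hn as h i))
    · have hr := hword (wordW hn as)
      have h1 := psiWord_sub_mem (q := q) hst hn as.length as (word (wordW hn as)) rfl
        (by rw [hr.length_eq hn]; omega) (hr.wordW_eq hn).symm (by omega) i
      have h2 := mem_basisSpan (word := word) (one_mem (ySubalgebra q β)) (wordW hn as) i
      have h3 := add_mem (ih (wordSpan_mono (by omega) h1)) h2
      rwa [one_mul, sub_mul, sub_add_cancel] at h3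

/-- The union of the `wordSpan q β k` is a left ideal; as it contains `1 = ∑ e(i)`, it is all of W.
-/
lemma mem_wordSpan_mul (hst : IsStableB β) (hn : 2 ≤ n) (x : AlgW q β) :
    ∀ k, ∀ y ∈ wordSpan q β k, ∃ k', x * y ∈ wordSpan q β k' := by
  induction x using genW_induction with
  | hK r =>
    intro k y hy
    exact ⟨k, by rw [← Algebra.smul_def]; exact Submodule.smul_mem _ _ hy⟩
  | hmul x x' hx hx' =>
    intro k y hy
    obtain ⟨k1, h1⟩ := hx' k y hy
    obtain ⟨k2, h2⟩ := hx k1 _ h1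
    exact ⟨k2, by rwa [mul_assoc]⟩
  | hadd x x' hx hx' =>
    intro k y hy
    obtain ⟨k1, h1⟩ := hx k y hy
    obtain ⟨k2, h2⟩ := hx' k y hy
    exact ⟨max k1 k2, by
      rw [add_mul]
      exact add_mem (wordSpan_mono (le_max_left _ _) h1) (wordSpan_mono (le_max_right _ _) h2)⟩
  | hgen g =>
    intro k y hy
    cases g with
    | psi a => exact ⟨k + 1, psi_mul_wordSpan hst hn a hy⟩
    | y j => exact ⟨k, ySubalgebra_mul_wordSpan (y_mem j) hy⟩
    | e j =>
      refine ⟨k, ?_⟩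
      induction hy using Submodule.span_induction with
      | mem x hx =>
        obtain ⟨p, hp, as, ha, i, rfl⟩ := hx
        obtain ⟨j', hj⟩ := psiWord_e (q := q) hst hn as i
        have h1 : genW q (.e j) * (p * psiWord q β as * genW q (.e i)) =
            p * (genW q (.e j) * genW q (.e j')) * psiWord q β as := by
          rw [mul_assoc p, hj, ← mul_assoc, ← ySubalgebra_comm_e hp]
          noncomm_ring
        by_cases h : j = j'
        · rw [h1, h, e_idemW, mul_assoc, ← hj, ← mul_assoc]
          exact mem_wordSpan hp ha i
        · rw [h1, e_orthW h, mul_zero, zero_mul]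
          exact zero_mem _
      | zero => rw [mul_zero]; exact zero_mem _
      | add x y _ _ hx hy => rw [mul_add]; exact add_mem hx hy
      | smul c x _ hx => rw [mul_smul_comm]; exact Submodule.smul_mem _ c hx

theorem basisSpan_eq_top (hq0 : q ≠ 0) (hst : IsStableB β) (hn : 2 ≤ n)
    {word : weylD n → List (Fin n)} (hword : ∀ w, IsReducedD w (word w)) :
    basisSpan q β word = ⊤ := by
  rw [eq_top_iff]
  intro x _
  have h1 : (1 : AlgW q β) ∈ wordSpan q β 1 := by
    rw [← e_sumW]
    refine Submodule.sum_mem _ fun i _ => ?_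
    have := mem_wordSpan (one_mem (ySubalgebra q β)) (as := []) (k := 1) (by simp) i
    simpa using this
  obtain ⟨k, hk⟩ := mem_wordSpan_mul hst hn x 1 1 h1
  rw [mul_one] at hk
  exact wordSpan_le_basisSpan hq0 hst hn hword k hk

end Basis

/-! ### Two criteria for linear independence -/

lemma linearIndependent_of_triangular {L V ι : Type*} [Field L] [AddCommGroup V] [Module L V]
    {v w : ι → V} (hv : LinearIndependent L v) (len : ι → ℕ) (c : ι → L) (hc : ∀ x, c x ≠ 0)
    (h : ∀ x, w x - c x • v x ∈ Submodule.span L (v '' {y | len y < len x})) :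
    LinearIndependent L w := by
  classical
  rw [linearIndependent_iff']
  intro s g hg
  by_contra! hcon
  obtain ⟨x0, hx0, hgx0⟩ := hcon
  -- Take `x` of maximal length among the indices with nonzero coefficient. No lower term then
  -- involves `v x`, so the relation would express `v x` by the other `v z`.
  obtain ⟨x, hx, hmax⟩ := Finset.exists_max_image (s.filter fun y => g y ≠ 0) len
    ⟨x0, Finset.mem_filter.2 ⟨hx0, hgx0⟩⟩
  obtain ⟨hxs, hgx⟩ := Finset.mem_filter.1 hx
  have hlow : ∀ y, g y ≠ 0 → y ∈ s →
      w y - c y • v y ∈ Submodule.span L (v '' {z | z ≠ x}) := by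
    intro y hy hys
    refine Submodule.span_mono (Set.image_mono ?_) (h y)
    rintro z (hz : len z < len y) rfl
    have := hmax y (Finset.mem_filter.2 ⟨hys, hy⟩)
    omega
  have hmem : (g x * c x) • v x ∈ Submodule.span L (v '' {z | z ≠ x}) := by
    rw [← Finset.add_sum_erase s _ hxs] at hg
    have h1 : (g x * c x) • v x =
        -(g x • (w x - c x • v x)) - ∑ y ∈ s.erase x, g y • w y := by
      rw [eq_sub_iff_add_eq, ← sub_eq_zero, ← hg, smul_sub, smul_smul]
      abel
    rw [h1]
    refine sub_mem (neg_mem (Submodule.smul_mem _ _ (hlow x hgx hxs))) ?_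
    refine Submodule.sum_mem _ fun y hy => ?_
    by_cases hgy : g y = 0
    · rw [hgy, zero_smul]; exact zero_mem _
    refine Submodule.smul_mem _ _ ?_
    rw [← sub_add_cancel (w y) (c y • v y)]
    refine add_mem (hlow y hgy (Finset.mem_of_mem_erase hy)) (Submodule.smul_mem _ _ ?_)
    exact Submodule.subset_span ⟨y, Finset.ne_of_mem_erase hy, rfl⟩
  have hmem' : v x ∈ Submodule.span L (v '' {z | z ≠ x}) := by
    rwa [Submodule.smul_mem_iff _ (mul_ne_zero hgx (hc x))] at hmem
  exact hv.notMem_span_image (fun h : x ∈ {z | z ≠ x} => h rfl) hmem'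

/-- Products of `K`-independent scalars in `L` with `L`-independent vectors are `K`-independent, and
different indices `i` occupy different coordinates. -/
lemma linearIndependent_single_smul {K L ι κ μ V : Type*} [Field K] [Field L] [Algebra K L]
    [AddCommGroup V] [Module K V] [Module L V] [IsScalarTower K L V] [DecidableEq ι] {a : κ → L}
    {c : ι → μ → V} (ha : LinearIndependent K a) (hc : ∀ i, LinearIndependent L (c i)) :
    LinearIndependent K fun x : μ × κ × ι =>
      (Pi.single x.2.2 (a x.2.1 • c x.2.2 x.1) : ι → V) := by
  have h := Pi.linearIndependent_single (R := K) (Ms := fun _ : ι => V)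
    (fun (i : ι) (x : κ × μ) => a x.1 • c i x.2) fun i => linearIndependent_smul ha (hc i)
  refine h.comp (fun x : μ × κ × ι => (⟨x.2.2, (x.2.1, x.1)⟩ : Σ _ : ι, κ × μ)) ?_
  rintro ⟨w, m, i⟩ ⟨w', m', i'⟩ h
  simp only [Sigma.mk.injEq, heq_eq_eq, Prod.mk.injEq] at h
  obtain ⟨rfl, rfl, rfl⟩ := h
  rfl

/-- A field in `n` variables with an action of the Weyl group of type D that is compatible with the
simple reflections. -/
structure WeylField (K L : Type*) [Field K] [Field L] [Algebra K L] (n : ℕ) (hn : 2 ≤ n) extends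
    VarField K L n where
  /-- The action of the Weyl group. -/
  act : weylD n → L →ₐ[K] L
  act_one : ∀ x, act 1 x = x
  act_mul : ∀ v w x, act (v * w) x = act v (act w x)
  act_pos : ∀ b : Fin n, b.val ≠ 0 → ∀ x, act (simpleD hn b) x = s b x
  act_zero : ∀ z : Fin n, z.val = 0 → ∀ x, act (simpleD hn z) x = s z (s ⟨1, hn⟩ (s z x))
  act_inj : Function.Injective act
  aeval_inj : Function.Injective (MvPolynomial.aeval Y : MvPolynomial (Fin n) K →ₐ[K] L)

section Delta

variable {K L : Type*} [AddCommMonoid L] {n : ℕ} {β : Finset (Fin n → K)}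

open Classical in
/-- The function with value `f` at `i` and `0` elsewhere. -/
noncomputable def delta (i : β) (f : L) : β → L := fun t => if t = i then f else 0

lemma delta_same (i : β) (f : L) : delta i f i = f := if_pos rfl

lemma delta_of_ne {i t : β} (h : t ≠ i) (f : L) : delta i f t = 0 := if_neg h

lemma delta_add (i : β) (f g : L) : delta i (f + g) = delta i f + delta i g := by
  funext t
  by_cases h : t = i
  · subst h; simp [delta_same]
  · simp [delta_of_ne h]

lemma sum_delta (i : β) (f : L) : ∑ t, delta i f t = f := by
  rw [Finset.sum_eq_single i (fun t _ h => delta_of_ne h f) (fun h => absurd (Finset.mem_univ i) h),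
    delta_same]

end Delta

/-! ### Leading terms, and the independence of the monomials -/

section Independence

variable {K L : Type*} [Field K] [Field L] [Algebra K L] {n : ℕ} {hn : 2 ≤ n}
  {q : K} {β : Finset (Fin n → K)} (hst : IsStableB β)

lemma VarField.psiOp_delta (M : VarField K L n) (b : Fin n) (i : β) (f : L) :
    M.psiOp hst q b (delta i f) = delta (actB hst b i)
      (M.cSwap q b (actB hst b i) * M.s b f + M.cId b (actB hst b i) * f) := by
  funext t
  rw [M.psiOp_apply]
  by_cases h : t = actB hst b i
  · subst h
    rw [actB_actB, delta_same, delta_same]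
    rcases M.cId_eq_zero_or hst b (actB hst b i) with h1 | h1
    · rw [h1, zero_mul, zero_mul]
    · rw [actB_actB] at h1
      rw [← h1, delta_same]
  · have h' : actB hst b t ≠ i := fun h1 => h (by rw [← h1, actB_actB])
    rw [delta_of_ne h, delta_of_ne h', map_zero, mul_zero, zero_add]
    rcases M.cId_eq_zero_or hst b t with h1 | h1
    · rw [h1, zero_mul]
    · rw [delta_of_ne fun h2 => h' (h1.trans h2), mul_zero]

lemma VarField.yOp_delta (M : VarField K L n) (j : Fin n) (i : β) (f : L) :
    M.yOp β j (delta i f) = delta i (M.Y j * f) := by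
  funext t
  rw [M.yOp_apply]
  by_cases h : t = i
  · subst h; rw [delta_same, delta_same]
  · rw [delta_of_ne h, delta_of_ne h, mul_zero]

lemma VarField.eOp_delta_same (i : β) (f : L) :
    VarField.eOp (K := K) L i (delta i f) = delta i f := by
  funext t
  rw [VarField.eOp_apply]
  split_ifs with h
  · rfl
  · rw [delta_of_ne h]

lemma VarField.eOp_delta_of_ne {i i' : β} (h : i ≠ i') (f : L) :
    VarField.eOp (K := K) L i' (delta i f) = 0 := by
  funext t
  rw [VarField.eOp_apply]
  split_ifs with h1
  · subst h1; exact delta_of_ne h.symm f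
  · rfl

variable (M : WeylField K L n hn) (hq0 : q ≠ 0) (hq : q ^ 2 ≠ 1)
  (hnz : ∀ i ∈ β, ∀ k, i k ≠ 0)

/-- The representation of `W` on `L`-valued functions on `β`. -/
noncomputable def repW : AlgW q β →ₐ[K] Module.End K (β → L) :=
  (M.repV hst hq0 hq hnz).comp (phiHom q hst)

/-- The leading coefficient comes from `coeffSwap` and is nonzero because the variables are
distinct. For index 0, the outer factors of `ψ_0 ψ_1 ψ_0` conjugate the reflection `s_1` to `s_0`
and leave the identity term an identity term. -/
lemma repW_psi (a : Fin n) (i : β) : ∃ (j : β) (c d : L), c ≠ 0 ∧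
    ∀ f, repW hst M hq0 hq hnz (genW q (.psi a)) (delta i f) =
      delta j (c * M.act (simpleD hn a) f + d * f) := by
  have hc : ∀ (b : Fin n) (t : β), b.val ≠ 0 → M.cSwap q b t ≠ 0 := by
    intro b t hb
    rw [VarField.cSwap, if_neg hb]
    exact coeffSwap_ne_zero _ _ _ (sub_ne_zero.1 (M.Y_sub_ne_zero (pre_val_add_one hb)))
  by_cases ha : a.val = 0
  · set o : Fin n := ⟨1, hn⟩ with ho
    set j := actB hst o (actB hst a i) with hj
    refine ⟨actB hst a j, M.s a (M.cSwap q o j), M.s a (M.cId o j), ?_, fun f => ?_⟩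
    · exact (map_ne_zero (M.s a)).2 (hc o j (by simp [ho]))
    · have h0 : ∀ (i : β) (f : L), M.psiOp hst q a (delta i f) = delta (actB hst a i) (M.s a f) := by
        intro i f
        rw [M.psiOp_delta, VarField.cSwap, VarField.cId, if_pos ha, if_pos ha, one_mul, zero_mul,
          add_zero]
      rw [repW, AlgHom.comp_apply, phiHom_psi0 hst ha (o := o) rfl, conjV_apply, map_mul, map_mul,
        VarField.repV_gen, VarField.repV_gen, Module.End.mul_apply, Module.End.mul_apply]
      simp only [VarField.opGen]
      rw [h0, M.psiOp_delta, h0, M.act_zero a ha, map_add, map_mul, map_mul, M.s_s]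
  · refine ⟨actB hst a i, _, M.cId a (actB hst a i), hc a (actB hst a i) ha, fun f => ?_⟩
    rw [repW, AlgHom.comp_apply, phiHom_psi hst ha, VarField.repV_gen, M.act_pos a ha]
    exact M.psiOp_delta hst a i f

/-- The span of the operators given by the elements of the Weyl group with fewer than `k`
inversions. -/
noncomputable def lowerSpan (k : ℕ) : Submodule L (L → L) :=
  Submodule.span L ((fun w => (M.act w : L → L)) '' {w | lenD w < k})

lemma act_mem_lowerSpan {k : ℕ} {w : weylD n} (h : lenD w < k) :
    (M.act w : L → L) ∈ lowerSpan M k := Submodule.subset_span ⟨w, h, rfl⟩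

lemma lowerSpan_mono {k k' : ℕ} (h : k ≤ k') : lowerSpan M k ≤ lowerSpan M k' :=
  Submodule.span_mono (Set.image_mono fun _ hw => lt_of_lt_of_le hw h)

lemma act_comp_lowerSpan {k : ℕ} (a : Fin n) {T : L → L} (hT : T ∈ lowerSpan M k) :
    (fun f => M.act (simpleD hn a) (T f)) ∈ lowerSpan M (k + 1) := by
  induction hT using Submodule.span_induction with
  | mem T hT =>
    obtain ⟨w, hw, rfl⟩ := hT
    have h1 := act_mem_lowerSpan M (k := k + 1) (w := simpleD hn a * w)
      ((lenD_simple_mul_le hn w a).trans_lt (Nat.succ_lt_succ hw))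
    convert! h1 using 1
    funext f
    exact (M.act_mul _ _ _).symm
  | zero =>
    convert! zero_mem (lowerSpan M (k + 1)) using 1
    funext f
    exact map_zero _
  | add T T' _ _ h h' =>
    convert! add_mem h h' using 1
    funext f
    exact map_add _ _ _
  | smul c T _ h =>
    convert! Submodule.smul_mem _ (M.act (simpleD hn a) c) h using 1
    funext f
    exact map_mul _ _ _

/-- Applying a further `Ψ_a` multiplies the leading element by `s_a` and keeps its coefficient
nonzero. All other terms involve elements of fewer inversions than the new number of letters,
whether or not the word is reduced. -/
lemma repW_psiWord (as : List (Fin n)) (i : β) : ∃ (j : β) (c : L) (T : L → L), c ≠ 0 ∧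
    T ∈ lowerSpan M as.length ∧ ∀ f, repW hst M hq0 hq hnz (psiWord q β as) (delta i f) =
      delta j (c * M.act (wordW hn as) f + T f) := by
  induction as with
  | nil =>
    refine ⟨i, 1, 0, one_ne_zero, zero_mem _, fun f => ?_⟩
    rw [psiWord_nil, map_one, wordW_nil, M.act_one, one_mul, Pi.zero_apply, add_zero]
    rfl
  | cons a as ih =>
    obtain ⟨j, c, T, hc, hT, h⟩ := ih
    obtain ⟨j', p, d, hp, h'⟩ := repW_psi hst M hq0 hq hnz a j
    refine ⟨j', p * M.act (simpleD hn a) c,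
      p • (fun f => M.act (simpleD hn a) (T f)) + ((d * c) • (M.act (wordW hn as) : L → L) + d • T),
      mul_ne_zero hp ((map_ne_zero _).2 hc), ?_, fun f => ?_⟩
    · refine add_mem (Submodule.smul_mem _ _ (act_comp_lowerSpan M a hT)) (add_mem ?_ ?_)
      · exact Submodule.smul_mem _ _ (act_mem_lowerSpan M
          (Nat.lt_succ_of_le (lenD_wordW_le hn as)))
      · exact Submodule.smul_mem _ _ (lowerSpan_mono M (Nat.le_succ _) hT)
    · rw [psiWord_cons, map_mul, Module.End.mul_apply, h, h', wordW_cons, M.act_mul, map_add,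
        map_mul]
      congr 1
      simp only [Pi.add_apply, Pi.smul_apply, smul_eq_mul]
      ring

lemma repW_yEval (P : MvPolynomial (Fin n) K) (i : β) (f : L) :
    repW hst M hq0 hq hnz (yEval q β P) (delta i f) =
      delta i (MvPolynomial.aeval M.Y P * f) := by
  induction P using MvPolynomial.induction_on generalizing f with
  | C r =>
    rw [← MvPolynomial.algebraMap_eq, AlgHom.commutes, AlgHom.commutes, AlgHom.commutes]
    funext t
    rw [Module.algebraMap_end_apply, Pi.smul_apply, Algebra.smul_def]
    by_cases h : t = i
    · subst h; rw [delta_same, delta_same]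
    · rw [delta_of_ne h, delta_of_ne h, mul_zero]
  | add P Q hP hQ =>
    rw [map_add, map_add, map_add, LinearMap.add_apply, hP, hQ, add_mul, delta_add]
  | mul_X P j hP =>
    have h : repW hst M hq0 hq hnz (genW q (.y j)) (delta i f) = delta i (M.Y j * f) := by
      rw [repW, AlgHom.comp_apply, phiHom_y, VarField.repV_gen]
      exact M.yOp_delta j i f
    rw [map_mul, map_mul, map_mul, Module.End.mul_apply, yEval_X, h, hP, MvPolynomial.aeval_X,
      mul_assoc]

/-- The operators on `L` given by an element of `W`, summed over the components in the target. -/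
noncomputable def sumOp : AlgW q β →ₗ[K] β → L → L where
  toFun X i f := ∑ t, repW hst M hq0 hq hnz X (delta i f) t
  map_add' X X' := by
    funext i f
    simp [Finset.sum_add_distrib]
  map_smul' r X := by
    funext i f
    simp [Finset.smul_sum]

-- The factor `e(i)` selects the source component, and the polynomial multiplies the result.
-- Summation over the targets loses nothing, because a word maps one component into one component.
open Classical in
lemma sumOp_monomialW (m : Fin n → ℕ) (as : List (Fin n)) (i : β) :
    sumOp hst M hq0 hq hnz (monomialW q m as i) = Pi.single i
      (MvPolynomial.aeval M.Y
          (MvPolynomial.monomial (Finsupp.equivFunOnFinite.symm m) (1 : K)) •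
        sumOp hst M hq0 hq hnz (psiWord q β as) i) := by
  have he : ∀ i', repW hst M hq0 hq hnz (genW q (.e i')) = VarField.eOp L i' := by
    intro i'
    rw [repW, AlgHom.comp_apply, phiHom_e, VarField.repV_gen]
    rfl
  funext i' f
  change ∑ t, repW hst M hq0 hq hnz (monomialW q m as i) (delta i' f) t = _
  rw [monomialW_eq, map_mul, map_mul, Module.End.mul_apply, Module.End.mul_apply, he]
  by_cases h : i' = i
  · subst h
    obtain ⟨j, c, T, -, -, hw⟩ := repW_psiWord hst M hq0 hq hnz as i'
    rw [VarField.eOp_delta_same, Pi.single_eq_same, Pi.smul_apply, smul_eq_mul]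
    change _ = _ * ∑ t, repW hst M hq0 hq hnz (psiWord q β as) (delta i' f) t
    rw [hw, yMonomial_eq, repW_yEval, sum_delta, sum_delta]
  · rw [VarField.eOp_delta_of_ne h, map_zero, map_zero, Pi.single_eq_of_ne h]
    simp

/-- Dedekind's theorem on the independence of characters; `act_inj` supplies that the characters are
distinct. -/
lemma linearIndependent_act : LinearIndependent L fun w : weylD n => (M.act w : L → L) :=
  (linearIndependent_monoidHom L L).comp (fun w : weylD n => ((M.act w : L →ₐ[K] L) : L →* L))
    fun _ _ h => M.act_inj (AlgHom.ext fun x => DFunLike.congr_fun h x)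

/-- For a reduced word the number of letters is `lenD w`, so all lower terms have smaller length and
the system is triangular over the elements of the Weyl group. -/
lemma linearIndependent_sumOp_psiWord {word : weylD n → List (Fin n)}
    (hword : ∀ w, IsReducedD w (word w)) (i : β) :
    LinearIndependent L fun w : weylD n =>
      sumOp hst M hq0 hq hnz (psiWord q β (word w)) i := by
  choose j c T hc hT hw using fun w => repW_psiWord hst M hq0 hq hnz (word w) i
  refine linearIndependent_of_triangular (linearIndependent_act M) lenD c hc fun w => ?_
  have h := hT w
  rw [(hword w).length_eq hn] at h
  have h1 : sumOp hst M hq0 hq hnz (psiWord q β (word w)) i - c w • (M.act w : L → L) = T w := by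
    funext f
    change ∑ t, repW hst M hq0 hq hnz (psiWord q β (word w)) (delta i f) t - c w * M.act w f = _
    rw [hw, sum_delta, (hword w).wordW_eq hn, add_sub_cancel_left]
  rw [h1]
  exact h

lemma linearIndependent_aeval_monomial : LinearIndependent K fun m : Fin n → ℕ =>
    MvPolynomial.aeval M.Y (MvPolynomial.monomial (Finsupp.equivFunOnFinite.symm m) (1 : K)) := by
  have h1 := (MvPolynomial.basisMonomials (Fin n) K).linearIndependent
  rw [MvPolynomial.coe_basisMonomials] at h1
  have h2 := h1.map' (MvPolynomial.aeval M.Y : MvPolynomial (Fin n) K →ₐ[K] L).toLinearMap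
    (LinearMap.ker_eq_bot.2 M.aeval_inj)
  exact h2.comp _ Finsupp.equivFunOnFinite.symm.injective

theorem linearIndependent_sumOp_monomialW {word : weylD n → List (Fin n)}
    (hword : ∀ w, IsReducedD w (word w)) :
    LinearIndependent K fun x : weylD n × (Fin n → ℕ) × β =>
      sumOp hst M hq0 hq hnz (monomialW q x.2.1 (word x.1) x.2.2) := by
  classical
  have h := linearIndependent_single_smul
    (a := fun m : Fin n → ℕ => MvPolynomial.aeval M.Y
      (MvPolynomial.monomial (Finsupp.equivFunOnFinite.symm m) (1 : K)))
    (c := fun i w => sumOp hst M hq0 hq hnz (psiWord q β (word w)) i)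
    (linearIndependent_aeval_monomial M) (linearIndependent_sumOp_psiWord hst M hq0 hq hnz hword)
  have heq : (fun x : weylD n × (Fin n → ℕ) × β =>
      sumOp hst M hq0 hq hnz (monomialW q x.2.1 (word x.1) x.2.2)) = _ :=
    funext fun x => sumOp_monomialW hst M hq0 hq hnz x.2.1 (word x.1) x.2.2
  rw [heq]
  exact h

end Independence

/-! ### Rational functions with the action of the Weyl group -/

section RationalFunctions

variable (K : Type*) [Field K] {n : ℕ}

/-- The linear form with given integral coefficients. -/
noncomputable def linForm : (Fin n → ℤ) →+ MvPolynomial (Fin n) K where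
  toFun v := ∑ k, v k • MvPolynomial.X k
  map_zero' := by simp
  map_add' v w := by simp [add_smul, Finset.sum_add_distrib]

lemma linForm_single (k : Fin n) (c : ℤ) :
    linForm K (Pi.single k c) = c • MvPolynomial.X k := by
  change ∑ j, (Pi.single k c : Fin n → ℤ) j • MvPolynomial.X j = _
  rw [Finset.sum_eq_single k]
  · simp
  · intro j _ hj
    simp [Pi.single_eq_of_ne hj]
  · simp

lemma coeff_linForm (v : Fin n → ℤ) (k : Fin n) :
    MvPolynomial.coeff (Finsupp.single k 1) (linForm K v) = (v k : K) := by
  classical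
  change MvPolynomial.coeff _ (∑ j, v j • MvPolynomial.X j) = _
  simp only [MvPolynomial.coeff_sum, zsmul_eq_mul, ← map_intCast (MvPolynomial.C (R := K)),
    MvPolynomial.coeff_C_mul, MvPolynomial.coeff_X]
  simp [Finsupp.single_left_inj]

/-- The substitution of the variables given by an endomorphism of the lattice. -/
noncomputable def substHom (g : (Fin n → ℤ) →ₗ[ℤ] (Fin n → ℤ)) :
    MvPolynomial (Fin n) K →ₐ[K] MvPolynomial (Fin n) K :=
  MvPolynomial.aeval fun j => linForm K (g (Pi.single j 1))

lemma substHom_X (g : (Fin n → ℤ) →ₗ[ℤ] (Fin n → ℤ)) (j : Fin n) :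
    substHom K g (MvPolynomial.X j) = linForm K (g (Pi.single j 1)) :=
  MvPolynomial.aeval_X _ _

lemma substHom_linForm (g : (Fin n → ℤ) →ₗ[ℤ] (Fin n → ℤ)) (v : Fin n → ℤ) :
    substHom K g (linForm K v) = linForm K (g v) := by
  change substHom K g (∑ k, v k • MvPolynomial.X k) = _
  have hv : v = ∑ k, v k • (Pi.single k 1 : Fin n → ℤ) := by
    funext j; simp [Finset.sum_apply, Pi.single_apply]
  conv_rhs => rw [hv]
  simp only [map_sum, map_zsmul, map_smul, substHom_X]

lemma substHom_comp (g h : (Fin n → ℤ) →ₗ[ℤ] (Fin n → ℤ)) :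
    (substHom K g).comp (substHom K h) = substHom K (g.comp h) := by
  apply MvPolynomial.algHom_ext
  intro j
  rw [AlgHom.comp_apply, substHom_X, substHom_linForm, substHom_X, LinearMap.comp_apply]

lemma substHom_id : substHom K (LinearMap.id : (Fin n → ℤ) →ₗ[ℤ] (Fin n → ℤ)) =
    AlgHom.id K _ := by
  apply MvPolynomial.algHom_ext
  intro j
  rw [substHom_X, LinearMap.id_apply, linForm_single, one_smul, AlgHom.id_apply]

/-- The substitution of the variables given by an automorphism of the lattice. -/
noncomputable def substEquiv (g : (Fin n → ℤ) ≃ₗ[ℤ] (Fin n → ℤ)) :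
    MvPolynomial (Fin n) K ≃ₐ[K] MvPolynomial (Fin n) K :=
  AlgEquiv.ofAlgHom (substHom K g.toLinearMap) (substHom K g.symm.toLinearMap)
    (by rw [substHom_comp, LinearEquiv.comp_symm, substHom_id])
    (by rw [substHom_comp, LinearEquiv.symm_comp, substHom_id])

variable (n) in
/-- The field of rational functions. -/
abbrev RatField : Type _ := FractionRing (MvPolynomial (Fin n) K)

/-- The action of an automorphism of the lattice on rational functions. -/
noncomputable def ratAct (g : (Fin n → ℤ) ≃ₗ[ℤ] (Fin n → ℤ)) : RatField K n →ₐ[K] RatField K n :=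
  (IsFractionRing.algEquivOfAlgEquiv (substEquiv K g) : RatField K n ≃ₐ[K] RatField K n).toAlgHom

lemma ratAct_algebraMap (g : (Fin n → ℤ) ≃ₗ[ℤ] (Fin n → ℤ)) (P : MvPolynomial (Fin n) K) :
    ratAct K g (algebraMap _ _ P) = algebraMap _ _ (substHom K g.toLinearMap P) :=
  IsFractionRing.algEquivOfAlgEquiv_algebraMap (substEquiv K g) P

/-- The variables as rational functions. -/
noncomputable def ratVar (j : Fin n) : RatField K n :=
  algebraMap (MvPolynomial (Fin n) K) (RatField K n) (MvPolynomial.X j)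

lemma ratAct_ratVar (g : (Fin n → ℤ) ≃ₗ[ℤ] (Fin n → ℤ)) (j : Fin n) :
    ratAct K g (ratVar K j) = algebraMap _ _ (linForm K (g (Pi.single j 1))) := by
  rw [ratVar, ratAct_algebraMap, substHom_X]
  rfl

lemma ratField_hom_ext (f g : RatField K n →ₐ[K] RatField K n)
    (h : ∀ j, f (ratVar K j) = g (ratVar K j)) : f = g := by
  have h1 : f.comp (IsScalarTower.toAlgHom K (MvPolynomial (Fin n) K) (RatField K n)) =
      g.comp (IsScalarTower.toAlgHom K (MvPolynomial (Fin n) K) (RatField K n)) :=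
    MvPolynomial.algHom_ext h
  have h2 : ∀ P, f (algebraMap (MvPolynomial (Fin n) K) _ P) =
      g (algebraMap (MvPolynomial (Fin n) K) _ P) := fun P => DFunLike.congr_fun h1 P
  apply AlgHom.ext
  intro x
  obtain ⟨a, b, -, rfl⟩ := IsFractionRing.div_surjective (MvPolynomial (Fin n) K) x
  rw [map_div₀, map_div₀, h2, h2]

/-- The sign change of one coordinate. -/
def signFlip (b : Fin n) : (Fin n → ℤ) ≃ₗ[ℤ] (Fin n → ℤ) :=
  LinearEquiv.ofInvolutive
    { toFun := fun x j => if j = b then -x j else x j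
      map_add' := fun x y => by
        funext j
        simp only [Pi.add_apply]
        split_ifs
        · ring
        · rfl
      map_smul' := fun c x => by
        funext j
        simp only [Pi.smul_apply, smul_eq_mul, RingHom.id_apply]
        split_ifs
        · ring
        · rfl }
    (fun x => by
      funext j
      change (if j = b then -(if j = b then -x j else x j) else (if j = b then -x j else x j)) = x j
      split_ifs
      · rw [neg_neg]
      · rfl)

lemma signFlip_apply (b : Fin n) (x : Fin n → ℤ) (j : Fin n) :
    signFlip b x j = if j = b then -x j else x j := rfl

lemma signFlip_single_same (b : Fin n) : signFlip b (Pi.single b 1) = Pi.single b (-1) := by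
  funext j
  rw [signFlip_apply]
  by_cases h : j = b
  · subst h; simp
  · simp [h]

lemma signFlip_single_of_ne {b j : Fin n} (h : j ≠ b) :
    signFlip b (Pi.single j 1) = Pi.single j 1 := by
  funext k
  rw [signFlip_apply]
  by_cases h1 : k = b
  · subst h1; simp [h.symm]
  · simp [h1]

lemma rootReflection_single_pos {b : Fin n} (hb : b.val ≠ 0) (j : Fin n) :
    rootReflection (simpleRootD b) (Pi.single j 1) =
      Pi.single (Equiv.swap (pre b) b j) 1 := by
  have h := pre_ne hb
  rw [rootReflection_apply, dotProduct_comm, dot_simpleRootD_pos hb, simpleRootD_pos hb]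
  change Pi.single j 1 - ((Pi.single j 1 : Fin n → ℤ) b - (Pi.single j 1 : Fin n → ℤ) (pre b)) •
    (Pi.single b 1 - Pi.single (pre b) 1) = _
  by_cases h1 : j = b
  · subst h1
    simp [h]
  by_cases h2 : j = pre b
  · subst h2
    simp [h.symm]
  · simp [Equiv.swap_apply_of_ne_of_ne h2 h1, Ne.symm h1, Ne.symm h2]

lemma rootReflection_single_zero (hn : 2 ≤ n) {z : Fin n} (hz : z.val = 0) (j : Fin n) :
    rootReflection (simpleRootD z) (Pi.single j 1) =
      if j = z then Pi.single ⟨1, hn⟩ (-1) else if j = ⟨1, hn⟩ then Pi.single z (-1)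
        else Pi.single j 1 := by
  have hz' : z = ⟨0, by omega⟩ := Fin.ext hz
  have h01 : (⟨0, by omega⟩ : Fin n) ≠ ⟨1, hn⟩ := by simp
  rw [rootReflection_apply, dotProduct_comm, dot_simpleRootD_zero hn hz, simpleRootD_zero hn hz, hz']
  split_ifs with h1 h2
  · subst h1
    simp [h01.symm, Pi.single_neg]
  · subst h2
    simp [h01, Pi.single_neg]
  · simp [Ne.symm h1, Ne.symm h2]

lemma weylD_single_entry (w : weylD n) (j k : Fin n) :
    w.1 (Pi.single j 1) k = 0 ∨ w.1 (Pi.single j 1) k = 1 ∨ w.1 (Pi.single j 1) k = -1 := by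
  have h := sq_le_dotProduct_self (w.1 (Pi.single j 1)) k
  rw [weylD_dot] at h
  by_cases h0 : w.1 (Pi.single j 1) k = 0
  · exact Or.inl h0
  · exact Or.inr (int_eq_one_or_neg_one h0 (h.trans (by simp)))

lemma ratAct_mul (g h : (Fin n → ℤ) ≃ₗ[ℤ] (Fin n → ℤ)) (x : RatField K n) :
    ratAct K (g * h) x = ratAct K g (ratAct K h x) := by
  have : ratAct K (g * h) = (ratAct K g).comp (ratAct K h) := by
    apply ratField_hom_ext
    intro j
    rw [AlgHom.comp_apply, ratAct_ratVar, ratAct_ratVar, ratAct_algebraMap, substHom_linForm]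
    rfl
  rw [this, AlgHom.comp_apply]

lemma ratAct_one (x : RatField K n) : ratAct K 1 x = x := by
  have : ratAct K 1 = AlgHom.id K (RatField K n) := by
    apply ratField_hom_ext
    intro j
    rw [ratAct_ratVar, AlgHom.id_apply]
    change algebraMap _ _ (linForm K (Pi.single j 1)) = _
    rw [linForm_single, one_smul, ratVar]
  rw [this, AlgHom.id_apply]

lemma ratVar_injective : Function.Injective (ratVar K (n := n)) := fun _ _ h =>
  MvPolynomial.X_injective (IsFractionRing.injective (MvPolynomial (Fin n) K) (RatField K n) h)

/-- The action on the variables gives the matrix of the element with entries reduced to `K`. The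
integral entries are `0`, `1` or `-1`, which remain distinct in `K` because `2 ≠ 0`. -/
lemma ratAct_weylD_injective (h2 : (2 : K) ≠ 0) :
    Function.Injective fun w : weylD n => ratAct K w.1 := by
  intro v w h
  apply Subtype.ext
  apply LinearEquiv.toLinearMap_injective
  apply LinearMap.pi_ext'
  intro j
  ext1
  funext k
  have h1 := DFunLike.congr_fun h (ratVar K j)
  simp only [ratAct_ratVar] at h1
  have h3 := congrArg (MvPolynomial.coeff (Finsupp.single k 1))
    (IsFractionRing.injective (MvPolynomial (Fin n) K) (RatField K n) h1)
  rw [coeff_linForm, coeff_linForm] at h3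
  change v.1 (Pi.single j 1) k = w.1 (Pi.single j 1) k
  have hn1 : (-1 : K) ≠ 1 := fun h => h2 (by linear_combination -h)
  rcases weylD_single_entry v j k with e | e | e <;>
    rcases weylD_single_entry w j k with e' | e' | e' <;> rw [e, e'] at h3 ⊢ <;>
    simp [hn1, hn1.symm] at h3

/-- The rational functions with the action of the Weyl group. -/
noncomputable def ratWeylField (h2 : (2 : K) ≠ 0) (hn : 2 ≤ n) : WeylField K (RatField K n) n hn where
  Y := ratVar K
  Y_inj := ratVar_injective K
  hom_ext := ratField_hom_ext K
  -- The sign change of one coordinate is not in the Weyl group of type D; `ratAct` is defined for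
  -- all automorphisms of the lattice and so covers it.
  s b := if b.val = 0 then ratAct K (signFlip b) else ratAct K (simpleD hn b).1
  s_pos b j hb := by
    rw [if_neg hb, ratAct_ratVar, simpleD_apply, rootReflection_single_pos hb, linForm_single,
      one_smul, ratVar]
  s_zero_same b hb := by
    rw [if_pos hb, ratAct_ratVar, signFlip_single_same, linForm_single, neg_one_smul, map_neg, ratVar]
  s_zero_ne b j hb hj := by
    rw [if_pos hb, ratAct_ratVar, signFlip_single_of_ne hj, linForm_single, one_smul, ratVar]
  act w := ratAct K w.1
  act_one := ratAct_one K
  act_mul v w := ratAct_mul K v.1 w.1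
  act_pos b hb x := by rw [if_neg hb]
  act_zero z hz x := by
    rw [if_pos hz, if_neg (by simp), ← ratAct_mul, ← ratAct_mul]
    congr 2
    apply LinearEquiv.toLinearMap_injective
    apply LinearMap.pi_ext'
    intro j
    ext1
    -- The reflection in `ε_1 + ε_2` is the one in `ε_2 - ε_1` conjugated by the sign change of
    -- `ε_1`; this is checked on basis vectors.
    change rootReflection _ (Pi.single j 1) =
      signFlip z (rootReflection (simpleRootD ⟨1, hn⟩) (signFlip z (Pi.single j 1)))
    have h01 : (⟨1, hn⟩ : Fin n) ≠ z := fun h => by rw [← h] at hz; simp at hz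
    have hp : pre (⟨1, hn⟩ : Fin n) = z := (eq_pre (by simp [hz])).symm
    rw [rootReflection_single_zero hn hz]
    split_ifs with e1 e2
    · subst e1
      rw [signFlip_single_same, Pi.single_neg j, map_neg, map_neg, rootReflection_single_pos (by simp),
        hp, Equiv.swap_apply_left, signFlip_single_of_ne h01, Pi.single_neg]
    · subst e2
      rw [signFlip_single_of_ne h01, rootReflection_single_pos (by simp), hp,
        Equiv.swap_apply_right, signFlip_single_same]
    · rw [signFlip_single_of_ne e1, rootReflection_single_pos (by simp), hp,
        Equiv.swap_apply_of_ne_of_ne e1 e2, signFlip_single_of_ne e1]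
  act_inj := ratAct_weylD_injective K h2
  aeval_inj := by
    have : (MvPolynomial.aeval (ratVar K) : MvPolynomial (Fin n) K →ₐ[K] RatField K n) =
        IsScalarTower.toAlgHom K (MvPolynomial (Fin n) K) (RatField K n) := by
      apply MvPolynomial.algHom_ext
      intro j
      rw [MvPolynomial.aeval_X]
      rfl
    rw [this]
    exact IsFractionRing.injective (MvPolynomial (Fin n) K) (RatField K n)

end RationalFunctions

section VertexSet

variable {K : Type*} [Field K]

lemma ne_zero_of_mem_vertexSet {q : K} (hq0 : q ≠ 0) {l : ℕ} {lam : Fin l → K}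
    (hlam : ∀ a, lam a ≠ 0) {x : K} (hx : x ∈ vertexSet q lam) : x ≠ 0 := by
  obtain ⟨a, ε, m, -, rfl⟩ := Set.mem_iUnion.1 hx
  exact mul_ne_zero (zpow_ne_zero _ (hlam a)) (zpow_ne_zero _ hq0)

end VertexSet

/-! ### The basis of W and the injectivity of the homomorphism -/

section Main

variable {K : Type*} [Field K] {n : ℕ} {q : K} {β : Finset (Fin n → K)}

/-- The basis of `W` that consists of the elements `y^m Ψ_w e(i)`. -/
noncomputable def basisW (h2 : (2 : K) ≠ 0) (hn : 2 ≤ n) (hst : IsStableB β) (hq0 : q ≠ 0)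
    (hq : q ^ 2 ≠ 1) (hnz : ∀ i ∈ β, ∀ k, i k ≠ 0) {word : weylD n → List (Fin n)}
    (hword : ∀ w, IsReducedD w (word w)) :
    Module.Basis (weylD n × (Fin n → ℕ) × β) K (AlgW q β) :=
  Module.Basis.mk
    (LinearIndependent.of_comp (sumOp hst (ratWeylField K h2 hn) hq0 hq hnz)
      (linearIndependent_sumOp_monomialW hst (ratWeylField K h2 hn) hq0 hq hnz hword))
    (basisSpan_eq_top hq0 hst hn hword).ge

lemma basisW_apply (h2 : (2 : K) ≠ 0) (hn : 2 ≤ n) (hst : IsStableB β) (hq0 : q ≠ 0)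
    (hq : q ^ 2 ≠ 1) (hnz : ∀ i ∈ β, ∀ k, i k ≠ 0) {word : weylD n → List (Fin n)}
    (hword : ∀ w, IsReducedD w (word w)) (x : weylD n × (Fin n → ℕ) × β) :
    basisW h2 hn hst hq0 hq hnz hword x = monomialW q x.2.1 (word x.1) x.2.2 :=
  Module.Basis.mk_apply _ _ x

/-- The map `sumOp` sends a basis of W to an independent family, so it is injective; and it depends
on an element of W only through its image in V. -/
lemma phiHom_injective (h2 : (2 : K) ≠ 0) (hn : 2 ≤ n) (hst : IsStableB β) (hq0 : q ≠ 0)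
    (hq : q ^ 2 ≠ 1) (hnz : ∀ i ∈ β, ∀ k, i k ≠ 0) {word : weylD n → List (Fin n)}
    (hword : ∀ w, IsReducedD w (word w)) : Function.Injective (phiHom q hst) := by
  have hinj : Function.Injective (sumOp hst (ratWeylField K h2 hn) hq0 hq hnz) := by
    rw [← LinearMap.ker_eq_bot, LinearMap.ker_eq_bot']
    intro x hx
    have hli := linearIndependent_sumOp_monomialW hst (ratWeylField K h2 hn) hq0 hq hnz hword
    set b := basisW h2 hn hst hq0 hq hnz hword with hb
    have h0 := linearIndependent_iff.1 hli (b.repr x) (by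
      have hcoe : (fun x : weylD n × (Fin n → ℕ) × β =>
          sumOp hst (ratWeylField K h2 hn) hq0 hq hnz (monomialW q x.2.1 (word x.1) x.2.2)) =
          sumOp hst (ratWeylField K h2 hn) hq0 hq hnz ∘ b := by
        funext x
        rw [Function.comp_apply, hb, basisW_apply]
      rw [hcoe, ← Finsupp.apply_linearCombination, b.linearCombination_repr, hx])
    exact b.repr.map_eq_zero_iff.1 h0
  intro x x' h
  apply hinj
  funext i f
  change ∑ t, (VarField.repV _ hst hq0 hq hnz) (phiHom q hst x) (delta i f) t =
    ∑ t, (VarField.repV _ hst hq0 hq hnz) (phiHom q hst x') (delta i f) t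
  rw [h]

end Main

end QuiverHecke

theorem mainTheorem2 {K : Type*} [Field K] (h2 : (2 : K) ≠ 0)
    (q : K) (hq0 : q ≠ 0) (hq : q ^ 2 ≠ 1)
    {l : ℕ} (lam : Fin l → K) (hlam : ∀ a, lam a ≠ 0)
    (hdisj : ∀ a b, a ≠ b →
      QuiverHecke.vertexClass q (lam a) ∩ QuiverHecke.vertexClass q (lam b) = ∅)
    {n : ℕ} (hn : 2 ≤ n) (β : Finset (Fin n → K))
    (hβ : ∀ i ∈ β, ∀ k, i k ∈ QuiverHecke.vertexSet q lam)
    (hstable : QuiverHecke.IsStableB β)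
    (word : QuiverHecke.weylD n → List (Fin n))
    (hword : ∀ w, QuiverHecke.IsReducedD w (word w)) :
    (∃ D : Module.Basis (QuiverHecke.weylD n × (Fin n → ℕ) × β) K (QuiverHecke.AlgW q β),
      ∀ w m i, D (w, m, i) = QuiverHecke.monomialW q m (word w) i) ∧
    (∃ φ : QuiverHecke.AlgW q β ≃ₐ[K] QuiverHecke.fixedV q β,
      (φ (QuiverHecke.genW q (.psi ⟨0, by omega⟩)) : QuiverHecke.AlgV q β) =
          QuiverHecke.genV q (.psi ⟨0, by omega⟩) * QuiverHecke.genV q (.psi ⟨1, by omega⟩) *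
            QuiverHecke.genV q (.psi ⟨0, by omega⟩) ∧
      (∀ b : Fin n, b.val ≠ 0 →
        (φ (QuiverHecke.genW q (.psi b)) : QuiverHecke.AlgV q β) = QuiverHecke.genV q (.psi b)) ∧
      (∀ j : Fin n,
        (φ (QuiverHecke.genW q (.y j)) : QuiverHecke.AlgV q β) = QuiverHecke.genV q (.y j)) ∧
      (∀ i : β,
        (φ (QuiverHecke.genW q (.e i)) : QuiverHecke.AlgV q β) = QuiverHecke.genV q (.e i))) := by
  have hnz : ∀ i ∈ β, ∀ k, i k ≠ 0 := fun i hi k =>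
    QuiverHecke.ne_zero_of_mem_vertexSet hq0 hlam (hβ i hi k)
  have hinj := QuiverHecke.phiHom_injective h2 hn hstable hq0 hq hnz hword
  refine ⟨⟨QuiverHecke.basisW h2 hn hstable hq0 hq hnz hword,
      fun w m i => QuiverHecke.basisW_apply h2 hn hstable hq0 hq hnz hword (w, m, i)⟩,
    QuiverHecke.phiEquiv h2 hstable hn hinj, ?_, fun b hb => ?_, fun j => ?_, fun i => ?_⟩
  · rw [QuiverHecke.phiEquiv_coe, QuiverHecke.phiHom_psi0 hstable (z := ⟨0, by omega⟩)
      (o := ⟨1, by omega⟩) rfl rfl, QuiverHecke.conjV_apply]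
  · rw [QuiverHecke.phiEquiv_coe, QuiverHecke.phiHom_psi hstable hb]
  · rw [QuiverHecke.phiEquiv_coe, QuiverHecke.phiHom_y]
  · rw [QuiverHecke.phiEquiv_coe, QuiverHecke.phiHom_e]
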